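/- For a category $\mathcal C$ with pullbacks let $\mathrm{Span}(\mathcal C)$ be the simplicial set whose $n$-cells are the functors $F:C_n\to\mathcal C$, where $C_n$ is the poset of nonempty subintervals of $\{0,\dots,n\}$ ordered by reverse inclusion, such that for all $I,J\in C_n$ with $I\cap J\neq\emptyset$ the square formed by $F(I\cup J)$, $F(I)$, $F(J)$, $F(I\cap J)$ is a pullback. Thus a $1$-cell is a span $Z_0\leftarrow Z_{01}\to Z_1$ in $\mathcal C$, regarded as an edge from $Z_0$ to $Z_1$. Put $\mathrm{Span}=\mathrm{Span}(\mathrm{FinSet})$ and $\mathrm{Span}^\times=\mathrm{Span}(\mathrm{Arr}(\mathrm{FinSet}))$, where $\mathrm{Arr}(\mathrm{FinSet})$ is the category of arrows of finite sets, and let $p:\mathrm{Span}^\times\to\mathrm{Span}$ be the map induced by the codomain functor $(X\to Y)\mapsto Y$. For a map $p:\mathcal C\to\mathcal D$ of simplicial sets, an edge $f:x\to y$ of $\mathcal C$ is called $p$-cartesian if the natural map $\mathcal C_{/f}\to\mathcal C_{/y}\times_{\mathcal D_{/py}}\mathcal D_{/pf}$ has the right lifting property with respect to all inclusions $\partial\Delta^m\to\Delta^m$,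 $m\ge 0$. A map $p:\mathcal C\to\mathcal D$ of quasicategories is a cartesian fibration if it is an inner fibration and if for every edge $g:x\to y$ of $\mathcal D$ and every vertex $\tilde y$ of $\mathcal C$ with $p(\tilde y)=y$ there is a $p$-cartesian edge with target $\tilde y$ that $p$ maps to $g$. Theorem. Let $F$ be the $1$-cell of $\mathrm{Span}^\times$ given by the commutative diagram of finite sets $$\begin{array}{ccccc}X_0&\xleftarrow{\ \lambda^X_{01}\ }&X_{01}&\xrightarrow{\ \rho^X_{01}\ }&X_1\\ \downarrow&&\downarrow&&\downarrow\\ Y_0&\xleftarrow{\ \lambda^Y_{01}\ }&Y_{01}&\xrightarrow{\ \rho^Y_{01}\ }&Y_1,\end{array}$$ so that $p(F)$ is its bottom row. Then $F$ is $p$-cartesian if and only if the right-hand square is a pullback and $\lambda^X_{01}$ is an isomorphism. Moreover $\mathrm{Span}^\times$ and $\mathrm{Span}$ are quasicategories, and $p$ is a cartesian fibration. -/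

import Mathlib

open CategoryTheory CategoryTheory.Limits Opposite Simplicial

universe v v' u u' w

/-! ## Overcategories, cartesian edges and cartesian fibrations of simplicial sets -/

/-- The ordinal sum `[a] ⋆ [b] = [a + 1 + b]`: first the elements of `[a]`, then those of `[b]`. -/
abbrev ordinalSum (a b : SimplexCategory) : SimplexCategory := ⦋a.len + 1 + b.len⦌

/-- The map `φ ⋆ θ` of ordinal sums, given by `φ` on the first summand and by `θ` on the
second one. -/
def ordinalSumMap {a a' b b' : SimplexCategory} (φ : a ⟶ a') (θ : b ⟶ b') :
    ordinalSum a b ⟶ ordinalSum a' b' :=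
  SimplexCategory.Hom.mk
    { toFun := Fin.addCases (m := a.len + 1) (n := b.len + 1)
        (motive := fun _ => Fin (a'.len + 1 + (b'.len + 1)))
        (fun i => Fin.castAdd (b'.len + 1) (φ.toOrderHom i))
        (fun j => Fin.natAdd (a'.len + 1) (θ.toOrderHom j))
      monotone' := by
        intro x y
        refine Fin.addCases (m := a.len + 1) (n := b.len + 1) (fun i => ?_) (fun i => ?_) x <;>
        refine Fin.addCases (m := a.len + 1) (n := b.len + 1) (fun j => ?_) (fun j => ?_) y <;>
        intro h
        · rw [Fin.addCases_left, Fin.addCases_left]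
          exact φ.toOrderHom.monotone (show i ≤ j from h)
        · rw [Fin.addCases_left, Fin.addCases_right]
          have := (φ.toOrderHom i).isLt
          change ((φ.toOrderHom i : Fin _) : ℕ) ≤ a'.len + 1 + (θ.toOrderHom j : Fin _)
          omega
        · exfalso
          have h' : a.len + 1 + (i : ℕ) ≤ (j : ℕ) := h
          omega
        · rw [Fin.addCases_right, Fin.addCases_right]
          have h' : a.len + 1 + (i : ℕ) ≤ a.len + 1 + (j : ℕ) := h
          have h'' : ((θ.toOrderHom i : Fin _) : ℕ) ≤ (θ.toOrderHom j : Fin _) :=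
            θ.toOrderHom.monotone (show (i : ℕ) ≤ (j : ℕ) by omega)
          change a'.len + 1 + ((θ.toOrderHom i : Fin _) : ℕ) ≤
            a'.len + 1 + (θ.toOrderHom j : Fin _)
          omega }

/-- The inclusion of the second summand `[b]` into `[a] ⋆ [b]`. -/
def ordinalSumInr (a b : SimplexCategory) : b ⟶ ordinalSum a b :=
  SimplexCategory.Hom.mk
    { toFun := fun j => Fin.natAdd (a.len + 1) j
      monotone' := fun i j h => by
        have h' : (i : ℕ) ≤ (j : ℕ) := h
        change a.len + 1 + (i : ℕ) ≤ a.len + 1 + (j : ℕ)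
        omega }

lemma ordinalSumMap_left {a a' b b' : SimplexCategory} (φ : a ⟶ a') (θ : b ⟶ b')
    (i : Fin (a.len + 1)) :
    (ordinalSumMap φ θ).toOrderHom (Fin.castAdd (b.len + 1) i : Fin (a.len + 1 + (b.len + 1))) =
      (Fin.castAdd (b'.len + 1) (φ.toOrderHom i) : Fin (a'.len + 1 + (b'.len + 1))) :=
  Fin.addCases_left (motive := fun _ => Fin (a'.len + 1 + (b'.len + 1)))
    (left := fun i => Fin.castAdd (b'.len + 1) (φ.toOrderHom i))
    (right := fun j => Fin.natAdd (a'.len + 1) (θ.toOrderHom j)) i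

lemma ordinalSumMap_right {a a' b b' : SimplexCategory} (φ : a ⟶ a') (θ : b ⟶ b')
    (j : Fin (b.len + 1)) :
    (ordinalSumMap φ θ).toOrderHom (Fin.natAdd (a.len + 1) j : Fin (a.len + 1 + (b.len + 1))) =
      (Fin.natAdd (a'.len + 1) (θ.toOrderHom j) : Fin (a'.len + 1 + (b'.len + 1))) :=
  Fin.addCases_right (motive := fun _ => Fin (a'.len + 1 + (b'.len + 1)))
    (left := fun i => Fin.castAdd (b'.len + 1) (φ.toOrderHom i))
    (right := fun j => Fin.natAdd (a'.len + 1) (θ.toOrderHom j)) j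

lemma ordinalSumMap_id (a b : SimplexCategory) :
    ordinalSumMap (𝟙 a) (𝟙 b) = 𝟙 (ordinalSum a b) := by
  apply SimplexCategory.Hom.ext
  apply OrderHom.ext
  funext x
  refine Fin.addCases (m := a.len + 1) (n := b.len + 1) (fun i => ?_) (fun i => ?_) x
  · exact ordinalSumMap_left _ _ i
  · exact ordinalSumMap_right _ _ i

lemma ordinalSumMap_comp {a a' a'' b b' b'' : SimplexCategory} (φ : a ⟶ a') (φ' : a' ⟶ a'')
    (θ : b ⟶ b') (θ' : b' ⟶ b'') :
    ordinalSumMap (φ ≫ φ') (θ ≫ θ') = ordinalSumMap φ θ ≫ ordinalSumMap φ' θ' := by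
  apply SimplexCategory.Hom.ext
  apply OrderHom.ext
  funext x
  refine Fin.addCases (m := a.len + 1) (n := b.len + 1) (fun i => ?_) (fun i => ?_) x
  · exact (ordinalSumMap_left _ _ i).trans (((congrArg (ordinalSumMap φ' θ').toOrderHom
      (ordinalSumMap_left φ θ i)).trans (ordinalSumMap_left _ _ _)).symm)
  · exact (ordinalSumMap_right _ _ i).trans (((congrArg (ordinalSumMap φ' θ').toOrderHom
      (ordinalSumMap_right φ θ i)).trans (ordinalSumMap_right _ _ _)).symm)

lemma ordinalSumInr_comp {a a' b b' : SimplexCategory} (φ : a ⟶ a') (θ : b ⟶ b') :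
    ordinalSumInr a b ≫ ordinalSumMap φ θ = θ ≫ ordinalSumInr a' b' := by
  apply SimplexCategory.Hom.ext
  apply OrderHom.ext
  funext x
  exact ordinalSumMap_right φ θ x

/-- The overcategory `C_{/σ}` of a simplicial set over a simplex `σ : Δ^k → C`. Its `n`-simplices
are the maps `Δ^n ⋆ Δ^k → C` that restrict to `σ` on `Δ^k`. As `Δ^n ⋆ Δ^k = Δ^{n+1+k}`, these are
the `(n+1+k)`-simplices of `C` whose face spanned by the last `k + 1` vertices is `σ`. -/
def overSSet (C : SSet.{w}) {k : SimplexCategory} (σ : C.obj (op k)) : SSet.{w} where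
  obj n := { τ : C.obj (op (ordinalSum n.unop k)) // C.map (ordinalSumInr n.unop k).op τ = σ }
  map φ := ↾fun τ => ⟨C.map (ordinalSumMap φ.unop (𝟙 k)).op τ.1, by
    have h := ordinalSumInr_comp φ.unop (𝟙 k)
    rw [Category.id_comp] at h
    rw [← Functor.map_comp_apply, ← op_comp, h]
    exact τ.2⟩
  map_id n := by
    apply ConcreteCategory.hom_ext
    rintro ⟨τ, hτ⟩
    apply Subtype.ext
    change C.map (ordinalSumMap (𝟙 n.unop) (𝟙 k)).op τ = τ
    rw [ordinalSumMap_id, op_id, Functor.map_id_apply]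
  map_comp φ ψ := by
    apply ConcreteCategory.hom_ext
    rintro ⟨τ, hτ⟩
    apply Subtype.ext
    have h := ordinalSumMap_comp ψ.unop φ.unop (𝟙 k) (𝟙 k)
    rw [Category.id_comp] at h
    change C.map (ordinalSumMap (ψ.unop ≫ φ.unop) (𝟙 k)).op τ = C.map _ (C.map _ τ)
    rw [h, op_comp, Functor.map_comp_apply]

namespace overSSet

variable {C D : SSet.{w}}

/-- The restriction map `C_{/σ} → C_{/σ'}` when `σ' = θ^* σ` is the restriction of `σ : Δ^k → C`
along `θ : Δ^j → Δ^k`. -/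
def restrict {j k : SimplexCategory} (θ : j ⟶ k) {σ : C.obj (op k)} {σ' : C.obj (op j)}
    (h : C.map θ.op σ = σ') : overSSet C σ ⟶ overSSet C σ' where
  app n := ↾fun τ => ⟨C.map (ordinalSumMap (𝟙 n.unop) θ).op τ.1, by
    rw [← Functor.map_comp_apply, ← op_comp, ordinalSumInr_comp, op_comp,
      Functor.map_comp_apply, τ.2, h]⟩
  naturality m n φ := by
    apply ConcreteCategory.hom_ext
    intro τ
    apply Subtype.ext
    have h₁ := ordinalSumMap_comp φ.unop (𝟙 m.unop) (𝟙 j) θ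
    have h₂ := ordinalSumMap_comp (𝟙 n.unop) φ.unop θ (𝟙 k)
    rw [Category.comp_id, Category.id_comp] at h₁ h₂
    change C.map _ (C.map _ τ.1) = C.map _ (C.map _ τ.1)
    rw [← Functor.map_comp_apply, ← Functor.map_comp_apply, ← op_comp, ← op_comp,
      ← h₁, ← h₂]

/-- The map `C_{/σ} → D_{/pσ}` induced by `p : C → D`. -/
def map (p : C ⟶ D) {k : SimplexCategory} {σ : C.obj (op k)} {ρ : D.obj (op k)}
    (h : p.app (op k) σ = ρ) : overSSet C σ ⟶ overSSet D ρ where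
  app n := ↾fun τ => ⟨p.app _ τ.1, by
    rw [← NatTrans.naturality_apply, τ.2, h]⟩
  naturality m n φ := by
    apply ConcreteCategory.hom_ext
    intro τ
    apply Subtype.ext
    change p.app _ (C.map _ τ.1) = D.map _ (p.app _ τ.1)
    rw [NatTrans.naturality_apply]

lemma restrict_map (p : C ⟶ D) {j k : SimplexCategory} (θ : j ⟶ k) {σ : C.obj (op k)}
    {σ' : C.obj (op j)} {ρ : D.obj (op k)} {ρ' : D.obj (op j)} (h : C.map θ.op σ = σ')
    (h' : p.app _ σ' = ρ') (k₁ : p.app _ σ = ρ) (k₂ : D.map θ.op ρ = ρ') :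
    restrict θ h ≫ map p h' = map p k₁ ≫ restrict θ k₂ := by
  ext n τ
  apply Subtype.ext
  change p.app _ (C.map _ τ.1) = D.map _ (p.app _ τ.1)
  rw [NatTrans.naturality_apply]

end overSSet

/-- The target of an edge: its vertex `1`, which is its face opposite to the vertex `0`. -/
def edgeTarget {C : SSet.{w}} (f : C _⦋1⦌) : C _⦋0⦌ := C.map (SimplexCategory.δ 0).op f

/-- For `p : C → D` and an edge `f : x → y` of `C`, the natural map
`L_f : C_{/f} → C_{/y} ×_{D_{/py}} D_{/pf}`. -/
noncomputable def overComparison {C D : SSet.{w}} (p : C ⟶ D) (f : C _⦋1⦌) :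
    overSSet C f ⟶
      pullback
        (overSSet.map p rfl : overSSet C (edgeTarget f) ⟶ overSSet D (p.app _ (edgeTarget f)))
        (overSSet.restrict (SimplexCategory.δ 0) (NatTrans.naturality_apply p _ f).symm :
          overSSet D (p.app _ f) ⟶ overSSet D (p.app _ (edgeTarget f))) :=
  pullback.lift (overSSet.restrict (SimplexCategory.δ 0) rfl) (overSSet.map p rfl)
    (overSSet.restrict_map p _ _ _ _ _)

/-- Acyclic Kan fibrations: maps with the right lifting property against all the boundary
inclusions `∂Δ^m → Δ^m`, `m ≥ 0`. -/
def IsAcyclicKanFibration {X Y : SSet.{w}} (q : X ⟶ Y) : Prop :=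
  ∀ m : ℕ, HasLiftingProperty (SSet.boundary.{w} m).ι q

/-- An edge `f : x → y` of `C` is `p`-cartesian if the natural map
`C_{/f} → C_{/y} ×_{D_{/py}} D_{/pf}` is an acyclic Kan fibration. -/
def IsCartesianEdge {C D : SSet.{w}} (p : C ⟶ D) (f : C _⦋1⦌) : Prop :=
  IsAcyclicKanFibration (overComparison p f)

/-- Cartesian fibrations of quasicategories. -/
structure IsCartesianFibration {C D : SSet.{w}} (p : C ⟶ D) : Prop where
  quasicategory_source : SSet.Quasicategory C
  quasicategory_target : SSet.Quasicategory D
  innerFibration : SSet.InnerFibration p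
  /-- every edge `g` of `D` has a `p`-cartesian lift with any prescribed lift `y` of its target -/
  exists_cartesian_lift : ∀ (g : D _⦋1⦌) (y : C _⦋0⦌), p.app _ y = edgeTarget g →
    ∃ f : C _⦋1⦌, IsCartesianEdge p f ∧ edgeTarget f = y ∧ p.app _ f = g

/-! ## Span quasicategories -/

/-- The poset `C_n` of nonempty subintervals of `[n] = {0, …, n}` under *reverse* inclusion. -/
abbrev SubintervalPoset (n : SimplexCategory) : Type := (NonemptyInterval (Fin (n.len + 1)))ᵒᵈ

/-- The element `(i, i+1, …, j)` of `C_n`. -/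
def subinterval {n : SimplexCategory} (i j : Fin (n.len + 1)) (h : i ≤ j) : SubintervalPoset n :=
  OrderDual.toDual ⟨(i, j), h⟩

/-- The morphism `I → J` of `C_n` for intervals `J ⊆ I`. -/
def intervalHom {n : SimplexCategory} {I J : NonemptyInterval (Fin (n.len + 1))} (h : J ≤ I) :
    (OrderDual.toDual I : SubintervalPoset n) ⟶ OrderDual.toDual J :=
  homOfLE (OrderDual.toDual_le_toDual.2 h)

/-- `C_n` is functorial in `[n]`: a monotone map `φ` sends `(i, …, j)` to `(φ i, …, φ j)`. -/
def subintervalFunctor {m n : SimplexCategory} (φ : m ⟶ n) :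
    SubintervalPoset m ⥤ SubintervalPoset n :=
  Monotone.functor
    (f := fun I => OrderDual.toDual ((OrderDual.ofDual I).map φ.toOrderHom))
    (fun _ _ h => ⟨φ.toOrderHom.monotone h.1, φ.toOrderHom.monotone h.2⟩)

/-- The pullback property of `F : C_n ⥤ C`: whenever `I` and `J` are nonempty intervals with
nonempty intersection `K = I ∩ J` (so that their union `U = I ∪ J` is again an interval), the square
```
F(U) → F(I)
 ↓      ↓
F(J) → F(K)
```
is a pullback. The union and the intersection are described by their end points. -/
def PullbackProperty {C : Type u} [Category.{v} C] {n : SimplexCategory}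
    (F : SubintervalPoset n ⥤ C) : Prop :=
  ∀ (I J U K : NonemptyInterval (Fin (n.len + 1))) (hIU : I ≤ U) (hJU : J ≤ U)
    (hKI : K ≤ I) (hKJ : K ≤ J),
    (U.fst = min I.fst J.fst ∧ U.snd = max I.snd J.snd) →
    (K.fst = max I.fst J.fst ∧ K.snd = min I.snd J.snd) →
    IsPullback (F.map (intervalHom hIU)) (F.map (intervalHom hJU))
      (F.map (intervalHom hKI)) (F.map (intervalHom hKJ))

lemma PullbackProperty.precomp {C : Type u} [Category.{v} C] {m n : SimplexCategory}
    {F : SubintervalPoset n ⥤ C} (hF : PullbackProperty F) (φ : m ⟶ n) :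
    PullbackProperty (subintervalFunctor φ ⋙ F) := by
  intro I J U K hIU hJU hKI hKJ hU hK
  have hφ : Monotone φ.toOrderHom := φ.toOrderHom.monotone
  refine hF (I.map φ.toOrderHom) (J.map φ.toOrderHom) (U.map φ.toOrderHom) (K.map φ.toOrderHom)
    ⟨hφ hIU.1, hφ hIU.2⟩ ⟨hφ hJU.1, hφ hJU.2⟩ ⟨hφ hKI.1, hφ hKI.2⟩ ⟨hφ hKJ.1, hφ hKJ.2⟩ ?_ ?_
  · exact ⟨(congrArg φ.toOrderHom hU.1).trans hφ.map_min,
      (congrArg φ.toOrderHom hU.2).trans hφ.map_max⟩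
  · exact ⟨(congrArg φ.toOrderHom hK.1).trans hφ.map_max,
      (congrArg φ.toOrderHom hK.2).trans hφ.map_min⟩

lemma PullbackProperty.postcomp {C : Type u} [Category.{v} C] {D : Type u'} [Category.{v'} D]
    {n : SimplexCategory} {F : SubintervalPoset n ⥤ C} (hF : PullbackProperty F) (G : C ⥤ D)
    [PreservesLimitsOfShape WalkingCospan G] : PullbackProperty (F ⋙ G) :=
  fun I J U K hIU hJU hKI hKJ hU hK => (hF I J U K hIU hJU hKI hKJ hU hK).map G

/-- The simplicial set `Span(C)`: its `n`-cells are the functors `C_n ⥤ C` with the pullback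
property, and `φ : [m] → [n]` acts by precomposition with `C_m ⥤ C_n`. -/
def spanSSet (C : Type u) [Category.{v} C] : SSet.{max u v} where
  obj n := { F : SubintervalPoset n.unop ⥤ C // PullbackProperty F }
  map φ := ↾fun F => ⟨subintervalFunctor φ.unop ⋙ F.1, F.2.precomp φ.unop⟩

/-- The simplicial map `Span(C) → Span(D)` given by composition with a functor `G : C ⥤ D` that
preserves pullbacks. -/
def spanMap {C : Type u} [Category.{v} C] {D : Type u} [Category.{v} D] (G : C ⥤ D)
    [PreservesLimitsOfShape WalkingCospan G] : spanSSet C ⟶ spanSSet D where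
  app n := ↾fun F => ⟨F.1 ⋙ G, F.2.postcomp G⟩

section

variable {C : Type u} [Category.{v} C] (S : (spanSSet C) _⦋1⦌)

/-! A 1-cell of `Span(C)` is a span `S₀ ← S₀₁ → S₁` in `C`. -/

/-- The object `S₀`. -/
def spanSource : C := S.1.obj (subinterval 0 0 le_rfl)

/-- The object `S₁`. -/
def spanTarget : C := S.1.obj (subinterval 1 1 le_rfl)

/-- The object `S₀₁`. -/
def spanApex : C := S.1.obj (subinterval 0 1 (Fin.zero_le 1))

/-- The left leg `λ_{01} : S₀₁ → S₀`. -/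
def spanLeftLeg : spanApex S ⟶ spanSource S :=
  S.1.map (intervalHom ⟨le_rfl, Fin.zero_le 1⟩)

/-- The right leg `ρ_{01} : S₀₁ → S₁`. -/
def spanRightLeg : spanApex S ⟶ spanTarget S :=
  S.1.map (intervalHom ⟨Fin.zero_le 1, le_rfl⟩)

end

/-! ## The projection `p : Span^× → Span` -/

/-- If `C` has an initial object then the codomain functor `Arr(C) ⥤ C`, `(X → Y) ↦ Y` is right
adjoint to `Y ↦ (∅ → Y)`. -/
noncomputable def initialArrowAdjunction (C : Type u) [Category.{v} C] [HasInitial C] :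
    ({ obj := fun Y => Arrow.mk (initial.to Y)
       map := fun g => Arrow.homMk (𝟙 _) g } : C ⥤ Arrow C) ⊣ Arrow.rightFunc :=
  Adjunction.mkOfHomEquiv
    { homEquiv := fun Y A =>
        { toFun := fun f => f.right
          invFun := fun g => Arrow.homMk (initial.to _) g
          left_inv := fun f => by
            ext
            · exact initial.hom_ext _ _
            · rfl
          right_inv := fun g => rfl } }

instance : PreservesLimitsOfShape WalkingCospan
    (Arrow.rightFunc : Arrow FintypeCat.{u} ⥤ FintypeCat.{u}) :=
  (initialArrowAdjunction FintypeCat.{u}).rightAdjoint_preservesLimits.preservesLimitsOfShape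

/-- `Span = Span(FinSet)`. -/
abbrev FinSpan : SSet.{u + 1} := spanSSet FintypeCat.{u}

/-- `Span^× = Span(Arr(FinSet))`, with `Arr(FinSet)` the category of arrows of finite sets. -/
abbrev FinSpanTimes : SSet.{u + 1} := spanSSet (Arrow FintypeCat.{u})

/-- The projection `p : Span^× → Span`, induced by the functor `(X → Y) ↦ Y`. -/
def finSpanProj : FinSpanTimes.{u} ⟶ FinSpan.{u} := spanMap Arrow.rightFunc

/-!
A cell of `Span(C)` is encoded by its values at the intervals `[a,b]` together with its left
legs `[a,b] → [c,b]` and its right legs `[a,b] → [a,d]`. Such data form a cell exactly when left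
legs compose, right legs compose, and the squares of `[a,b]`, `[a,d]`, `[c,b]`, `[c,d]` are
pullbacks (`SpanPregrid.IsGrid`, `SpanPregrid.IsGrid.cell`). Each of these laws concerns four end
points. A horn of dimension at least three contains all edges of the simplex, so all values of the
cell to be constructed are prescribed; what remains is to define the missing legs and to check
the laws.

* For an inner horn with vertex `k`, the missing legs are composites, or are forced by the
  decomposition of an interval at `k` as a pullback (`exists_inner_filler`). The horn of
  dimension two is filled by a pullback of arrows that lifts a given pullback of codomains. Hence
  `p` is an inner fibration (`innerFibration_spanMap`), and so is the map from `Span(C)` to the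
  spans of the terminal category, which makes `Span(C)` a quasicategory (`quasicategory_spanSSet`).

* Call a span of arrows special if its right square is a pullback and its left leg is an
  isomorphism on domains. For a horn that lacks the face opposite to the last vertex `k`, and the
  last edge `[j,k]` of which is special, base change shows that all maps `[a,k] → [a,j]` are
  isomorphisms on domains. This forces the missing legs, and the laws can be checked on domains and
  on codomains (`exists_right_filler`, `exists_triangle_right`). As the lifting problems that define
  cartesian edges translate into fillers of such horns (`isCartesianEdge_of_fillers`), special edges
  are cartesian (`IsSpecialEdge.isCartesianEdge`). Pulling back along the right leg of a span in the
  base yields a special lift with any given target (`exists_isSpecialEdge`). So `p` is a cartesian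
  fibration.

* Conversely, a cartesian edge `F` and the special lift `F'` with the same image and target factor
  through each other, by spans `G` and `H` over an identity. Both composites of `G` and `H` are
  homotopic to identities (`IsCartesianEdge.exists_homotopy`), and therefore are spans the legs of
  which are isomorphisms. Then all legs of `G` and `H` are split epimorphisms, and the
  legs of `G` are isomorphisms (`isInvertibleSpan_of_comp`). The composite `F` of `G` with the
  special span `F'` is thus special (`IsCartesianEdge.isSpecialEdge`).
-/

/-! ### Cells of spans as grids -/

/-- The laws satisfied by the legs among the values of a cell of `Span(C)` at the intervals
`[a,b]`, `[c,b]`, `[d,b]`, `[a,d]`, `[a,c]`, `[c,d]`, for `a ≤ c ≤ d ≤ b`: left legs compose,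
right legs compose, and the square on `[a,b]`, `[a,d]`, `[c,b]`, `[c,d]` is a pullback. -/
structure QuadLaws {C : Type u} [Category.{v} C] {ab cb db ad ac cd : C}
    (lacb : ab ⟶ cb) (lcdb : cb ⟶ db) (ladb : ab ⟶ db)
    (radb : ab ⟶ ad) (racd : ad ⟶ ac) (racb : ab ⟶ ac)
    (lacd : ad ⟶ cd) (rcdb : cb ⟶ cd) : Prop where
  ll : lacb ≫ lcdb = ladb
  rr : radb ≫ racd = racb
  pb : IsPullback radb lacb lacd rcdb

namespace QuadLaws

variable {C : Type u} [Category.{v} C] {ab cb db ad ac cd : C}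
    {lacb : ab ⟶ cb} {lcdb : cb ⟶ db} {ladb : ab ⟶ db}
    {radb : ab ⟶ ad} {racd : ad ⟶ ac} {racb : ab ⟶ ac}
    {lacd : ad ⟶ cd} {rcdb : cb ⟶ cd}

lemma comm (h : QuadLaws lacb lcdb ladb radb racd racb lacd rcdb) :
    radb ≫ lacd = lacb ≫ rcdb := h.pb.w

lemma of_iso (h : QuadLaws lacb lcdb ladb radb racd racb lacd rcdb)
    {ab' cb' db' ad' ac' cd' : C}
    {lacb' : ab' ⟶ cb'} {lcdb' : cb' ⟶ db'} {ladb' : ab' ⟶ db'}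
    {radb' : ab' ⟶ ad'} {racd' : ad' ⟶ ac'} {racb' : ab' ⟶ ac'}
    {lacd' : ad' ⟶ cd'} {rcdb' : cb' ⟶ cd'}
    (eab : ab ≅ ab') (ecb : cb ≅ cb') (edb : db ≅ db') (ead : ad ≅ ad') (eac : ac ≅ ac')
    (ecd : cd ≅ cd')
    (h₁ : lacb ≫ ecb.hom = eab.hom ≫ lacb') (h₂ : lcdb ≫ edb.hom = ecb.hom ≫ lcdb')
    (h₃ : ladb ≫ edb.hom = eab.hom ≫ ladb') (h₄ : radb ≫ ead.hom = eab.hom ≫ radb')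
    (h₅ : racd ≫ eac.hom = ead.hom ≫ racd') (h₆ : racb ≫ eac.hom = eab.hom ≫ racb')
    (h₇ : lacd ≫ ecd.hom = ead.hom ≫ lacd') (h₈ : rcdb ≫ ecd.hom = ecb.hom ≫ rcdb') :
    QuadLaws lacb' lcdb' ladb' radb' racd' racb' lacd' rcdb' where
  ll := by
    rw [← cancel_epi eab.hom, ← reassoc_of% h₁, ← h₂, ← h₃, ← h.ll, Category.assoc]
  rr := by
    rw [← cancel_epi eab.hom, ← reassoc_of% h₄, ← h₅, ← h₆, ← h.rr, Category.assoc]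
  pb := h.pb.of_iso eab ead ecb ecd h₄ h₁ h₇ h₈

end QuadLaws

/-- The data underlying an `N`-cell of `Span(C)`: the value `obj a b` at each interval `[a,b]`,
the maps `l a c b : obj a b ⟶ obj c b` and `r a d b : obj a b ⟶ obj a d` that move the left and
the right end point of an interval. -/
structure SpanPregrid (C : Type u) [Category.{v} C] (N : ℕ) where
  /-- the value at `[a,b]` -/
  obj : ∀ a b : Fin (N + 1), a ≤ b → C
  /-- the map that moves the left end point -/
  l : ∀ (a c b : Fin (N + 1)) (h : a ≤ c) (h' : c ≤ b), obj a b (h.trans h') ⟶ obj c b h'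
  /-- the map that moves the right end point -/
  r : ∀ (a d b : Fin (N + 1)) (h : a ≤ d) (h' : d ≤ b), obj a b (h.trans h') ⟶ obj a d h

namespace SpanPregrid

variable {C : Type u} [Category.{v} C] {N : ℕ}

/-- The laws of a cell of `Span(C)` at the end points `a ≤ c ≤ d ≤ b`. -/
def LawsAt (Γ : SpanPregrid C N) (a c d b : Fin (N + 1)) (h₁ : a ≤ c) (h₂ : c ≤ d)
    (h₃ : d ≤ b) : Prop :=
  QuadLaws (Γ.l a c b h₁ (h₂.trans h₃)) (Γ.l c d b h₂ h₃) (Γ.l a d b (h₁.trans h₂) h₃)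
    (Γ.r a d b (h₁.trans h₂) h₃) (Γ.r a c d h₁ h₂) (Γ.r a c b h₁ (h₂.trans h₃))
    (Γ.l a c d h₁ h₂) (Γ.r c d b h₂ h₃)

/-- A grid: data that come from an `N`-cell of `Span(C)`. -/
structure IsGrid (Γ : SpanPregrid C N) : Prop where
  l_refl : ∀ a b h, Γ.l a a b le_rfl h = 𝟙 _
  r_refl : ∀ a b h, Γ.r a b b h le_rfl = 𝟙 _
  laws : ∀ a c d b h₁ h₂ h₃, Γ.LawsAt a c d b h₁ h₂ h₃

end SpanPregrid

section FunctorLegs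

variable {m : ℕ}

/-- The morphism `[i,j] ⟶ [c,j]` of `C_m`, for `i ≤ c ≤ j`. -/
def leftHom (i c j : Fin (m + 1)) (h : i ≤ c) (h' : c ≤ j) :
    (subinterval (n := ⦋m⦌) i j (h.trans h')) ⟶ subinterval (n := ⦋m⦌) c j h' :=
  intervalHom ⟨h, le_rfl⟩

/-- The morphism `[i,j] ⟶ [i,d]` of `C_m`, for `i ≤ d ≤ j`. -/
def rightHom (i d j : Fin (m + 1)) (h : i ≤ d) (h' : d ≤ j) :
    (subinterval (n := ⦋m⦌) i j (h.trans h')) ⟶ subinterval (n := ⦋m⦌) i d h :=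
  intervalHom ⟨le_rfl, h'⟩

variable {C : Type u} [Category.{v} C]

/-- The pregrid of a functor `C_m ⥤ C`. -/
def SpanPregrid.ofFunctor (F : SubintervalPoset ⦋m⦌ ⥤ C) : SpanPregrid C m where
  obj i j h := F.obj (subinterval (n := ⦋m⦌) i j h)
  l i c j h h' := F.map (leftHom i c j h h')
  r i d j h h' := F.map (rightHom i d j h h')

lemma SpanPregrid.isGrid_ofFunctor {F : SubintervalPoset ⦋m⦌ ⥤ C} (hF : PullbackProperty F) :
    (SpanPregrid.ofFunctor F).IsGrid where
  l_refl _ _ _ := F.map_id _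
  r_refl _ _ _ := F.map_id _
  laws a c d b h₁ h₂ h₃ :=
    { ll := (F.map_comp _ _).symm
      rr := (F.map_comp _ _).symm
      pb := hF ⟨(a, d), h₁.trans h₂⟩ ⟨(c, b), h₂.trans h₃⟩ ⟨(a, b), h₁.trans (h₂.trans h₃)⟩
        ⟨(c, d), h₂⟩ ⟨le_rfl, h₃⟩ ⟨h₁, le_rfl⟩ ⟨h₁, le_rfl⟩ ⟨le_rfl, h₃⟩
        ⟨(min_eq_left h₁).symm, (max_eq_right h₃).symm⟩
        ⟨(max_eq_right h₁).symm, (min_eq_left h₃).symm⟩ }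

/-- A functor on `C_m` is determined by its values at the intervals and by its legs. -/
lemma subintervalFunctor_ext {F G : SubintervalPoset ⦋m⦌ ⥤ C}
    (ho : ∀ i j h, F.obj (subinterval (n := ⦋m⦌) i j h) = G.obj (subinterval (n := ⦋m⦌) i j h))
    (hl : ∀ i c j h h', F.map (leftHom i c j h h') ≫ eqToHom (ho c j h') =
      eqToHom (ho i j _) ≫ G.map (leftHom i c j h h'))
    (hr : ∀ i d j h h', F.map (rightHom i d j h h') ≫ eqToHom (ho i d h) =
      eqToHom (ho i j _) ≫ G.map (rightHom i d j h h')) : F = G := by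
  have key : ∀ (a b c d : Fin (m + 1)) (hab : a ≤ b) (hcd : c ≤ d)
      (f : subinterval (n := ⦋m⦌) a b hab ⟶ subinterval (n := ⦋m⦌) c d hcd),
      F.map f = eqToHom (ho a b hab) ≫ G.map f ≫ eqToHom (ho c d hcd).symm := by
    intro a b c d hab hcd f
    have h₁ : a ≤ c := (leOfHom f).1
    have h₂ : d ≤ b := (leOfHom f).2
    have e : f = leftHom a c b h₁ (hcd.trans h₂) ≫ rightHom c d b hcd h₂ := Subsingleton.elim _ _
    rw [← Category.assoc, ← comp_eqToHom_iff (ho c d hcd), e, F.map_comp, G.map_comp,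
      Category.assoc, hr, reassoc_of% hl]
  exact CategoryTheory.Functor.ext (fun I => ho I.fst I.snd I.fst_le_snd)
    (fun I J f => key I.fst I.snd J.fst J.snd I.fst_le_snd J.fst_le_snd f)

end FunctorLegs

namespace SpanPregrid.IsGrid

variable {C : Type u} [Category.{v} C] {N : ℕ} {Γ : SpanPregrid C N}

/-- The functor `C_N ⥤ C` of a grid. -/
def functor (hΓ : Γ.IsGrid) : SubintervalPoset ⦋N⦌ ⥤ C where
  obj I := Γ.obj I.fst I.snd I.fst_le_snd
  map {I J} f := Γ.l I.fst J.fst I.snd (leOfHom f).1 (J.fst_le_snd.trans (leOfHom f).2) ≫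
    Γ.r J.fst J.snd I.snd J.fst_le_snd (leOfHom f).2
  map_id I := by rw [hΓ.l_refl, hΓ.r_refl, Category.comp_id]
  map_comp {I J K} f g := by
    have e₁ := (hΓ.laws J.fst K.fst J.snd I.snd (leOfHom g).1
      (K.fst_le_snd.trans (leOfHom g).2) (leOfHom f).2).comm
    have e₂ := (hΓ.laws I.fst J.fst K.fst I.snd (leOfHom f).1 (leOfHom g).1
      (K.fst_le_snd.trans ((leOfHom g).2.trans (leOfHom f).2))).ll
    have e₃ := (hΓ.laws K.fst K.snd J.snd I.snd K.fst_le_snd (leOfHom g).2 (leOfHom f).2).rr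
    rw [Category.assoc, reassoc_of% e₁, ← e₂, ← e₃, Category.assoc]

lemma functor_map_leftHom (hΓ : Γ.IsGrid) (a c b : Fin (N + 1)) (h : a ≤ c) (h' : c ≤ b) :
    hΓ.functor.map (leftHom a c b h h') = Γ.l a c b h h' :=
  (congrArg (Γ.l a c b h h' ≫ ·) (hΓ.r_refl c b h')).trans (Category.comp_id _)

lemma functor_map_rightHom (hΓ : Γ.IsGrid) (a d b : Fin (N + 1)) (h : a ≤ d) (h' : d ≤ b) :
    hΓ.functor.map (rightHom a d b h h') = Γ.r a d b h h' :=
  (congrArg (· ≫ Γ.r a d b h h') (hΓ.l_refl a b (h.trans h'))).trans (Category.id_comp _)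

lemma pullbackProperty (hΓ : Γ.IsGrid) : PullbackProperty hΓ.functor := by
  have main : ∀ (I J U K : NonemptyInterval (Fin (N + 1))) (hIU : I ≤ U) (hJU : J ≤ U)
      (hKI : K ≤ I) (hKJ : K ≤ J), I.fst ≤ J.fst →
      (U.fst = min I.fst J.fst ∧ U.snd = max I.snd J.snd) →
      (K.fst = max I.fst J.fst ∧ K.snd = min I.snd J.snd) →
      IsPullback (hΓ.functor.map (intervalHom (n := ⦋N⦌) hIU)) (hΓ.functor.map (intervalHom hJU))
        (hΓ.functor.map (intervalHom hKI)) (hΓ.functor.map (intervalHom hKJ)) := by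
    rintro ⟨⟨a, d⟩, had⟩ ⟨⟨c, b⟩, hcb⟩ ⟨⟨a', b'⟩, hab'⟩ ⟨⟨c', d'⟩, hcd'⟩ hIU hJU hKI hKJ hac
      ⟨hU₁, hU₂⟩ ⟨hK₁, hK₂⟩
    dsimp only at *
    rw [min_eq_left hac] at hU₁
    rw [max_eq_right hac] at hK₁
    subst hU₁ hK₁
    rcases le_total d b with hdb | hbd
    · rw [max_eq_right hdb] at hU₂
      rw [min_eq_left hdb] at hK₂
      subst hU₂ hK₂
      have h := (hΓ.laws a' c' d' b' hac hcd' hdb).pb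
      rw [← hΓ.functor_map_leftHom, ← hΓ.functor_map_leftHom, ← hΓ.functor_map_rightHom,
        ← hΓ.functor_map_rightHom] at h
      exact h
    · rw [max_eq_left hbd] at hU₂
      rw [min_eq_right hbd] at hK₂
      subst hU₂ hK₂
      have h₁ : hΓ.functor.map (intervalHom (n := ⦋N⦌) hIU) = 𝟙 _ := hΓ.functor.map_id _
      have h₂ : hΓ.functor.map (intervalHom (n := ⦋N⦌) hKJ) = 𝟙 _ := hΓ.functor.map_id _
      rw [h₁, h₂]
      exact IsPullback.id_horiz _
  intro I J U K hIU hJU hKI hKJ hU hK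
  rcases le_total I.fst J.fst with h | h
  · exact main I J U K hIU hJU hKI hKJ h hU hK
  · exact (main J I U K hJU hIU hKJ hKI h (by rwa [min_comm, max_comm])
      (by rwa [max_comm, min_comm])).flip

/-- The cell of `Span(C)` of a grid. -/
def cell (hΓ : Γ.IsGrid) : (spanSSet C) _⦋N⦌ := ⟨hΓ.functor, hΓ.pullbackProperty⟩

end SpanPregrid.IsGrid

namespace SpanPregrid

variable {C : Type u} [Category.{v} C] {N : ℕ}

lemma IsGrid.of_iso {Γ Γ' : SpanPregrid C N} (hΓ : Γ.IsGrid)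
    (e : ∀ a b h, Γ.obj a b h ≅ Γ'.obj a b h)
    (hl : ∀ a c b h h', Γ.l a c b h h' ≫ (e c b h').hom = (e a b _).hom ≫ Γ'.l a c b h h')
    (hr : ∀ a d b h h', Γ.r a d b h h' ≫ (e a d h).hom = (e a b _).hom ≫ Γ'.r a d b h h') :
    Γ'.IsGrid where
  l_refl a b h := by
    rw [← cancel_epi (e a b h).hom, ← hl, hΓ.l_refl, Category.id_comp, Category.comp_id]
  r_refl a b h := by
    rw [← cancel_epi (e a b h).hom, ← hr, hΓ.r_refl, Category.id_comp, Category.comp_id]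
  laws a c d b h₁ h₂ h₃ := (hΓ.laws a c d b h₁ h₂ h₃).of_iso (e _ _ _) (e _ _ _) (e _ _ _)
    (e _ _ _) (e _ _ _) (e _ _ _) (hl _ _ _ _ _) (hl _ _ _ _ _) (hl _ _ _ _ _) (hr _ _ _ _ _)
    (hr _ _ _ _ _) (hr _ _ _ _ _) (hl _ _ _ _ _) (hr _ _ _ _ _)

/-- It suffices to check the laws of a grid at the nondegenerate end points. -/
lemma IsGrid.of_nondegenerate {Γ : SpanPregrid C N}
    (l_refl : ∀ a b h, Γ.l a a b le_rfl h = 𝟙 _) (r_refl : ∀ a b h, Γ.r a b b h le_rfl = 𝟙 _)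
    (ll : ∀ a c d b (h₁ : a < c) (h₂ : c < d) (h₃ : d ≤ b),
      Γ.l a c b h₁.le (h₂.le.trans h₃) ≫ Γ.l c d b h₂.le h₃ = Γ.l a d b (h₁.trans h₂).le h₃)
    (rr : ∀ a c d b (h₁ : a ≤ c) (h₂ : c < d) (h₃ : d < b),
      Γ.r a d b (h₁.trans h₂.le) h₃.le ≫ Γ.r a c d h₁ h₂.le = Γ.r a c b h₁ (h₂.trans h₃).le)
    (pb : ∀ a c d b (h₁ : a < c) (h₂ : c ≤ d) (h₃ : d < b),
      IsPullback (Γ.r a d b (h₁.le.trans h₂) h₃.le) (Γ.l a c b h₁.le (h₂.trans h₃.le))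
        (Γ.l a c d h₁.le h₂) (Γ.r c d b h₂ h₃.le)) : Γ.IsGrid where
  l_refl := l_refl
  r_refl := r_refl
  laws a c d b h₁ h₂ h₃ :=
    { ll := by
        rcases h₁.eq_or_lt with rfl | h₁
        · rw [l_refl, Category.id_comp]
        rcases h₂.eq_or_lt with rfl | h₂
        · rw [l_refl, Category.comp_id]
        exact ll _ _ _ _ h₁ h₂ h₃
      rr := by
        rcases h₃.eq_or_lt with rfl | h₃
        · rw [r_refl, Category.id_comp]
        rcases h₂.eq_or_lt with rfl | h₂
        · rw [r_refl, Category.comp_id]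
        exact rr _ _ _ _ h₁ h₂ h₃
      pb := by
        rcases h₁.eq_or_lt with rfl | h₁
        · rw [l_refl, l_refl]
          exact IsPullback.id_vert _
        rcases h₃.eq_or_lt with rfl | h₃
        · rw [r_refl, r_refl]
          exact IsPullback.id_horiz _
        exact pb _ _ _ _ h₁ h₂ h₃ }

end SpanPregrid

/-! ### Criteria for grids -/

namespace SpanPregrid

variable {C : Type u} [Category.{v} C] {N : ℕ}

/-- The laws of a grid follow from those at the end points on one side of a vertex `k`, those in
which `k` is a middle end point, and the decomposition of `[a,b]` at `k`. -/
lemma IsGrid.of_inner {Γ : SpanPregrid C N} (k : Fin (N + 1))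
    (l_refl : ∀ a b h, Γ.l a a b le_rfl h = 𝟙 _) (r_refl : ∀ a b h, Γ.r a b b h le_rfl = 𝟙 _)
    (side : ∀ a c d b h₁ h₂ h₃, b ≤ k ∨ k ≤ a → Γ.LawsAt a c d b h₁ h₂ h₃)
    (ll₁ : ∀ a c b (h₁ : a ≤ c) (h₂ : c ≤ k) (h₃ : k ≤ b),
      Γ.l a c b h₁ (h₂.trans h₃) ≫ Γ.l c k b h₂ h₃ = Γ.l a k b (h₁.trans h₂) h₃)
    (ll₂ : ∀ a d b (h₁ : a ≤ k) (h₂ : k ≤ d) (h₃ : d ≤ b),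
      Γ.l a k b h₁ (h₂.trans h₃) ≫ Γ.l k d b h₂ h₃ = Γ.l a d b (h₁.trans h₂) h₃)
    (rr₁ : ∀ a c b (h₁ : a ≤ c) (h₂ : c ≤ k) (h₃ : k ≤ b),
      Γ.r a k b (h₁.trans h₂) h₃ ≫ Γ.r a c k h₁ h₂ = Γ.r a c b h₁ (h₂.trans h₃))
    (rr₂ : ∀ a d b (h₁ : a ≤ k) (h₂ : k ≤ d) (h₃ : d ≤ b),
      Γ.r a d b (h₁.trans h₂) h₃ ≫ Γ.r a k d h₁ h₂ = Γ.r a k b h₁ (h₂.trans h₃))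
    (comm₁ : ∀ a c b (h₁ : a ≤ c) (h₂ : c ≤ k) (h₃ : k ≤ b),
      Γ.r a k b (h₁.trans h₂) h₃ ≫ Γ.l a c k h₁ h₂ = Γ.l a c b h₁ (h₂.trans h₃) ≫ Γ.r c k b h₂ h₃)
    (comm₂ : ∀ a d b (h₁ : a ≤ k) (h₂ : k ≤ d) (h₃ : d ≤ b),
      Γ.r a d b (h₁.trans h₂) h₃ ≫ Γ.l a k d h₁ h₂ = Γ.l a k b h₁ (h₂.trans h₃) ≫ Γ.r k d b h₂ h₃)
    (pb : ∀ a b (h₁ : a ≤ k) (h₂ : k ≤ b),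
      IsPullback (Γ.r a k b h₁ h₂) (Γ.l a k b h₁ h₂) (Γ.l a k k h₁ le_rfl)
        (Γ.r k k b le_rfl h₂)) : Γ.IsGrid := by
  -- the pullback squares one of whose end points is `k`
  have pb₂ : ∀ a d b (h₁ : a ≤ k) (h₂ : k ≤ d) (h₃ : d ≤ b),
      IsPullback (Γ.r a d b (h₁.trans h₂) h₃) (Γ.l a k b h₁ (h₂.trans h₃)) (Γ.l a k d h₁ h₂)
        (Γ.r k d b h₂ h₃) := by
    intro a d b h₁ h₂ h₃
    refine IsPullback.of_right ?_ (comm₂ a d b h₁ h₂ h₃) (pb a d h₁ h₂)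
    rw [rr₂, (side k k d b le_rfl h₂ h₃ (Or.inr le_rfl)).rr]
    exact pb a b h₁ (h₂.trans h₃)
  have pb₁ : ∀ a c b (h₁ : a ≤ c) (h₂ : c ≤ k) (h₃ : k ≤ b),
      IsPullback (Γ.r a k b (h₁.trans h₂) h₃) (Γ.l a c b h₁ (h₂.trans h₃)) (Γ.l a c k h₁ h₂)
        (Γ.r c k b h₂ h₃) := by
    intro a c b h₁ h₂ h₃
    refine IsPullback.of_bot ?_ (comm₁ a c b h₁ h₂ h₃) (pb c b h₂ h₃)
    rw [ll₁, (side a c k k h₁ h₂ le_rfl (Or.inl le_rfl)).ll]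
    exact pb a b (h₁.trans h₂) h₃
  refine ⟨l_refl, r_refl, fun a c d b h₁ h₂ h₃ => ?_⟩
  by_cases hs : b ≤ k ∨ k ≤ a
  · exact side a c d b h₁ h₂ h₃ hs
  have hkb : k ≤ b := (not_le.1 (not_or.1 hs).1).le
  have hak : a ≤ k := (not_le.1 (not_or.1 hs).2).le
  have side' := fun a c d b h₁ h₂ h₃ h => (side a c d b h₁ h₂ h₃ h).comm
  refine ⟨?_, ?_, ?_⟩
  · rcases le_total k c with hkc | hck
    · rw [← ll₂ a c b hak hkc (h₂.trans h₃), Category.assoc,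
        (side k c d b hkc h₂ h₃ (Or.inr le_rfl)).ll, ll₂]
    rcases le_total k d with hkd | hdk
    · rw [← ll₂ c d b hck hkd h₃, ← Category.assoc, ll₁, ll₂]
    · apply (pb d b hdk hkb).hom_ext
      · rw [Category.assoc, ← comm₁ c d b h₂ hdk hkb, ← Category.assoc, ← comm₁ a c b h₁ hck hkb,
          Category.assoc, (side a c d k h₁ h₂ hdk (Or.inl le_rfl)).ll,
          comm₁ a d b (h₁.trans h₂) hdk hkb]
      · rw [Category.assoc, ll₁, ll₁, ll₁]
  · rcases le_total d k with hdk | hkd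
    · rw [← rr₁ a d b (h₁.trans h₂) hdk hkb, Category.assoc,
        (side a c d k h₁ h₂ hdk (Or.inl le_rfl)).rr, rr₁]
    rcases le_total c k with hck | hkc
    · rw [← rr₁ a c d h₁ hck hkd, ← Category.assoc, rr₂, rr₁]
    · apply (pb a c hak hkc).hom_ext
      · rw [Category.assoc, rr₂, rr₂, rr₂]
      · rw [Category.assoc, comm₂ a c d hak hkc h₂, ← Category.assoc, comm₂ a d b hak hkd h₃,
          Category.assoc, (side k c d b hkc h₂ h₃ (Or.inr le_rfl)).rr,
          comm₂ a c b hak hkc (h₂.trans h₃)]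
  · rcases le_total k c with hkc | hck
    · have h := (pb₂ a d b hak (hkc.trans h₂) h₃).paste_vert
        (side k c d b hkc h₂ h₃ (Or.inr le_rfl)).pb
      rwa [ll₂, ll₂] at h
    rcases le_total k d with hkd | hdk
    · refine IsPullback.of_bot ?_ ?_ (pb₂ c d b hck hkd h₃)
      · rw [ll₁, ll₁]
        exact pb₂ a d b hak hkd h₃
      · apply (pb c d hck hkd).hom_ext
        · rw [Category.assoc, ← comm₁ a c d h₁ hck hkd, ← Category.assoc, rr₂,
            comm₁ a c b h₁ hck hkb, Category.assoc, rr₂]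
        · rw [Category.assoc, ll₁, comm₂ a d b hak hkd h₃, Category.assoc,
            comm₂ c d b hck hkd h₃, ← Category.assoc, ll₁]
    · have h := (pb₁ a c b h₁ hck hkb).paste_horiz
        (side a c d k h₁ h₂ hdk (Or.inl le_rfl)).pb
      rwa [rr₁, rr₁] at h

end SpanPregrid

section ArrowPullback

variable {C : Type u} [Category.{v} C]

/-- The functor `(X → Y) ↦ X` is right adjoint to `X ↦ (X = X)`. -/
def idArrowLeftAdjunction (C : Type u) [Category.{v} C] :
    ({ obj := fun X => Arrow.mk (𝟙 X)
       map := fun g => Arrow.homMk g g } : C ⥤ Arrow C) ⊣ Arrow.leftFunc :=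
  Adjunction.mkOfHomEquiv
    { homEquiv := fun X A =>
        { toFun := fun f => f.left
          invFun := fun g => Arrow.homMk g (g ≫ A.hom)
          left_inv := fun f => by
            ext
            · rfl
            · exact (Arrow.w f).trans (Category.id_comp _)
          right_inv := fun g => rfl }
      homEquiv_naturality_left_symm := fun f g => by
        ext
        · rfl
        · exact Category.assoc _ _ _ }

lemma isPullback_left {P A B K : Arrow C} {f : P ⟶ A} {g : P ⟶ B} {h : A ⟶ K} {i : B ⟶ K}
    (H : IsPullback f g h i) : IsPullback f.left g.left h.left i.left := by
  have : PreservesLimitsOfSize.{0, 0} (Arrow.leftFunc : Arrow C ⥤ C) :=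
    (idArrowLeftAdjunction C).rightAdjoint_preservesLimits
  exact H.map Arrow.leftFunc

lemma isPullback_of_left_right {P A B K : Arrow C} {f : P ⟶ A} {g : P ⟶ B} {h : A ⟶ K}
    {i : B ⟶ K} (H₁ : IsPullback f.left g.left h.left i.left)
    (H₂ : IsPullback f.right g.right h.right i.right) : IsPullback f g h i := by
  have w₁ (s : PullbackCone h i) : s.fst.left ≫ h.left = s.snd.left ≫ i.left :=
    congrArg Arrow.Hom.left s.condition
  have w₂ (s : PullbackCone h i) : s.fst.right ≫ h.right = s.snd.right ≫ i.right :=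
    congrArg Arrow.Hom.right s.condition
  refine ⟨⟨by ext; exacts [H₁.w, H₂.w]⟩, ⟨PullbackCone.IsLimit.mk _ (fun s =>
    Arrow.homMk (H₁.lift s.fst.left s.snd.left (w₁ s))
      (H₂.lift s.fst.right s.snd.right (w₂ s)) ?_) ?_ ?_ ?_⟩⟩
  · apply H₂.hom_ext
    · rw [Category.assoc, Category.assoc, H₂.lift_fst, ← Arrow.w f, ← Category.assoc,
        H₁.lift_fst, Arrow.w]
    · rw [Category.assoc, Category.assoc, H₂.lift_snd, ← Arrow.w g, ← Category.assoc,
        H₁.lift_snd, Arrow.w]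
  · intro s
    ext
    · exact H₁.lift_fst _ _ _
    · exact H₂.lift_fst _ _ _
  · intro s
    ext
    · exact H₁.lift_snd _ _ _
    · exact H₂.lift_snd _ _ _
  · intro s m h₁ h₂
    ext
    · apply H₁.hom_ext
      · exact (congrArg Arrow.Hom.left h₁).trans (H₁.lift_fst _ _ _).symm
      · exact (congrArg Arrow.Hom.left h₂).trans (H₁.lift_snd _ _ _).symm
    · apply H₂.hom_ext
      · exact (congrArg Arrow.Hom.right h₁).trans (H₂.lift_fst _ _ _).symm
      · exact (congrArg Arrow.Hom.right h₂).trans (H₂.lift_snd _ _ _).symm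

/-- Arrows into a cartesian square are determined by their bases and by their composites with
it. -/
lemma Arrow.hom_ext_of_cartesian {W A B : Arrow C} {e : A ⟶ B}
    (he : IsPullback e.left A.hom B.hom e.right) {f g : W ⟶ A} (h : f ≫ e = g ≫ e)
    (h' : f.right = g.right) : f = g := by
  ext
  · apply he.hom_ext
    · exact congrArg Arrow.Hom.left h
    · rw [Arrow.w f, Arrow.w g, h']
  · exact h'

/-- Arrows out of the target of a map that is an isomorphism of domains are determined by their
bases and by their composites with it. -/
lemma Arrow.hom_ext_of_isIso_left {W A B : Arrow C} {e : A ⟶ B} (he : IsIso e.left)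
    {f g : B ⟶ W} (h : e ≫ f = e ≫ g) (h' : f.right = g.right) : f = g := by
  ext
  · rw [← cancel_epi e.left]
    exact congrArg Arrow.Hom.left h
  · exact h'

end ArrowPullback

namespace SpanPregrid

variable {C : Type u} [Category.{v} C] {D : Type u'} [Category.{v'} D] {N : ℕ}

/-- The image of a pregrid under a functor. -/
def map (Γ : SpanPregrid C N) (G : C ⥤ D) : SpanPregrid D N where
  obj a b h := G.obj (Γ.obj a b h)
  l a c b h h' := G.map (Γ.l a c b h h')
  r a d b h h' := G.map (Γ.r a d b h h')

/-- The laws of a grid of arrows, given those of the codomains and a last edge `[j,k]` that is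
special. They follow from the laws that do not involve `j` together with some of the laws that
involve both `j` and `k`. Indeed the maps `r a j k` are isomorphisms on domains, so the values at
`[a,j]` have the same domains as those at `[a,k]`, and maps into the value at `[j,k]` are determined
by their bases and by their composites with the cartesian square `l j k k`. -/
lemma IsGrid.of_right {Γ : SpanPregrid (Arrow C) N} {j k : Fin (N + 1)} (hjk : j < k)
    (hk : ∀ b, b < j ∨ b = j ∨ b = k)
    (hR : (Γ.map Arrow.rightFunc).IsGrid)
    (hiso : IsIso (Γ.r j j k le_rfl hjk.le).left)
    (hcart : IsPullback (Γ.l j k k hjk.le le_rfl).left (Γ.obj j k hjk.le).hom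
      (Γ.obj k k le_rfl).hom (Γ.l j k k hjk.le le_rfl).right)
    (l_refl : ∀ a b h, Γ.l a a b le_rfl h = 𝟙 _) (r_refl : ∀ a b h, Γ.r a b b h le_rfl = 𝟙 _)
    (avoid : ∀ a c d b h₁ h₂ h₃, a ≠ j → c ≠ j → d ≠ j → b ≠ j → Γ.LawsAt a c d b h₁ h₂ h₃)
    (laws₁ : ∀ a (h : a ≤ j), Γ.LawsAt a j j k h le_rfl hjk.le)
    (laws₂ : ∀ a (h : a ≤ j), Γ.LawsAt a j k k h hjk.le le_rfl)
    (comm : ∀ a c (h₁ : a ≤ c) (h₂ : c ≤ j), Γ.l a c k h₁ (h₂.trans hjk.le) ≫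
      Γ.r c j k h₂ hjk.le = Γ.r a j k (h₁.trans h₂) hjk.le ≫ Γ.l a c j h₁ h₂)
    (rr : ∀ a d (h₁ : a ≤ d) (h₂ : d ≤ j), Γ.r a j k (h₁.trans h₂) hjk.le ≫ Γ.r a d j h₁ h₂ =
      Γ.r a d k h₁ (h₂.trans hjk.le)) : Γ.IsGrid := by
  have right_eq {A B : Arrow C} {f g : A ⟶ B}
      (h : (Arrow.rightFunc : Arrow C ⥤ C).map f = Arrow.rightFunc.map g) : f.right = g.right := h
  have llR := fun a c d b h₁ h₂ h₃ => (hR.laws a c d b h₁ h₂ h₃).ll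
  have rrR := fun a c d b h₁ h₂ h₃ => (hR.laws a c d b h₁ h₂ h₃).rr
  have pbR := fun a c d b h₁ h₂ h₃ => (hR.laws a c d b h₁ h₂ h₃).pb
  have iso : ∀ a (h : a ≤ j), IsIso (Γ.r a j k h hjk.le).left := fun a h =>
    (isPullback_left (laws₁ a h).pb).isIso_fst_of_isIso
  -- the laws at the end points `a`, `c`, `d`, `k`
  have ll_k : ∀ a c d (h₁ : a < c) (h₂ : c < d) (h₃ : d ≤ k),
      Γ.l a c k h₁.le (h₂.le.trans h₃) ≫ Γ.l c d k h₂.le h₃ = Γ.l a d k (h₁.trans h₂).le h₃ := by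
    intro a c d h₁ h₂ h₃
    rcases hk d with hd | rfl | rfl
    · exact (avoid _ _ _ _ _ _ _ ((h₁.trans h₂).trans hd).ne (h₂.trans hd).ne hd.ne hjk.ne').ll
    · refine Arrow.hom_ext_of_cartesian hcart ?_ ?_
      · rw [Category.assoc, (laws₂ c h₂.le).ll, (laws₂ a (h₁.trans h₂).le).ll,
          (avoid a c k k h₁.le (h₂.trans hjk).le le_rfl (h₁.trans h₂).ne h₂.ne hjk.ne' hjk.ne').ll]
      · exact llR _ _ _ _ h₁.le h₂.le h₃
    · rcases hk c with hc | rfl | rfl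
      · exact (avoid _ _ _ _ _ _ _ (h₁.trans hc).ne hc.ne hjk.ne' hjk.ne').ll
      · exact (laws₂ a h₁.le).ll
      · exact absurd h₂ (lt_irrefl _)
  have rr_k : ∀ a c d (h₁ : a ≤ c) (h₂ : c < d) (h₃ : d < k),
      Γ.r a d k (h₁.trans h₂.le) h₃.le ≫ Γ.r a c d h₁ h₂.le = Γ.r a c k h₁ (h₂.trans h₃).le := by
    intro a c d h₁ h₂ h₃
    rcases hk d with hd | rfl | rfl
    · exact (avoid _ _ _ _ h₁ h₂.le h₃.le ((h₁.trans_lt h₂).trans hd).ne (h₂.trans hd).ne hd.ne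
        hjk.ne').rr
    · exact rr a c h₁ h₂.le
    · exact absurd h₃ (lt_irrefl _)
  have pb_k : ∀ a c d (h₁ : a < c) (h₂ : c ≤ d) (h₃ : d < k),
      IsPullback (Γ.r a d k (h₁.le.trans h₂) h₃.le) (Γ.l a c k h₁.le (h₂.trans h₃.le))
        (Γ.l a c d h₁.le h₂) (Γ.r c d k h₂ h₃.le) := by
    intro a c d h₁ h₂ h₃
    rcases hk d with hd | rfl | rfl
    · exact (avoid _ _ _ _ h₁.le h₂ h₃.le ((h₁.trans_le h₂).trans hd).ne (h₂.trans_lt hd).ne hd.ne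
        hjk.ne').pb
    · have := iso a (h₁.le.trans h₂)
      have := iso c h₂
      refine isPullback_of_left_right (IsPullback.of_horiz_isIso ⟨?_⟩) (pbR _ _ _ _ h₁.le h₂ h₃.le)
      exact congrArg Arrow.Hom.left (comm a c h₁.le h₂).symm
    · exact absurd h₃ (lt_irrefl _)
  refine IsGrid.of_nondegenerate l_refl r_refl ?_ ?_ ?_
  · intro a c d b h₁ h₂ h₃
    rcases hk b with hb | rfl | rfl
    · exact (avoid _ _ _ _ _ _ _ (((h₁.trans h₂).trans_le h₃).trans hb).ne
        ((h₂.trans_le h₃).trans hb).ne (h₃.trans_lt hb).ne hb.ne).ll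
    · refine Arrow.hom_ext_of_isIso_left (iso a ((h₁.trans h₂).le.trans h₃)) ?_ ?_
      · rw [← Category.assoc, ← comm a c h₁.le (h₂.le.trans h₃), Category.assoc,
          ← comm c d h₂.le h₃, ← Category.assoc, ll_k a c d h₁ h₂, comm]
      · exact llR _ _ _ _ h₁.le h₂.le h₃
    · exact ll_k a c d h₁ h₂ h₃
  · intro a c d b h₁ h₂ h₃
    rcases hk b with hb | rfl | rfl
    · exact (avoid _ _ _ _ h₁ h₂.le h₃.le (((h₁.trans_lt h₂).trans h₃).trans hb).ne
        ((h₂.trans h₃).trans hb).ne (h₃.trans hb).ne hb.ne).rr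
    · refine Arrow.hom_ext_of_isIso_left (iso a ((h₁.trans h₂.le).trans h₃.le)) ?_ ?_
      · rw [← Category.assoc, rr a d (h₁.trans h₂.le) h₃.le, rr_k a c d h₁ h₂ (h₃.trans hjk),
          rr a c h₁ (h₂.trans h₃).le]
      · exact rrR _ _ _ _ h₁ h₂.le h₃.le
    · exact rr_k a c d h₁ h₂ h₃
  · intro a c d b h₁ h₂ h₃
    rcases hk b with hb | rfl | rfl
    · exact (avoid _ _ _ _ h₁.le h₂ h₃.le (((h₁.trans_le h₂).trans h₃).trans hb).ne
        ((h₂.trans_lt h₃).trans hb).ne (h₃.trans hb).ne hb.ne).pb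
    · have ha := iso a ((h₁.le.trans h₂).trans h₃.le)
      have hc := iso c (h₂.trans h₃.le)
      refine isPullback_of_left_right ?_ (pbR _ _ _ _ h₁.le h₂ h₃.le)
      refine (isPullback_left (pb_k a c d h₁ h₂ (h₃.trans hjk))).of_iso
        (@asIso _ _ _ _ _ ha) (Iso.refl _) (@asIso _ _ _ _ _ hc) (Iso.refl _) ?_ ?_ ?_ ?_
      · have := congrArg Arrow.Hom.left (rr a d (h₁.le.trans h₂) h₃.le)
        simpa using this.symm
      · have := congrArg Arrow.Hom.left (comm a c h₁.le (h₂.trans h₃.le))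
        simpa using this
      · simp
      · have := congrArg Arrow.Hom.left (rr c d h₂ h₃.le)
        simpa using this.symm
    · exact pb_k a c d h₁ h₂ h₃

end SpanPregrid

/-! ### Maps from subcomplexes of a simplex to spans -/

section VertexMaps

variable {N : ℕ}

/-- The map `[1] → [N]` with values `a ≤ b`. -/
def edgeHom (a b : Fin (N + 1)) (h : a ≤ b) : ⦋1⦌ ⟶ ⦋N⦌ :=
  SimplexCategory.Hom.mk ⟨![a, b], by
    rw [Fin.monotone_iff_le_succ]; intro i; fin_cases i; exact h⟩

/-- The map `[2] → [N]` with values `a ≤ c ≤ b`. -/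
def triangleHom (a c b : Fin (N + 1)) (h : a ≤ c) (h' : c ≤ b) : ⦋2⦌ ⟶ ⦋N⦌ :=
  SimplexCategory.Hom.mk ⟨![a, c, b], by
    rw [Fin.monotone_iff_le_succ]; intro i; fin_cases i; exacts [h, h']⟩

/-- The map `[3] → [N]` with values `a ≤ c ≤ d ≤ b`. -/
def tetraHom (a c d b : Fin (N + 1)) (h₁ : a ≤ c) (h₂ : c ≤ d) (h₃ : d ≤ b) : ⦋3⦌ ⟶ ⦋N⦌ :=
  SimplexCategory.Hom.mk ⟨![a, c, d, b], by
    rw [Fin.monotone_iff_le_succ]; intro i; fin_cases i; exacts [h₁, h₂, h₃]⟩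

lemma edgeHom_comp {m : ℕ} (s : ⦋m⦌ ⟶ ⦋N⦌) (i j : Fin (m + 1)) (h : i ≤ j) :
    edgeHom i j h ≫ s =
      edgeHom (s.toOrderHom i) (s.toOrderHom j) (s.toOrderHom.monotone h) := by
  apply SimplexCategory.Hom.ext
  apply OrderHom.ext
  funext x
  fin_cases x <;> rfl

lemma triangleHom_comp {m : ℕ} (s : ⦋m⦌ ⟶ ⦋N⦌) (i c j : Fin (m + 1)) (h : i ≤ c) (h' : c ≤ j) :
    triangleHom i c j h h' ≫ s =
      triangleHom (s.toOrderHom i) (s.toOrderHom c) (s.toOrderHom j)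
        (s.toOrderHom.monotone h) (s.toOrderHom.monotone h') := by
  apply SimplexCategory.Hom.ext
  apply OrderHom.ext
  funext x
  fin_cases x <;> rfl

end VertexMaps

section Evaluation

variable {X Y : SSet.{w}} {N : ℕ} {A : (Δ[N] : SSet.{w}).Subcomplex}

/-- The simplex `s` of `Δ[N]` lies in the subcomplex `A`. -/
def MemSub (A : (Δ[N] : SSet.{w}).Subcomplex) {m : ℕ} (s : ⦋m⦌ ⟶ ⦋N⦌) : Prop :=
  SSet.stdSimplex.objEquiv.symm s ∈ A.obj (op ⦋m⦌)

lemma MemSub.precomp {m m' : ℕ} {s : ⦋m⦌ ⟶ ⦋N⦌} (hs : MemSub A s) (θ : ⦋m'⦌ ⟶ ⦋m⦌) :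
    MemSub A (θ ≫ s) := A.map θ.op hs

lemma MemSub.triangle {m : ℕ} {s : ⦋m⦌ ⟶ ⦋N⦌} (hs : MemSub A s) (i c j : Fin (m + 1))
    (h : i ≤ c) (h' : c ≤ j) : MemSub A (triangleHom (s.toOrderHom i) (s.toOrderHom c)
      (s.toOrderHom j) (s.toOrderHom.monotone h) (s.toOrderHom.monotone h')) := by
  rw [← triangleHom_comp s i c j h h']
  exact hs.precomp _

/-- The value of `σ : A → X` at a simplex of `A ⊆ Δ[N]`. -/
def evalAt (σ : (A : SSet.{w}) ⟶ X) {m : ℕ} (s : ⦋m⦌ ⟶ ⦋N⦌) (hs : MemSub A s) : X _⦋m⦌ :=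
  σ.app (op ⦋m⦌) ⟨_, hs⟩

lemma map_evalAt (σ : (A : SSet.{w}) ⟶ X) {m m' : ℕ} (s : ⦋m⦌ ⟶ ⦋N⦌) (hs : MemSub A s)
    (θ : ⦋m'⦌ ⟶ ⦋m⦌) : X.map θ.op (evalAt σ s hs) = evalAt σ (θ ≫ s) (hs.precomp θ) :=
  (NatTrans.naturality_apply σ θ.op _).symm

lemma evalAt_congr (σ : (A : SSet.{w}) ⟶ X) {m : ℕ} {s s' : ⦋m⦌ ⟶ ⦋N⦌} (h : s = s')
    (hs : MemSub A s) (hs' : MemSub A s') : evalAt σ s hs = evalAt σ s' hs' := by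
  subst h; rfl

end Evaluation

section SpanEvaluation

lemma conj_eqToHom_comp {C : Type u} [Category.{v} C] {P P' R Q Q' S : C} (f : P' ⟶ Q')
    (p : P = P') (q : Q' = Q) (r : Q = S) (s : P = R) (t : R = P') (z : Q' = S) :
    (eqToHom p ≫ f ≫ eqToHom q) ≫ eqToHom r = eqToHom s ≫ eqToHom t ≫ f ≫ eqToHom z := by
  subst p q r s
  simp

variable {C : Type u} [Category.{v} C] {N : ℕ} {A : (Δ[N] : SSet.{max u v}).Subcomplex}
  (σ : (A : SSet.{max u v}) ⟶ spanSSet C)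

lemma obj_eq_of_eq {m : ℕ} {x y : (spanSSet C) _⦋m⦌} (h : x = y) (i j : Fin (m + 1))
    (hij : i ≤ j) : x.1.obj (subinterval (n := ⦋m⦌) i j hij) =
      y.1.obj (subinterval (n := ⦋m⦌) i j hij) := by
  rw [h]

lemma map_leftHom_of_eq {m : ℕ} {x y : (spanSSet C) _⦋m⦌} (h : x = y) (i c j : Fin (m + 1))
    (hic : i ≤ c) (hcj : c ≤ j) : x.1.map (leftHom i c j hic hcj) =
      eqToHom (obj_eq_of_eq h _ _ _) ≫ y.1.map (leftHom i c j hic hcj) ≫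
        eqToHom (obj_eq_of_eq h _ _ _).symm := by
  subst h; simp

lemma map_rightHom_of_eq {m : ℕ} {x y : (spanSSet C) _⦋m⦌} (h : x = y) (i d j : Fin (m + 1))
    (hid : i ≤ d) (hdj : d ≤ j) : x.1.map (rightHom i d j hid hdj) =
      eqToHom (obj_eq_of_eq h _ _ _) ≫ y.1.map (rightHom i d j hid hdj) ≫
        eqToHom (obj_eq_of_eq h _ _ _).symm := by
  subst h; simp

variable (hE : ∀ a b h, MemSub A (edgeHom a b h))

/-- The value at the interval `[a,b]` prescribed by `σ : A → Span(C)`, if `A ⊆ Δ[N]` contains all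
edges. -/
def subObj (a b : Fin (N + 1)) (h : a ≤ b) : C :=
  (evalAt σ (edgeHom a b h) (hE a b h)).1.obj (subinterval (n := ⦋1⦌) 0 1 (Fin.zero_le 1))

lemma evalAt_obj {m : ℕ} (s : ⦋m⦌ ⟶ ⦋N⦌) (hs : MemSub A s) (i j : Fin (m + 1)) (h : i ≤ j) :
    (evalAt σ s hs).1.obj (subinterval (n := ⦋m⦌) i j h) =
      subObj σ hE (s.toOrderHom i) (s.toOrderHom j) (s.toOrderHom.monotone h) :=
  obj_eq_of_eq ((map_evalAt σ s hs (edgeHom i j h)).trans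
    (evalAt_congr σ (edgeHom_comp s i j h) _ (hE _ _ _))) 0 1 (Fin.zero_le 1)

/-- The left leg prescribed by `σ : A → Span(C)` at the end points of a triangle in `A`. -/
def subL (a c b : Fin (N + 1)) (h : a ≤ c) (h' : c ≤ b) (hT : MemSub A (triangleHom a c b h h')) :
    subObj σ hE a b (h.trans h') ⟶ subObj σ hE c b h' :=
  eqToHom (evalAt_obj σ hE _ hT 0 2 (Fin.zero_le _)).symm ≫
    (evalAt σ _ hT).1.map (leftHom 0 1 2 (Fin.zero_le _) (by decide)) ≫
    eqToHom (evalAt_obj σ hE _ hT 1 2 (by decide))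

/-- The right leg prescribed by `σ : A → Span(C)` at the end points of a triangle in `A`. -/
def subR (a d b : Fin (N + 1)) (h : a ≤ d) (h' : d ≤ b) (hT : MemSub A (triangleHom a d b h h')) :
    subObj σ hE a b (h.trans h') ⟶ subObj σ hE a d h :=
  eqToHom (evalAt_obj σ hE _ hT 0 2 (Fin.zero_le _)).symm ≫
    (evalAt σ _ hT).1.map (rightHom 0 1 2 (Fin.zero_le _) (by decide)) ≫
    eqToHom (evalAt_obj σ hE _ hT 0 1 (by decide))

lemma evalAt_l {m : ℕ} (s : ⦋m⦌ ⟶ ⦋N⦌) (hs : MemSub A s) (i c j : Fin (m + 1)) (h : i ≤ c)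
    (h' : c ≤ j) :
    (evalAt σ s hs).1.map (leftHom i c j h h') ≫ eqToHom (evalAt_obj σ hE s hs c j h') =
      eqToHom (evalAt_obj σ hE s hs i j (h.trans h')) ≫
        subL σ hE _ _ _ (s.toOrderHom.monotone h) (s.toOrderHom.monotone h')
          (hs.triangle i c j h h') := by
  have e := map_leftHom_of_eq ((map_evalAt σ s hs (triangleHom i c j h h')).trans
    (evalAt_congr σ (triangleHom_comp s i c j h h') _ (hs.triangle i c j h h'))) 0 1 2
    (Fin.zero_le _) (by decide)
  change (evalAt σ s hs).1.map (leftHom i c j h h') = _ at e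
  rw [e]
  exact conj_eqToHom_comp _ _ _ _ _ _ _

lemma evalAt_r {m : ℕ} (s : ⦋m⦌ ⟶ ⦋N⦌) (hs : MemSub A s) (i d j : Fin (m + 1)) (h : i ≤ d)
    (h' : d ≤ j) :
    (evalAt σ s hs).1.map (rightHom i d j h h') ≫ eqToHom (evalAt_obj σ hE s hs i d h) =
      eqToHom (evalAt_obj σ hE s hs i j (h.trans h')) ≫
        subR σ hE _ _ _ (s.toOrderHom.monotone h) (s.toOrderHom.monotone h')
          (hs.triangle i d j h h') := by
  have e := map_rightHom_of_eq ((map_evalAt σ s hs (triangleHom i d j h h')).trans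
    (evalAt_congr σ (triangleHom_comp s i d j h h') _ (hs.triangle i d j h h'))) 0 1 2
    (Fin.zero_le _) (by decide)
  change (evalAt σ s hs).1.map (rightHom i d j h h') = _ at e
  rw [e]
  exact conj_eqToHom_comp _ _ _ _ _ _ _

end SpanEvaluation

/-! ### Cells that extend a map on a subcomplex -/

section EqToHom

variable {C : Type u} [Category.{v} C] {D : Type u'} [Category.{v'} D]

lemma eq_id_of_comp_eqToHom {P Q : C} {f : P ⟶ P} {g : Q ⟶ Q} {p q : P = Q}
    (h : f ≫ eqToHom q = eqToHom p ≫ g) (hf : f = 𝟙 P) : g = 𝟙 Q := by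
  subst p hf
  simpa using h.symm

lemma comp_eqToHom_symm {P P' Q Q' : C} {f : P ⟶ Q} {g : P' ⟶ Q'} {p : P = P'} {q : Q = Q'}
    (h : f ≫ eqToHom q = eqToHom p ≫ g) :
    g ≫ eqToHom q.symm = eqToHom p.symm ≫ f := by
  subst p q
  simpa using h.symm

lemma map_conj_eqToHom (G : C ⥤ D) {P Q R S : C} {Q' R' : D} (f : Q ⟶ R) (g : Q' ⟶ R')
    (p : P = Q) (q : R = S) {a : G.obj Q = Q'} {b : R' = G.obj R}
    (h : G.map f = eqToHom a ≫ g ≫ eqToHom b) (c : G.obj S = R') (d : G.obj P = Q') :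
    G.map (eqToHom p ≫ f ≫ eqToHom q) ≫ eqToHom c = eqToHom d ≫ g := by
  subst p q a b
  simp [h]

end EqToHom

section SpanEvaluation

variable {C : Type u} [Category.{v} C] {N : ℕ} {A : (Δ[N] : SSet.{max u v}).Subcomplex}
  (σ : (A : SSet.{max u v}) ⟶ spanSSet C) (hE : ∀ a b h, MemSub A (edgeHom a b h))

/-- The legs prescribed by `σ : A → Span(C)` satisfy the laws at the end points of every
tetrahedron in `A`. -/
lemma quadLaws_of_memSub (a c d b : Fin (N + 1)) (h₁ : a ≤ c) (h₂ : c ≤ d) (h₃ : d ≤ b)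
    (hT : MemSub A (tetraHom a c d b h₁ h₂ h₃)) :
    QuadLaws (subL σ hE a c b h₁ (h₂.trans h₃) (hT.triangle 0 1 3 (by decide) (by decide)))
      (subL σ hE c d b h₂ h₃ (hT.triangle 1 2 3 (by decide) (by decide)))
      (subL σ hE a d b (h₁.trans h₂) h₃ (hT.triangle 0 2 3 (by decide) (by decide)))
      (subR σ hE a d b (h₁.trans h₂) h₃ (hT.triangle 0 2 3 (by decide) (by decide)))
      (subR σ hE a c d h₁ h₂ (hT.triangle 0 1 2 (by decide) (by decide)))
      (subR σ hE a c b h₁ (h₂.trans h₃) (hT.triangle 0 1 3 (by decide) (by decide)))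
      (subL σ hE a c d h₁ h₂ (hT.triangle 0 1 2 (by decide) (by decide)))
      (subR σ hE c d b h₂ h₃ (hT.triangle 1 2 3 (by decide) (by decide))) :=
  ((SpanPregrid.isGrid_ofFunctor (evalAt σ _ hT).2).laws 0 1 2 3 (by decide) (by decide)
    (by decide)).of_iso (eqToIso (evalAt_obj σ hE _ hT 0 3 (by decide)))
    (eqToIso (evalAt_obj σ hE _ hT 1 3 (by decide)))
    (eqToIso (evalAt_obj σ hE _ hT 2 3 (by decide)))
    (eqToIso (evalAt_obj σ hE _ hT 0 2 (by decide)))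
    (eqToIso (evalAt_obj σ hE _ hT 0 1 (by decide)))
    (eqToIso (evalAt_obj σ hE _ hT 1 2 (by decide)))
    (evalAt_l σ hE _ hT 0 1 3 (by decide) (by decide))
    (evalAt_l σ hE _ hT 1 2 3 (by decide) (by decide))
    (evalAt_l σ hE _ hT 0 2 3 (by decide) (by decide))
    (evalAt_r σ hE _ hT 0 2 3 (by decide) (by decide))
    (evalAt_r σ hE _ hT 0 1 2 (by decide) (by decide))
    (evalAt_r σ hE _ hT 0 1 3 (by decide) (by decide))
    (evalAt_l σ hE _ hT 0 1 2 (by decide) (by decide))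
    (evalAt_r σ hE _ hT 1 2 3 (by decide) (by decide))

lemma subL_refl (a b : Fin (N + 1)) (h : a ≤ b) (hT : MemSub A (triangleHom a a b le_rfl h)) :
    subL σ hE a a b le_rfl h hT = 𝟙 _ := by
  have e := evalAt_l σ hE (edgeHom a b h) (hE a b h) 0 0 1 le_rfl (by decide)
  exact eq_id_of_comp_eqToHom e ((evalAt σ _ (hE a b h)).1.map_id _)

lemma subR_refl (a b : Fin (N + 1)) (h : a ≤ b) (hT : MemSub A (triangleHom a b b h le_rfl)) :
    subR σ hE a b b h le_rfl hT = 𝟙 _ := by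
  have e := evalAt_r σ hE (edgeHom a b h) (hE a b h) 0 1 1 (by decide) le_rfl
  exact eq_id_of_comp_eqToHom e ((evalAt σ _ (hE a b h)).1.map_id _)

/-- A grid that extends the legs prescribed by `σ : A → Span(C)` defines a cell that
extends `σ`. -/
lemma map_cell_eq_evalAt
    {l : ∀ (a c b : Fin (N + 1)) (h : a ≤ c) (h' : c ≤ b),
      subObj σ hE a b (h.trans h') ⟶ subObj σ hE c b h'}
    {r : ∀ (a d b : Fin (N + 1)) (h : a ≤ d) (h' : d ≤ b),
      subObj σ hE a b (h.trans h') ⟶ subObj σ hE a d h}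
    (hl : ∀ a c b h h' hT, l a c b h h' = subL σ hE a c b h h' hT)
    (hr : ∀ a d b h h' hT, r a d b h h' = subR σ hE a d b h h' hT)
    (hΓ : (SpanPregrid.mk (subObj σ hE) l r).IsGrid)
    {m : ℕ} (s : ⦋m⦌ ⟶ ⦋N⦌) (hs : MemSub A s) :
    (spanSSet C).map s.op hΓ.cell = evalAt σ s hs := by
  apply Subtype.ext
  refine subintervalFunctor_ext (fun i j h => (evalAt_obj σ hE s hs i j h).symm) ?_ ?_
  · intro i c j h h'
    have e : ((spanSSet C).map s.op hΓ.cell).1.map (leftHom i c j h h') = _ :=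
      (hΓ.functor_map_leftHom _ _ _ (s.toOrderHom.monotone h) (s.toOrderHom.monotone h')).trans
        (hl _ _ _ _ _ (hs.triangle i c j h h'))
    rw [e]
    exact comp_eqToHom_symm (evalAt_l σ hE s hs i c j h h')
  · intro i d j h h'
    have e : ((spanSSet C).map s.op hΓ.cell).1.map (rightHom i d j h h') = _ :=
      (hΓ.functor_map_rightHom _ _ _ (s.toOrderHom.monotone h) (s.toOrderHom.monotone h')).trans
        (hr _ _ _ _ _ (hs.triangle i d j h h'))
    rw [e]
    exact comp_eqToHom_symm (evalAt_r σ hE s hs i d j h h')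

section Base

variable {D : Type u} [Category.{v} D] (G : C ⥤ D) [PreservesLimitsOfShape WalkingCospan G]
  {y : (spanSSet D) _⦋N⦌}
  (hy : ∀ (m : ℕ) (s : ⦋m⦌ ⟶ ⦋N⦌) (hs : MemSub A s),
    (spanMap G).app _ (evalAt σ s hs) = (spanSSet D).map s.op y)

include hy in
lemma subObj_base (a b : Fin (N + 1)) (h : a ≤ b) :
    G.obj (subObj σ hE a b h) = y.1.obj (subinterval (n := ⦋N⦌) a b h) :=
  obj_eq_of_eq (hy 1 (edgeHom a b h) (hE a b h)) 0 1 (Fin.zero_le 1)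

lemma subL_base (a c b : Fin (N + 1)) (h : a ≤ c) (h' : c ≤ b)
    (hT : MemSub A (triangleHom a c b h h')) :
    G.map (subL σ hE a c b h h' hT) ≫ eqToHom (subObj_base σ hE G hy c b h') =
      eqToHom (subObj_base σ hE G hy a b (h.trans h')) ≫ y.1.map (leftHom a c b h h') := by
  exact map_conj_eqToHom G _ _ _ _
    (map_leftHom_of_eq (hy 2 (triangleHom a c b h h') hT) 0 1 2 (Fin.zero_le _) (by decide)) _ _

lemma subR_base (a d b : Fin (N + 1)) (h : a ≤ d) (h' : d ≤ b)
    (hT : MemSub A (triangleHom a d b h h')) :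
    G.map (subR σ hE a d b h h' hT) ≫ eqToHom (subObj_base σ hE G hy a d h) =
      eqToHom (subObj_base σ hE G hy a b (h.trans h')) ≫ y.1.map (rightHom a d b h h') := by
  exact map_conj_eqToHom G _ _ _ _
    (map_rightHom_of_eq (hy 2 (triangleHom a d b h h') hT) 0 1 2 (Fin.zero_le _) (by decide)) _ _

section

variable {l : ∀ (a c b : Fin (N + 1)) (h : a ≤ c) (h' : c ≤ b),
    subObj σ hE a b (h.trans h') ⟶ subObj σ hE c b h'}
  {r : ∀ (a d b : Fin (N + 1)) (h : a ≤ d) (h' : d ≤ b),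
    subObj σ hE a b (h.trans h') ⟶ subObj σ hE a d h}
  (hl : ∀ a c b h h', G.map (l a c b h h') ≫ eqToHom (subObj_base σ hE G hy c b h') =
    eqToHom (subObj_base σ hE G hy a b (h.trans h')) ≫ y.1.map (leftHom a c b h h'))
  (hr : ∀ a d b h h', G.map (r a d b h h') ≫ eqToHom (subObj_base σ hE G hy a d h) =
    eqToHom (subObj_base σ hE G hy a b (h.trans h')) ≫ y.1.map (rightHom a d b h h'))

include hl hr

/-- The image in the base of legs that lift those of `y` satisfies the laws of a grid. -/
lemma isGrid_map_of_base : ((SpanPregrid.mk (subObj σ hE) l r).map G).IsGrid :=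
  (SpanPregrid.isGrid_ofFunctor y.2).of_iso
    (fun a b h => eqToIso (subObj_base σ hE G hy a b h).symm)
    (fun a c b h h' => comp_eqToHom_symm (hl a c b h h'))
    (fun a d b h h' => comp_eqToHom_symm (hr a d b h h'))

lemma spanMap_cell_eq (hΓ : (SpanPregrid.mk (subObj σ hE) l r).IsGrid) :
    (spanMap G).app _ hΓ.cell = y := by
  apply Subtype.ext
  refine subintervalFunctor_ext (fun i j h => subObj_base σ hE G hy i j h) ?_ ?_
  · intro i c j h h'
    have e : ((spanMap G).app _ hΓ.cell).1.map (leftHom i c j h h') = G.map (l i c j h h') :=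
      congrArg G.map (hΓ.functor_map_leftHom _ _ _ h h')
    rw [e]
    exact hl i c j h h'
  · intro i d j h h'
    have e : ((spanMap G).app _ hΓ.cell).1.map (rightHom i d j h h') = G.map (r i d j h h') :=
      congrArg G.map (hΓ.functor_map_rightHom _ _ _ h h')
    rw [e]
    exact hr i d j h h'

end

end Base

end SpanEvaluation

/-! ### Fillers of inner horns -/

section HornMembership

variable {N : ℕ} {k : Fin (N + 1)}

lemma memSub_horn_iff {m : ℕ} (s : ⦋m⦌ ⟶ ⦋N⦌) :
    MemSub (SSet.horn.{w} N k) s ↔ ∃ j, j ≠ k ∧ ∀ i, s.toOrderHom i ≠ j := by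
  refine (SSet.mem_horn_iff_notMem_range _ _).trans ?_
  constructor
  · rintro ⟨j, hj, h⟩
    exact ⟨j, hj, fun i hi => h ⟨i, hi⟩⟩
  · rintro ⟨j, hj, h⟩
    exact ⟨j, hj, fun ⟨i, hi⟩ => h i hi⟩

lemma memSub_horn_triangle {a c b : Fin (N + 1)} {h : a ≤ c} {h' : c ≤ b} (j : Fin (N + 1))
    (hj : j ≠ k) (ha : a ≠ j) (hc : c ≠ j) (hb : b ≠ j) :
    MemSub (SSet.horn.{w} N k) (triangleHom a c b h h') :=
  (memSub_horn_iff _).2 ⟨j, hj, fun i => by fin_cases i; exacts [ha, hc, hb]⟩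

lemma memSub_horn_tetra {a c d b : Fin (N + 1)} {h₁ : a ≤ c} {h₂ : c ≤ d} {h₃ : d ≤ b}
    (j : Fin (N + 1)) (hj : j ≠ k) (ha : a ≠ j) (hc : c ≠ j) (hd : d ≠ j) (hb : b ≠ j) :
    MemSub (SSet.horn.{w} N k) (tetraHom a c d b h₁ h₂ h₃) :=
  (memSub_horn_iff _).2 ⟨j, hj, fun i => by fin_cases i; exacts [ha, hc, hd, hb]⟩

lemma exists_of_memSub_horn_triangle {a c b : Fin (N + 1)} {h : a ≤ c} {h' : c ≤ b}
    (hT : MemSub (SSet.horn.{w} N k) (triangleHom a c b h h')) :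
    ∃ j, j ≠ k ∧ a ≠ j ∧ c ≠ j ∧ b ≠ j := by
  obtain ⟨j, hj, h⟩ := (memSub_horn_iff _).1 hT
  exact ⟨j, hj, h 0, h 1, h 2⟩

lemma exists_avoid_three (hN : 3 ≤ N) (x y z : Fin (N + 1)) : ∃ j, j ≠ x ∧ y ≠ j ∧ z ≠ j := by
  have h : ({x, y, z} : Finset (Fin (N + 1))).card < (Finset.univ : Finset (Fin (N + 1))).card :=
    (Finset.card_le_three).trans_lt (by simp; omega)
  obtain ⟨j, -, hj⟩ := Finset.exists_mem_notMem_of_card_lt_card h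
  simp only [Finset.mem_insert, Finset.mem_singleton, not_or] at hj
  exact ⟨j, hj.1, Ne.symm hj.2.1, Ne.symm hj.2.2⟩

lemma memSub_horn_edge (hN : 3 ≤ N) (a b : Fin (N + 1)) (h : a ≤ b) :
    MemSub (SSet.horn.{w} N k) (edgeHom a b h) := by
  obtain ⟨j, hj, ha, hb⟩ := exists_avoid_three hN k a b
  exact (memSub_horn_iff _).2 ⟨j, hj, fun i => by fin_cases i; exacts [ha, hb]⟩

end HornMembership

/-- Naturality squares compose. -/
lemma map_comp_natural {C : Type u} [Category.{v} C] {D : Type u'} [Category.{v'} D] (G : C ⥤ D)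
    {P Q R : C} {P' Q' R' : D} {f : P ⟶ Q} {g : Q ⟶ R} {m : P ⟶ R} {f' : P' ⟶ Q'} {g' : Q' ⟶ R'}
    {m' : P' ⟶ R'} {p : G.obj P ⟶ P'} {q : G.obj Q ⟶ Q'} {r : G.obj R ⟶ R'}
    (hm : f ≫ g = m) (hm' : f' ≫ g' = m') (hf : G.map f ≫ q = p ≫ f')
    (hg : G.map g ≫ r = q ≫ g') : G.map m ≫ r = p ≫ m' := by
  rw [← hm, ← hm', G.map_comp, Category.assoc, hg, reassoc_of% hf]

/-- Naturality of a map into a pullback is checked on the projections. -/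
lemma map_natural_of_isPullback {C : Type u} [Category.{v} C] {D : Type u'} [Category.{v'} D]
    (G : C ⥤ D) {P Q R S : C} {P' Q' R' S' T' : D} {f : P ⟶ Q} {g : Q ⟶ R} {h : Q ⟶ S}
    {f' : P' ⟶ Q'} {g' : Q' ⟶ R'} {h' : Q' ⟶ S'} {x' : R' ⟶ T'} {y' : S' ⟶ T'}
    {fg : P ⟶ R} {fh : P ⟶ S} {fg' : P' ⟶ R'} {fh' : P' ⟶ S'}
    {p : G.obj P ⟶ P'} {q : G.obj Q ⟶ Q'} {r : G.obj R ⟶ R'} {s : G.obj S ⟶ S'}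
    (pb : IsPullback g' h' x' y') (hg : G.map g ≫ r = q ≫ g') (hh : G.map h ≫ s = q ≫ h')
    (e₁ : f ≫ g = fg) (e₁' : f' ≫ g' = fg') (e₂ : f ≫ h = fh) (e₂' : f' ≫ h' = fh')
    (hfg : G.map fg ≫ r = p ≫ fg') (hfh : G.map fh ≫ s = p ≫ fh') :
    G.map f ≫ q = p ≫ f' := by
  apply pb.hom_ext
  · rw [Category.assoc, ← hg, ← G.map_comp_assoc, e₁, hfg, Category.assoc, e₁']
  · rw [Category.assoc, ← hh, ← G.map_comp_assoc, e₂, hfh, Category.assoc, e₂']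

lemma QuadLaws.congr {C : Type u} [Category.{v} C] {ab cb db ad ac cd : C}
    {lacb lacb' : ab ⟶ cb} {lcdb lcdb' : cb ⟶ db} {ladb ladb' : ab ⟶ db}
    {radb radb' : ab ⟶ ad} {racd racd' : ad ⟶ ac} {racb racb' : ab ⟶ ac}
    {lacd lacd' : ad ⟶ cd} {rcdb rcdb' : cb ⟶ cd}
    (h : QuadLaws lacb lcdb ladb radb racd racb lacd rcdb)
    (h₁ : lacb' = lacb) (h₂ : lcdb' = lcdb) (h₃ : ladb' = ladb) (h₄ : radb' = radb)
    (h₅ : racd' = racd) (h₆ : racb' = racb) (h₇ : lacd' = lacd) (h₈ : rcdb' = rcdb) :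
    QuadLaws lacb' lcdb' ladb' radb' racd' racb' lacd' rcdb' := by
  subst h₁ h₂ h₃ h₄ h₅ h₆ h₇ h₈
  exact h

variable {C : Type u} [Category.{v} C] {D : Type u} [Category.{v} D]

/-- Horns of dimension at least three with an inner vertex `k` removed have fillers in spans over
any cell of the base that extends their image. The legs on the missing face are forced: the
left leg at `a ≤ c ≤ b` is a composite if `k ≤ c`, and is determined by the decomposition of
`[c,b]` at `k` otherwise. -/
theorem exists_inner_filler (G : C ⥤ D) [PreservesLimitsOfShape WalkingCospan G]
    {N : ℕ} (hN : 3 ≤ N) {k : Fin (N + 1)} (h0 : 0 < k) (hk : k < Fin.last N)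
    (σ : (SSet.horn.{max u v} N k : SSet.{max u v}) ⟶ spanSSet C) (y : (spanSSet D) _⦋N⦌)
    (hy : ∀ (m : ℕ) (s : ⦋m⦌ ⟶ ⦋N⦌) (hs : MemSub (SSet.horn N k) s),
      (spanMap G).app _ (evalAt σ s hs) = (spanSSet D).map s.op y) :
    ∃ z : (spanSSet C) _⦋N⦌,
      (∀ (m : ℕ) (s : ⦋m⦌ ⟶ ⦋N⦌) (hs : MemSub (SSet.horn N k) s),
        (spanSSet C).map s.op z = evalAt σ s hs) ∧ (spanMap G).app _ z = y := by
  have hE := fun a b h => memSub_horn_edge.{max u v} (k := k) hN a b h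
  -- which triangles and tetrahedra lie in the horn
  have mk₁ : ∀ {c b} (h : k ≤ c) (h' : c ≤ b),
      MemSub (SSet.horn.{max u v} N k) (triangleHom k c b h h') := fun {c b} h h' => by
    obtain ⟨j, hj, h₁, h₂⟩ := exists_avoid_three hN k c b
    exact memSub_horn_triangle j hj hj.symm h₁ h₂
  have mk₂ : ∀ {a b} (h : a ≤ k) (h' : k ≤ b),
      MemSub (SSet.horn.{max u v} N k) (triangleHom a k b h h') := fun {a b} h h' => by
    obtain ⟨j, hj, h₁, h₂⟩ := exists_avoid_three hN k a b
    exact memSub_horn_triangle j hj h₁ hj.symm h₂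
  have mk₃ : ∀ {a c} (h : a ≤ c) (h' : c ≤ k),
      MemSub (SSet.horn.{max u v} N k) (triangleHom a c k h h') := fun {a c} h h' => by
    obtain ⟨j, hj, h₁, h₂⟩ := exists_avoid_three hN k a c
    exact memSub_horn_triangle j hj h₁ h₂ hj.symm
  have mkk : ∀ {a b} (h : a ≤ k) (h' : k ≤ b),
      MemSub (SSet.horn.{max u v} N k) (tetraHom a k k b h le_rfl h') := fun {a b} h h' => by
    obtain ⟨j, hj, h₁, h₂⟩ := exists_avoid_three hN k a b
    exact memSub_horn_tetra j hj h₁ hj.symm hj.symm h₂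
  have mside : ∀ {a c d b} (h₁ : a ≤ c) (h₂ : c ≤ d) (h₃ : d ≤ b), b ≤ k ∨ k ≤ a →
      MemSub (SSet.horn.{max u v} N k) (tetraHom a c d b h₁ h₂ h₃) := by
    rintro a c d b h₁ h₂ h₃ (h | h)
    · have hb := h.trans_lt hk
      exact memSub_horn_tetra (Fin.last N) hk.ne' ((h₁.trans (h₂.trans h₃)).trans_lt hb).ne
        ((h₂.trans h₃).trans_lt hb).ne (h₃.trans_lt hb).ne hb.ne
    · have ha := h0.trans_le h
      exact memSub_horn_tetra 0 h0.ne ha.ne' (ha.trans_le h₁).ne' (ha.trans_le (h₁.trans h₂)).ne'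
        (ha.trans_le (h₁.trans (h₂.trans h₃))).ne'
  have mside' : ∀ {a c b} (h : a ≤ c) (h' : c ≤ b), b ≤ k ∨ k ≤ a →
      MemSub (SSet.horn.{max u v} N k) (triangleHom a c b h h') := fun h h' hs =>
    (mside h le_rfl h' hs).triangle 0 1 3 (by decide) (by decide)
  have minsert₁ : ∀ {a c b} {h : a ≤ c} {h' : c ≤ b},
      MemSub (SSet.horn.{max u v} N k) (triangleHom a c b h h') → ∀ (h₁ : a ≤ k) (h₂ : k ≤ c),
      MemSub (SSet.horn.{max u v} N k) (tetraHom a k c b h₁ h₂ h') := by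
    intro a c b h h' hT h₁ h₂
    obtain ⟨j, hj, ha, hc, hb⟩ := exists_of_memSub_horn_triangle hT
    exact memSub_horn_tetra j hj ha hj.symm hc hb
  have minsert₂ : ∀ {a c b} {h : a ≤ c} {h' : c ≤ b},
      MemSub (SSet.horn.{max u v} N k) (triangleHom a c b h h') → ∀ (h₁ : c ≤ k) (h₂ : k ≤ b),
      MemSub (SSet.horn.{max u v} N k) (tetraHom a c k b h h₁ h₂) := by
    intro a c b h h' hT h₁ h₂
    obtain ⟨j, hj, ha, hc, hb⟩ := exists_of_memSub_horn_triangle hT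
    exact memSub_horn_tetra j hj ha hc hj.symm hb
  -- the left legs
  have exl : ∀ (a c b : Fin (N + 1)) (h : a ≤ c) (h' : c ≤ b),
      ∃ m : subObj σ hE a b (h.trans h') ⟶ subObj σ hE c b h',
        (∀ hT, m = subL σ hE a c b h h' hT) ∧
        (∀ (h₁ : a ≤ k) (h₂ : k ≤ c), subL σ hE a k b h₁ (h₂.trans h') (mk₂ _ _) ≫
          subL σ hE k c b h₂ h' (mk₁ _ _) = m) ∧
        (∀ (h₁ : c ≤ k) (h₂ : k ≤ b),
          m ≫ subL σ hE c k b h₁ h₂ (mk₂ _ _) = subL σ hE a k b (h.trans h₁) h₂ (mk₂ _ _) ∧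
          m ≫ subR σ hE c k b h₁ h₂ (mk₂ _ _) =
            subR σ hE a k b (h.trans h₁) h₂ (mk₂ _ _) ≫ subL σ hE a c k h h₁ (mk₃ _ _)) := by
    intro a c b h h'
    by_cases hT : MemSub (SSet.horn.{max u v} N k) (triangleHom a c b h h')
    · refine ⟨subL σ hE a c b h h' hT, fun _ => rfl, fun h₁ h₂ => ?_, fun h₁ h₂ => ⟨?_, ?_⟩⟩
      · exact (quadLaws_of_memSub σ hE a k c b h₁ h₂ h' (minsert₁ hT h₁ h₂)).ll
      · exact (quadLaws_of_memSub σ hE a c k b h h₁ h₂ (minsert₂ hT h₁ h₂)).ll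
      · exact (quadLaws_of_memSub σ hE a c k b h h₁ h₂ (minsert₂ hT h₁ h₂)).comm.symm
    · have hbk : k ≤ b := le_of_not_ge fun hb => hT (mside' h h' (Or.inl hb))
      have hak : a ≤ k := le_of_not_ge fun ha => hT (mside' h h' (Or.inr ha))
      have hck : c ≠ k := fun hc => hT (by subst hc; exact mk₂ _ _)
      rcases le_total k c with hkc | hck'
      · exact ⟨subL σ hE a k b hak hbk (mk₂ _ _) ≫ subL σ hE k c b hkc h' (mk₁ _ _),
          fun hT' => absurd hT' hT, fun h₁ h₂ => rfl,
          fun h₁ h₂ => absurd (le_antisymm h₁ hkc) hck⟩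
      · have pb := (quadLaws_of_memSub σ hE c k k b hck' le_rfl hbk (mkk _ _)).pb
        have w : (subR σ hE a k b hak hbk (mk₂ _ _) ≫ subL σ hE a c k h hck' (mk₃ _ _)) ≫
            subL σ hE c k k hck' le_rfl (mk₂ _ _) =
            subL σ hE a k b hak hbk (mk₂ _ _) ≫ subR σ hE k k b le_rfl hbk (mk₂ _ _) := by
          rw [Category.assoc, (quadLaws_of_memSub σ hE a c k k h hck' le_rfl
            (mside _ _ _ (Or.inl le_rfl))).ll]
          exact (quadLaws_of_memSub σ hE a k k b hak le_rfl hbk (mkk _ _)).comm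
        exact ⟨pb.lift _ _ w, fun hT' => absurd hT' hT,
          fun h₁ h₂ => absurd (le_antisymm hck' h₂) hck,
          fun h₁ h₂ => ⟨pb.lift_snd _ _ w, pb.lift_fst _ _ w⟩⟩
  -- the right legs
  have exr : ∀ (a d b : Fin (N + 1)) (h : a ≤ d) (h' : d ≤ b),
      ∃ m : subObj σ hE a b (h.trans h') ⟶ subObj σ hE a d h,
        (∀ hT, m = subR σ hE a d b h h' hT) ∧
        (∀ (h₁ : d ≤ k) (h₂ : k ≤ b), subR σ hE a k b (h.trans h₁) h₂ (mk₂ _ _) ≫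
          subR σ hE a d k h h₁ (mk₃ _ _) = m) ∧
        (∀ (h₁ : a ≤ k) (h₂ : k ≤ d),
          m ≫ subR σ hE a k d h₁ h₂ (mk₂ _ _) = subR σ hE a k b h₁ (h₂.trans h') (mk₂ _ _) ∧
          m ≫ subL σ hE a k d h₁ h₂ (mk₂ _ _) =
            subL σ hE a k b h₁ (h₂.trans h') (mk₂ _ _) ≫ subR σ hE k d b h₂ h' (mk₁ _ _)) := by
    intro a d b h h'
    by_cases hT : MemSub (SSet.horn.{max u v} N k) (triangleHom a d b h h')
    · refine ⟨subR σ hE a d b h h' hT, fun _ => rfl, fun h₁ h₂ => ?_, fun h₁ h₂ => ⟨?_, ?_⟩⟩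
      · exact (quadLaws_of_memSub σ hE a d k b h h₁ h₂ (minsert₂ hT h₁ h₂)).rr
      · exact (quadLaws_of_memSub σ hE a k d b h₁ h₂ h' (minsert₁ hT h₁ h₂)).rr
      · exact (quadLaws_of_memSub σ hE a k d b h₁ h₂ h' (minsert₁ hT h₁ h₂)).comm
    · have hbk : k ≤ b := le_of_not_ge fun hb => hT (mside' h h' (Or.inl hb))
      have hak : a ≤ k := le_of_not_ge fun ha => hT (mside' h h' (Or.inr ha))
      have hdk : d ≠ k := fun hd => hT (by subst hd; exact mk₂ _ _)
      rcases le_total d k with hdk' | hkd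
      · exact ⟨subR σ hE a k b hak hbk (mk₂ _ _) ≫ subR σ hE a d k h hdk' (mk₃ _ _),
          fun hT' => absurd hT' hT, fun h₁ h₂ => rfl,
          fun h₁ h₂ => absurd (le_antisymm hdk' h₂) hdk⟩
      · have pb := (quadLaws_of_memSub σ hE a k k d hak le_rfl hkd (mkk _ _)).pb
        have w : subR σ hE a k b hak hbk (mk₂ _ _) ≫ subL σ hE a k k hak le_rfl (mk₂ _ _) =
            (subL σ hE a k b hak hbk (mk₂ _ _) ≫ subR σ hE k d b hkd h' (mk₁ _ _)) ≫
              subR σ hE k k d le_rfl hkd (mk₂ _ _) := by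
          rw [Category.assoc, (quadLaws_of_memSub σ hE k k d b le_rfl hkd h'
            (mside _ _ _ (Or.inr le_rfl))).rr]
          exact (quadLaws_of_memSub σ hE a k k b hak le_rfl hbk (mkk _ _)).comm
        exact ⟨pb.lift _ _ w, fun hT' => absurd hT' hT,
          fun h₁ h₂ => absurd (le_antisymm h₁ hkd) hdk,
          fun h₁ h₂ => ⟨pb.lift_fst _ _ w, pb.lift_snd _ _ w⟩⟩
  choose l hl hl₁ hl₂ using exl
  choose r hr hr₁ hr₂ using exr
  have hΓ : (SpanPregrid.mk (subObj σ hE) l r).IsGrid := by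
    refine SpanPregrid.IsGrid.of_inner k ?_ ?_ ?_ ?_ ?_ ?_ ?_ ?_ ?_ ?_
    · intro a b h
      have hT := MemSub.triangle (hE a b h) 0 0 1 (by decide) (by decide)
      exact (hl _ _ _ _ _ hT).trans (subL_refl σ hE a b h hT)
    · intro a b h
      have hT := MemSub.triangle (hE a b h) 0 1 1 (by decide) (by decide)
      exact (hr _ _ _ _ _ hT).trans (subR_refl σ hE a b h hT)
    · intro a c d b h₁ h₂ h₃ hs
      have hT := mside h₁ h₂ h₃ hs
      exact (quadLaws_of_memSub σ hE a c d b h₁ h₂ h₃ hT).congr (hl ..) (hl ..) (hl ..) (hr ..)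
        (hr ..) (hr ..) (hl ..) (hr ..)
    · intro a c b h₁ h₂ h₃
      exact (congrArg _ (hl ..)).trans (((hl₂ a c b h₁ (h₂.trans h₃) h₂ h₃).1).trans (hl ..).symm)
    · intro a d b h₁ h₂ h₃
      exact (congrArg₂ _ (hl ..) (hl ..)).trans (hl₁ a d b (h₁.trans h₂) h₃ h₁ h₂)
    · intro a c b h₁ h₂ h₃
      exact (congrArg₂ _ (hr ..) (hr ..)).trans (hr₁ a c b h₁ (h₂.trans h₃) h₂ h₃)
    · intro a d b h₁ h₂ h₃
      exact (congrArg _ (hr ..)).trans (((hr₂ a d b (h₁.trans h₂) h₃ h₁ h₂).1).trans (hr ..).symm)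
    · intro a c b h₁ h₂ h₃
      exact (congrArg₂ _ (hr ..) (hl ..)).trans
        ((hl₂ a c b h₁ (h₂.trans h₃) h₂ h₃).2.symm.trans (congrArg _ (hr ..).symm))
    · intro a d b h₁ h₂ h₃
      exact (congrArg _ (hl ..)).trans
        ((hr₂ a d b (h₁.trans h₂) h₃ h₁ h₂).2.trans (congrArg₂ _ (hl ..).symm (hr ..).symm))
    · intro a b h₁ h₂
      exact ((quadLaws_of_memSub σ hE a k k b h₁ le_rfl h₂ (mkk _ _)).congr (hl ..) (hl ..) (hl ..)
        (hr ..) (hr ..) (hr ..) (hl ..) (hr ..)).pb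
  have hY := SpanPregrid.isGrid_ofFunctor y.2
  refine ⟨hΓ.cell, fun m s hs => map_cell_eq_evalAt σ hE hl hr hΓ s hs,
    spanMap_cell_eq σ hE G hy ?_ ?_ hΓ⟩
  · intro a c b h h'
    by_cases hT : MemSub (SSet.horn.{max u v} N k) (triangleHom a c b h h')
    · exact (congrArg (fun m => G.map m ≫ eqToHom (subObj_base σ hE G hy c b h'))
        (hl a c b h h' hT)).trans (subL_base σ hE G hy a c b h h' hT)
    have hbk : k ≤ b := le_of_not_ge fun hb => hT (mside' h h' (Or.inl hb))
    have hak : a ≤ k := le_of_not_ge fun ha => hT (mside' h h' (Or.inr ha))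
    rcases le_total k c with hkc | hck
    · exact map_comp_natural G (hl₁ a c b h h' hak hkc) (hY.laws a k c b hak hkc h').ll
        (subL_base σ hE G hy a k b hak hbk _) (subL_base σ hE G hy k c b hkc h' _)
    · have e₁' := (hY.laws a c k b h hck hbk).comm
      exact map_natural_of_isPullback G (hY.laws c k k b hck le_rfl hbk).pb
        (subR_base σ hE G hy c k b hck hbk _) (subL_base σ hE G hy c k b hck hbk _)
        (hl₂ a c b h h' hck hbk).2 e₁'.symm (hl₂ a c b h h' hck hbk).1
        (hY.laws a c k b h hck hbk).ll
        (map_comp_natural G rfl rfl (subR_base σ hE G hy a k b hak hbk _)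
          (subL_base σ hE G hy a c k h hck _))
        (subL_base σ hE G hy a k b hak hbk _)
  · intro a d b h h'
    by_cases hT : MemSub (SSet.horn.{max u v} N k) (triangleHom a d b h h')
    · exact (congrArg (fun m => G.map m ≫ eqToHom (subObj_base σ hE G hy a d h))
        (hr a d b h h' hT)).trans (subR_base σ hE G hy a d b h h' hT)
    have hbk : k ≤ b := le_of_not_ge fun hb => hT (mside' h h' (Or.inl hb))
    have hak : a ≤ k := le_of_not_ge fun ha => hT (mside' h h' (Or.inr ha))
    rcases le_total d k with hdk | hkd
    · exact map_comp_natural G (hr₁ a d b h h' hdk hbk) (hY.laws a d k b h hdk hbk).rr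
        (subR_base σ hE G hy a k b hak hbk _) (subR_base σ hE G hy a d k h hdk _)
    · exact map_natural_of_isPullback G (hY.laws a k k d hak le_rfl hkd).pb
        (subR_base σ hE G hy a k d hak hkd _) (subL_base σ hE G hy a k d hak hkd _)
        (hr₂ a d b h h' hak hkd).1 (hY.laws a k d b hak hkd h').rr (hr₂ a d b h h' hak hkd).2
        (hY.laws a k d b hak hkd h').comm (subR_base σ hE G hy a k b hak hbk _)
        (map_comp_natural G rfl rfl (subL_base σ hE G hy a k b hak hbk _)
          (subR_base σ hE G hy k d b hkd h' _))

/-! ### Fillers of outer horns that end in a special edge -/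

/-- The special edges of spans of arrows: the left leg is an isomorphism on domains, and the right
leg is a cartesian square. -/
def IsSpecialEdge {C : Type u} [Category.{v} C] (f : (spanSSet (Arrow C)) _⦋1⦌) : Prop :=
  IsPullback (spanRightLeg f).left (spanApex f).hom (spanTarget f).hom (spanRightLeg f).right ∧
    IsIso (spanLeftLeg f).left

section

variable {C : Type u} [Category.{v} C]

lemma isIso_left_of_comp_eqToHom {P P' Q Q' : Arrow C} {f : P ⟶ Q} {g : P' ⟶ Q'} {p : P = P'}
    {q : Q = Q'} (h : f ≫ eqToHom q = eqToHom p ≫ g) (hf : IsIso f.left) : IsIso g.left := by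
  subst p q
  obtain rfl : f = g := by simpa using h
  exact hf

lemma isPullback_of_comp_eqToHom {P P' Q Q' : Arrow C} {f : P ⟶ Q} {g : P' ⟶ Q'} {p : P = P'}
    {q : Q = Q'} (h : f ≫ eqToHom q = eqToHom p ≫ g)
    (hf : IsPullback f.left P.hom Q.hom f.right) : IsPullback g.left P'.hom Q'.hom g.right := by
  subst p q
  obtain rfl : f = g := by simpa using h
  exact hf

/-- Maps of arrows that are isomorphisms on domains are cocartesian. -/
lemma Arrow.exists_comp_eq_of_isIso_left {A P Q : Arrow C} (e : A ⟶ P) (he : IsIso e.left)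
    (g : A ⟶ Q) (t : P.right ⟶ Q.right) (h : e.right ≫ t = g.right) :
    ∃ m : P ⟶ Q, m.right = t ∧ e ≫ m = g := by
  refine ⟨Arrow.homMk (inv e.left ≫ g.left) t ?_, rfl, ?_⟩
  · rw [Category.assoc, Arrow.w g, ← h, IsIso.inv_comp_eq, ← Category.assoc, ← Category.assoc,
      Arrow.w e]
  · ext
    · exact IsIso.hom_inv_id_assoc _ _
    · exact h

lemma map_comp_conj_eqToHom {D : Type u'} [Category.{v'} D] (G : C ⥤ D)
    {P Q R : C} {P' Q' R' : D} {e : P ⟶ Q} {g : P ⟶ R} {e' : P' ⟶ Q'} {g' : P' ⟶ R'}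
    {p : G.obj P ⟶ P'} {q : G.obj Q = Q'} {r : G.obj R = R'}
    (he : G.map e ≫ eqToHom q = p ≫ e') (hg : G.map g ≫ eqToHom r = p ≫ g')
    {t' : Q' ⟶ R'} (h : e' ≫ t' = g') :
    G.map e ≫ eqToHom q ≫ t' ≫ eqToHom r.symm = G.map g := by
  subst q r
  simp only [eqToHom_refl, Category.comp_id, Category.id_comp] at he hg ⊢
  rw [he, hg, Category.assoc, h]

lemma comp_eqToHom_of_eq_conj {P Q P' Q' : C} {f : P ⟶ Q} {f' : P' ⟶ Q'} {p : P = P'}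
    {q : Q = Q'} (h : f = eqToHom p ≫ f' ≫ eqToHom q.symm) :
    f ≫ eqToHom q = eqToHom p ≫ f' := by
  subst p q
  simpa using h

end

/-- Horns of dimension at least three with the last vertex `k` removed, the last edge `[j,k]` of
which is special, have fillers in spans of arrows over any cell of the base that extends their
image. The legs on the missing face are forced, as the maps from `[a,k]` to `[a,j]` are
isomorphisms on domains. -/
theorem exists_right_filler {C : Type (v + 1)} [LargeCategory.{v} C]
    [PreservesLimitsOfShape WalkingCospan (Arrow.rightFunc : Arrow C ⥤ C)]
    {N : ℕ} (hN : 3 ≤ N) {j k : Fin (N + 1)} (hjk : j < k) (hk : ∀ b, b < j ∨ b = j ∨ b = k)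
    (σ : (SSet.horn.{v + 1} N k : SSet.{v + 1}) ⟶ spanSSet (Arrow C)) (y : (spanSSet C) _⦋N⦌)
    (hy : ∀ (m : ℕ) (s : ⦋m⦌ ⟶ ⦋N⦌) (hs : MemSub (SSet.horn.{v + 1} N k) s),
      (spanMap (Arrow.rightFunc : Arrow C ⥤ C)).app _ (evalAt σ s hs) = (spanSSet C).map s.op y)
    (hσ : IsSpecialEdge (evalAt σ (edgeHom j k hjk.le) (memSub_horn_edge hN _ _ _))) :
    ∃ z : (spanSSet (Arrow C)) _⦋N⦌,
      (∀ (m : ℕ) (s : ⦋m⦌ ⟶ ⦋N⦌) (hs : MemSub (SSet.horn.{v + 1} N k) s),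
        (spanSSet (Arrow C)).map s.op z = evalAt σ s hs) ∧
      (spanMap (Arrow.rightFunc : Arrow C ⥤ C)).app _ z = y := by
  have hE := fun a b h => memSub_horn_edge.{v + 1} (k := k) hN a b h
  have hY := SpanPregrid.isGrid_ofFunctor y.2
  have hlast : ∀ b, b ≤ k := fun b => by
    rcases hk b with h | rfl | rfl
    exacts [(h.trans hjk).le, hjk.le, le_rfl]
  -- which triangles and tetrahedra lie in the horn
  have mk : ∀ {a c} (h : a ≤ c) (h' : c ≤ k),
      MemSub (SSet.horn.{v + 1} N k) (triangleHom a c k h h') := fun {a c} h h' => by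
    obtain ⟨i, hi, h₁, h₂⟩ := exists_avoid_three hN k a c
    exact memSub_horn_triangle i hi h₁ h₂ hi.symm
  have mj : ∀ {a c d b} (h₁ : a ≤ c) (h₂ : c ≤ d) (h₃ : d ≤ b) (_ : c = j ∨ c = k)
      (_ : d = j ∨ d = k) (_ : b = j ∨ b = k),
      MemSub (SSet.horn.{v + 1} N k) (tetraHom a c d b h₁ h₂ h₃) := by
    intro a c d b h₁ h₂ h₃ hc hd hb
    obtain ⟨i, hi, h₁, h₂⟩ := exists_avoid_three hN k a j
    have aux : ∀ x, x = j ∨ x = k → x ≠ i := by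
      rintro x (rfl | rfl)
      exacts [h₂, hi.symm]
    exact memSub_horn_tetra i hi h₁ (aux c hc) (aux d hd) (aux b hb)
  have minsert : ∀ {a c b} {h : a ≤ c} {h' : c ≤ b},
      MemSub (SSet.horn.{v + 1} N k) (triangleHom a c b h h') → ∀ (h'' : b ≤ k),
      MemSub (SSet.horn.{v + 1} N k) (tetraHom a c b k h h' h'') := by
    intro a c b h h' hT h''
    obtain ⟨i, hi, ha, hc, hb⟩ := exists_of_memSub_horn_triangle hT
    exact memSub_horn_tetra i hi ha hc hb hi.symm
  have eq_j : ∀ {a c b} (h : a ≤ c) (h' : c ≤ b),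
      ¬ MemSub (SSet.horn.{v + 1} N k) (triangleHom a c b h h') → b = j := by
    intro a c b h h' hT
    rcases hk b with hb | hb | rfl
    · exact absurd (memSub_horn_triangle j hjk.ne ((h.trans h').trans_lt hb).ne
        (h'.trans_lt hb).ne hb.ne) hT
    · exact hb
    · exact absurd (mk h h') hT
  have hiso : IsIso (subR σ hE j j k le_rfl hjk.le (mk _ _)).left :=
    isIso_left_of_comp_eqToHom (evalAt_r σ hE (edgeHom j k hjk.le) (hE _ _ _) 0 0 1 le_rfl
      (Fin.zero_le _)) hσ.2
  have hcart := isPullback_of_comp_eqToHom (evalAt_l σ hE (edgeHom j k hjk.le) (hE _ _ _) 0 1 1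
      (Fin.zero_le _) le_rfl) hσ.1
  have iso : ∀ a (h : a ≤ j), IsIso (subR σ hE a j k h hjk.le (mk _ _)).left := fun a h =>
    (isPullback_left (quadLaws_of_memSub σ hE a j j k h le_rfl hjk.le
      (mj _ _ _ (.inl rfl) (.inl rfl) (.inr rfl))).pb).isIso_fst_of_isIso
  -- the left legs
  have exl : ∀ (a c b : Fin (N + 1)) (h : a ≤ c) (h' : c ≤ b),
      ∃ m : subObj σ hE a b (h.trans h') ⟶ subObj σ hE c b h',
        (∀ hT, m = subL σ hE a c b h h' hT) ∧
        (∀ (h₁ : b ≤ k), subL σ hE a c k h (h'.trans h₁) (mk _ _) ≫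
          subR σ hE c b k h' h₁ (mk _ _) = subR σ hE a b k (h.trans h') h₁ (mk _ _) ≫ m) ∧
        (Arrow.rightFunc : Arrow C ⥤ C).map m ≫ eqToHom (subObj_base σ hE _ hy c b h') =
          eqToHom (subObj_base σ hE _ hy a b (h.trans h')) ≫ y.1.map (leftHom a c b h h') := by
    intro a c b h h'
    by_cases hT : MemSub (SSet.horn.{v + 1} N k) (triangleHom a c b h h')
    · exact ⟨subL σ hE a c b h h' hT, fun _ => rfl, fun h₁ =>
        (quadLaws_of_memSub σ hE a c b k h h' h₁ (minsert hT h₁)).comm.symm,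
        subL_base σ hE _ hy a c b h h' hT⟩
    · obtain rfl := eq_j h h' hT
      obtain ⟨m, hm, hm'⟩ := Arrow.exists_comp_eq_of_isIso_left
        (subR σ hE a b k (h.trans h') hjk.le (mk _ _)) (iso a (h.trans h'))
        (subL σ hE a c k h (h'.trans hjk.le) (mk _ _) ≫ subR σ hE c b k h' hjk.le (mk _ _))
        _ (map_comp_conj_eqToHom Arrow.rightFunc
          (subR_base σ hE _ hy a b k (h.trans h') hjk.le _)
          (map_comp_natural _ rfl rfl (subL_base σ hE _ hy a c k h (h'.trans hjk.le) _)
            (subR_base σ hE _ hy c b k h' hjk.le _)) (hY.laws a c b k h h' hjk.le).comm)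
      exact ⟨m, fun hT' => absurd hT' hT, fun h₁ => hm'.symm, comp_eqToHom_of_eq_conj hm⟩
  -- the right legs
  have exr : ∀ (a d b : Fin (N + 1)) (h : a ≤ d) (h' : d ≤ b),
      ∃ m : subObj σ hE a b (h.trans h') ⟶ subObj σ hE a d h,
        (∀ hT, m = subR σ hE a d b h h' hT) ∧
        (∀ (h₁ : b ≤ k), subR σ hE a b k (h.trans h') h₁ (mk _ _) ≫ m =
          subR σ hE a d k h (h'.trans h₁) (mk _ _)) ∧
        (Arrow.rightFunc : Arrow C ⥤ C).map m ≫ eqToHom (subObj_base σ hE _ hy a d h) =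
          eqToHom (subObj_base σ hE _ hy a b (h.trans h')) ≫ y.1.map (rightHom a d b h h') := by
    intro a d b h h'
    by_cases hT : MemSub (SSet.horn.{v + 1} N k) (triangleHom a d b h h')
    · exact ⟨subR σ hE a d b h h' hT, fun _ => rfl, fun h₁ =>
        (quadLaws_of_memSub σ hE a d b k h h' h₁ (minsert hT h₁)).rr,
        subR_base σ hE _ hy a d b h h' hT⟩
    · obtain rfl := eq_j h h' hT
      obtain ⟨m, hm, hm'⟩ := Arrow.exists_comp_eq_of_isIso_left
        (subR σ hE a b k (h.trans h') hjk.le (mk _ _)) (iso a (h.trans h'))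
        (subR σ hE a d k h (h'.trans hjk.le) (mk _ _))
        _ (map_comp_conj_eqToHom Arrow.rightFunc
          (subR_base σ hE _ hy a b k (h.trans h') hjk.le _)
          (subR_base σ hE _ hy a d k h (h'.trans hjk.le) _) (hY.laws a d b k h h' hjk.le).rr)
      exact ⟨m, fun hT' => absurd hT' hT, fun h₁ => hm', comp_eqToHom_of_eq_conj hm⟩
  choose l hl hl₁ hlb using exl
  choose r hr hr₁ hrb using exr
  have hlaws : ∀ a c d b h₁ h₂ h₃, MemSub (SSet.horn.{v + 1} N k) (tetraHom a c d b h₁ h₂ h₃) →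
      (SpanPregrid.mk (subObj σ hE) l r).LawsAt a c d b h₁ h₂ h₃ := fun a c d b h₁ h₂ h₃ hT =>
    (quadLaws_of_memSub σ hE a c d b h₁ h₂ h₃ hT).congr (hl ..) (hl ..) (hl ..) (hr ..)
        (hr ..) (hr ..) (hl ..) (hr ..)
  have hΓ : (SpanPregrid.mk (subObj σ hE) l r).IsGrid := by
    refine SpanPregrid.IsGrid.of_right hjk hk (isGrid_map_of_base σ hE _ hy hlb hrb) ?_ ?_ ?_ ?_
      (fun a c d b h₁ h₂ h₃ ha hc hd hb => hlaws a c d b h₁ h₂ h₃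
        (memSub_horn_tetra j hjk.ne ha hc hd hb))
      (fun a h => hlaws _ _ _ _ _ _ _ (mj _ _ _ (.inl rfl) (.inl rfl) (.inr rfl)))
      (fun a h => hlaws _ _ _ _ _ _ _ (mj _ _ _ (.inl rfl) (.inr rfl) (.inr rfl))) ?_ ?_
    · have e := hr j j k le_rfl hjk.le (mk _ _)
      exact (congrArg (fun m => IsIso (Arrow.Hom.left m)) e).mpr hiso
    · have e := hl j k k hjk.le le_rfl (mk _ _)
      exact (congrArg (fun m => IsPullback (Arrow.Hom.left m) (subObj σ hE j k hjk.le).hom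
        (subObj σ hE k k le_rfl).hom (Arrow.Hom.right m)) e).mpr hcart
    · intro a b h
      have hT := MemSub.triangle (hE a b h) 0 0 1 (by decide) (by decide)
      exact (hl _ _ _ _ _ hT).trans (subL_refl σ hE a b h hT)
    · intro a b h
      have hT := MemSub.triangle (hE a b h) 0 1 1 (by decide) (by decide)
      exact (hr _ _ _ _ _ hT).trans (subR_refl σ hE a b h hT)
    · intro a c h₁ h₂
      exact (congrArg₂ _ (hl ..) (hr ..)).trans ((hl₁ a c j h₁ h₂ hjk.le).trans
        (congrArg (· ≫ l a c j h₁ h₂) (hr ..).symm))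
    · intro a d h₁ h₂
      exact (congrArg (· ≫ r a d j h₁ h₂) (hr ..)).trans
        ((hr₁ a d j h₁ h₂ hjk.le).trans (hr ..).symm)
  exact ⟨hΓ.cell, fun m s hs => map_cell_eq_evalAt σ hE hl hr hΓ s hs,
    spanMap_cell_eq σ hE _ hy hlb hrb hΓ⟩

/-! ### Edges and triangles of spans -/

section LowDimension

variable {C : Type u} [Category.{v} C] {D : Type u} [Category.{v} D]

/-- It suffices to compare the nondegenerate legs of functors on `C_m`. -/
lemma subintervalFunctor_ext_of_lt {m : ℕ} {F G : SubintervalPoset ⦋m⦌ ⥤ C}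
    (ho : ∀ i j h, F.obj (subinterval (n := ⦋m⦌) i j h) = G.obj (subinterval (n := ⦋m⦌) i j h))
    (hl : ∀ i c j (h : i < c) (h' : c ≤ j), F.map (leftHom i c j h.le h') ≫ eqToHom (ho c j h') =
      eqToHom (ho i j _) ≫ G.map (leftHom i c j h.le h'))
    (hr : ∀ i d j (h : i ≤ d) (h' : d < j), F.map (rightHom i d j h h'.le) ≫ eqToHom (ho i d h) =
      eqToHom (ho i j _) ≫ G.map (rightHom i d j h h'.le)) : F = G := by
  refine subintervalFunctor_ext ho (fun i c j h h' => ?_) (fun i d j h h' => ?_)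
  · rcases h.eq_or_lt with rfl | h
    · have e₁ : F.map (leftHom i i j h h') = 𝟙 _ := F.map_id _
      have e₂ : G.map (leftHom i i j h h') = 𝟙 _ := G.map_id _
      rw [e₁, e₂, Category.id_comp, Category.comp_id]
    · exact hl i c j h h'
  · rcases h'.eq_or_lt with rfl | h'
    · have e₁ : F.map (rightHom i d d h h') = 𝟙 _ := F.map_id _
      have e₂ : G.map (rightHom i d d h h') = 𝟙 _ := G.map_id _
      rw [e₁, e₂, Category.id_comp, Category.comp_id]
    · exact hr i d j h h'

section Edge

lemma fin_two_eq_of_lt_of_le : ∀ {i c j : Fin 2}, i < c → c ≤ j → i = 0 ∧ c = 1 ∧ j = 1 := by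
  decide

lemma fin_two_eq_of_le_of_lt : ∀ {i d j : Fin 2}, i ≤ d → d < j → i = 0 ∧ d = 0 ∧ j = 1 := by
  decide

lemma fin_three_eq_of_lt_of_le : ∀ {i c j : Fin 3}, i < c → c ≤ j →
    (i = 0 ∧ c = 1 ∧ j = 1) ∨ (i = 0 ∧ c = 1 ∧ j = 2) ∨ (i = 0 ∧ c = 2 ∧ j = 2) ∨
      (i = 1 ∧ c = 2 ∧ j = 2) := by
  decide

lemma fin_three_eq_of_le_of_lt : ∀ {i d j : Fin 3}, i ≤ d → d < j →
    (i = 0 ∧ d = 0 ∧ j = 1) ∨ (i = 0 ∧ d = 1 ∧ j = 2) ∨ (i = 0 ∧ d = 0 ∧ j = 2) ∨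
      (i = 1 ∧ d = 1 ∧ j = 2) := by
  decide

lemma fin_three_eq_of_lt_of_lt_of_le : ∀ {a c d b : Fin 3}, a < c → c < d → d ≤ b →
    a = 0 ∧ c = 1 ∧ d = 2 ∧ b = 2 := by
  decide

lemma fin_three_eq_of_le_of_lt_of_lt : ∀ {a c d b : Fin 3}, a ≤ c → c < d → d < b →
    a = 0 ∧ c = 0 ∧ d = 1 ∧ b = 2 := by
  decide

lemma fin_three_eq_of_lt_of_le_of_lt : ∀ {a c d b : Fin 3}, a < c → c ≤ d → d < b →
    a = 0 ∧ c = 1 ∧ d = 1 ∧ b = 2 := by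
  decide

variable {P A B : C} (f : P ⟶ A) (g : P ⟶ B)

/-- The pregrid of a span. -/
def edgePregrid : SpanPregrid C 1 where
  obj
    | 0, 0, _ => A
    | 0, 1, _ => P
    | 1, 1, _ => B
    | 1, 0, h => absurd h (by decide)
  l
    | 0, 0, 0, _, _ => 𝟙 _
    | 0, 0, 1, _, _ => 𝟙 _
    | 1, 1, 1, _, _ => 𝟙 _
    | 0, 1, 1, _, _ => g
    | 1, 0, _, h, _ => absurd h (by decide)
    | 0, 1, 0, _, h => absurd h (by decide)
    | 1, 1, 0, _, h => absurd h (by decide)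
  r
    | 0, 0, 0, _, _ => 𝟙 _
    | 0, 0, 1, _, _ => f
    | 1, 1, 1, _, _ => 𝟙 _
    | 0, 1, 1, _, _ => 𝟙 _
    | 1, 0, _, h, _ => absurd h (by decide)
    | 0, 1, 0, _, h => absurd h (by decide)
    | 1, 1, 0, _, h => absurd h (by decide)

lemma edgePregrid_isGrid : (edgePregrid f g).IsGrid := by
  refine SpanPregrid.IsGrid.of_nondegenerate ?_ ?_ ?_ ?_ ?_
  · intro a b h
    fin_cases a <;> fin_cases b
    exacts [rfl, rfl, absurd h (by decide), rfl]
  · intro a b h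
    fin_cases a <;> fin_cases b
    exacts [rfl, rfl, absurd h (by decide), rfl]
  all_goals
    intro a c d b h₁ h₂ h₃
    exfalso
    revert a c d b
    decide

/-- The 1-cell of `Span(C)` of a span `A ← P → B`. -/
def spanEdge : (spanSSet C) _⦋1⦌ := (edgePregrid_isGrid f g).cell

lemma spanLeftLeg_spanEdge : spanLeftLeg (spanEdge f g) = f :=
  (edgePregrid_isGrid f g).functor_map_rightHom 0 0 1 le_rfl (Fin.zero_le 1)

lemma spanRightLeg_spanEdge : spanRightLeg (spanEdge f g) = g :=
  (edgePregrid_isGrid f g).functor_map_leftHom 0 1 1 (Fin.zero_le 1) le_rfl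

lemma spanEdge_eta (x : (spanSSet C) _⦋1⦌) : spanEdge (spanLeftLeg x) (spanRightLeg x) = x := by
  apply Subtype.ext
  refine subintervalFunctor_ext_of_lt ?_ ?_ ?_
  · intro i j h
    fin_cases i <;> fin_cases j
    exacts [rfl, rfl, absurd h (by decide), rfl]
  · intro i c j h h'
    obtain ⟨rfl, rfl, rfl⟩ : i = 0 ∧ c = 1 ∧ j = 1 := fin_two_eq_of_lt_of_le h h'
    exact (Category.comp_id _).trans ((spanRightLeg_spanEdge (spanLeftLeg x) _).trans
      (Category.id_comp _).symm)
  · intro i d j h h'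
    obtain ⟨rfl, rfl, rfl⟩ : i = 0 ∧ d = 0 ∧ j = 1 := fin_two_eq_of_le_of_lt h h'
    exact (Category.comp_id _).trans ((spanLeftLeg_spanEdge (spanLeftLeg x) _).trans
      (Category.id_comp _).symm)

lemma exists_eq_spanEdge (x : (spanSSet C) _⦋1⦌) :
    ∃ (P A B : C) (f : P ⟶ A) (g : P ⟶ B), x = spanEdge f g :=
  ⟨_, _, _, _, _, (spanEdge_eta x).symm⟩

variable {f g}

lemma spanEdge_inj {P' A' B' : C} {f' : P' ⟶ A'} {g' : P' ⟶ B'}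
    (h : spanEdge f g = spanEdge f' g') : P = P' ∧ A = A' ∧ B = B' ∧ f ≍ f' ∧ g ≍ g' := by
  have h₁ : spanLeftLeg (spanEdge f g) ≍ spanLeftLeg (spanEdge f' g') := by rw [h]
  have h₂ : spanRightLeg (spanEdge f g) ≍ spanRightLeg (spanEdge f' g') := by rw [h]
  refine ⟨congrArg spanApex h, congrArg spanSource h, congrArg spanTarget h, ?_, ?_⟩
  · exact (heq_of_eq (spanLeftLeg_spanEdge f g)).symm.trans
      (h₁.trans (heq_of_eq (spanLeftLeg_spanEdge f' g')))
  · exact (heq_of_eq (spanRightLeg_spanEdge f g)).symm.trans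
      (h₂.trans (heq_of_eq (spanRightLeg_spanEdge f' g')))

variable (f g)

lemma spanMap_spanEdge (G : C ⥤ D) [PreservesLimitsOfShape WalkingCospan G] :
    (spanMap G).app _ (spanEdge f g) = spanEdge (G.map f) (G.map g) := by
  have h := (spanEdge_eta ((spanMap G).app _ (spanEdge f g))).symm
  exact h.trans (congrArg₂ (fun (s : G.obj P ⟶ G.obj A) (t : G.obj P ⟶ G.obj B) => spanEdge s t)
    (congrArg G.map (spanLeftLeg_spanEdge f g)) (congrArg G.map (spanRightLeg_spanEdge f g)))

end Edge

section Triangle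

variable {O₀ O₁ O₂ O₀₁ O₁₂ O₀₂ : C} (f₀₁ : O₀₁ ⟶ O₀) (g₀₁ : O₀₁ ⟶ O₁) (f₁₂ : O₁₂ ⟶ O₁)
  (g₁₂ : O₁₂ ⟶ O₂) (f : O₀₂ ⟶ O₀₁) (g : O₀₂ ⟶ O₁₂)

/-- The pregrid of a composite of spans. -/
def trianglePregrid : SpanPregrid C 2 where
  obj
    | 0, 0, _ => O₀
    | 0, 1, _ => O₀₁
    | 0, 2, _ => O₀₂
    | 1, 1, _ => O₁
    | 1, 2, _ => O₁₂
    | 2, 2, _ => O₂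
    | 1, 0, h => absurd h (by decide)
    | 2, 0, h => absurd h (by decide)
    | 2, 1, h => absurd h (by decide)
  l
    | 0, 0, 0, _, _ => 𝟙 _
    | 0, 0, 1, _, _ => 𝟙 _
    | 0, 0, 2, _, _ => 𝟙 _
    | 1, 1, 1, _, _ => 𝟙 _
    | 1, 1, 2, _, _ => 𝟙 _
    | 2, 2, 2, _, _ => 𝟙 _
    | 0, 1, 1, _, _ => g₀₁
    | 0, 1, 2, _, _ => g
    | 0, 2, 2, _, _ => g ≫ g₁₂
    | 1, 2, 2, _, _ => g₁₂
    | 1, 0, _, h, _ => absurd h (by decide)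
    | 2, 0, _, h, _ => absurd h (by decide)
    | 2, 1, _, h, _ => absurd h (by decide)
    | 0, 1, 0, _, h => absurd h (by decide)
    | 1, 1, 0, _, h => absurd h (by decide)
    | 0, 2, 0, _, h => absurd h (by decide)
    | 1, 2, 0, _, h => absurd h (by decide)
    | 2, 2, 0, _, h => absurd h (by decide)
    | 0, 2, 1, _, h => absurd h (by decide)
    | 1, 2, 1, _, h => absurd h (by decide)
    | 2, 2, 1, _, h => absurd h (by decide)
  r
    | 0, 0, 0, _, _ => 𝟙 _
    | 0, 1, 1, _, _ => 𝟙 _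
    | 0, 2, 2, _, _ => 𝟙 _
    | 1, 1, 1, _, _ => 𝟙 _
    | 1, 2, 2, _, _ => 𝟙 _
    | 2, 2, 2, _, _ => 𝟙 _
    | 0, 0, 1, _, _ => f₀₁
    | 0, 1, 2, _, _ => f
    | 0, 0, 2, _, _ => f ≫ f₀₁
    | 1, 1, 2, _, _ => f₁₂
    | 1, 0, _, h, _ => absurd h (by decide)
    | 2, 0, _, h, _ => absurd h (by decide)
    | 2, 1, _, h, _ => absurd h (by decide)
    | 0, 1, 0, _, h => absurd h (by decide)
    | 1, 1, 0, _, h => absurd h (by decide)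
    | 0, 2, 0, _, h => absurd h (by decide)
    | 1, 2, 0, _, h => absurd h (by decide)
    | 2, 2, 0, _, h => absurd h (by decide)
    | 0, 2, 1, _, h => absurd h (by decide)
    | 1, 2, 1, _, h => absurd h (by decide)
    | 2, 2, 1, _, h => absurd h (by decide)

variable (pb : IsPullback f g g₀₁ f₁₂)

include pb in
lemma trianglePregrid_isGrid : (trianglePregrid f₀₁ g₀₁ f₁₂ g₁₂ f g).IsGrid := by
  refine SpanPregrid.IsGrid.of_nondegenerate ?_ ?_ ?_ ?_ ?_
  · intro a b h
    fin_cases a <;> fin_cases b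
    exacts [rfl, rfl, rfl, absurd h (by decide), rfl, rfl, absurd h (by decide),
      absurd h (by decide), rfl]
  · intro a b h
    fin_cases a <;> fin_cases b
    exacts [rfl, rfl, rfl, absurd h (by decide), rfl, rfl, absurd h (by decide),
      absurd h (by decide), rfl]
  · intro a c d b h₁ h₂ h₃
    obtain ⟨rfl, rfl, rfl, rfl⟩ : a = 0 ∧ c = 1 ∧ d = 2 ∧ b = 2 :=
      fin_three_eq_of_lt_of_lt_of_le h₁ h₂ h₃
    rfl
  · intro a c d b h₁ h₂ h₃
    obtain ⟨rfl, rfl, rfl, rfl⟩ : a = 0 ∧ c = 0 ∧ d = 1 ∧ b = 2 :=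
      fin_three_eq_of_le_of_lt_of_lt h₁ h₂ h₃
    rfl
  · intro a c d b h₁ h₂ h₃
    obtain ⟨rfl, rfl, rfl, rfl⟩ : a = 0 ∧ c = 1 ∧ d = 1 ∧ b = 2 :=
      fin_three_eq_of_lt_of_le_of_lt h₁ h₂ h₃
    exact pb

/-- The 2-cell of `Span(C)` of a composite of the spans `O₀ ← O₀₁ → O₁` and
`O₁ ← O₁₂ → O₂`. -/
def spanTriangle : (spanSSet C) _⦋2⦌ :=
  (trianglePregrid_isGrid f₀₁ g₀₁ f₁₂ g₁₂ f g pb).cell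

lemma spanTriangle_map_leftHom (i c j : Fin 3) (h : i ≤ c) (h' : c ≤ j) :
    (spanTriangle f₀₁ g₀₁ f₁₂ g₁₂ f g pb).1.map (leftHom i c j h h') =
      (trianglePregrid f₀₁ g₀₁ f₁₂ g₁₂ f g).l i c j h h' :=
  (trianglePregrid_isGrid f₀₁ g₀₁ f₁₂ g₁₂ f g pb).functor_map_leftHom i c j h h'

lemma spanTriangle_map_rightHom (i d j : Fin 3) (h : i ≤ d) (h' : d ≤ j) :
    (spanTriangle f₀₁ g₀₁ f₁₂ g₁₂ f g pb).1.map (rightHom i d j h h') =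
      (trianglePregrid f₀₁ g₀₁ f₁₂ g₁₂ f g).r i d j h h' :=
  (trianglePregrid_isGrid f₀₁ g₀₁ f₁₂ g₁₂ f g pb).functor_map_rightHom i d j h h'

lemma exists_eq_spanTriangle (x : (spanSSet C) _⦋2⦌) :
    ∃ (O₀ O₁ O₂ O₀₁ O₁₂ O₀₂ : C) (f₀₁ : O₀₁ ⟶ O₀) (g₀₁ : O₀₁ ⟶ O₁) (f₁₂ : O₁₂ ⟶ O₁)
      (g₁₂ : O₁₂ ⟶ O₂) (f : O₀₂ ⟶ O₀₁) (g : O₀₂ ⟶ O₁₂) (pb : IsPullback f g g₀₁ f₁₂),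
      x = spanTriangle f₀₁ g₀₁ f₁₂ g₁₂ f g pb := by
  have hx := SpanPregrid.isGrid_ofFunctor x.2
  have pb := (hx.laws 0 1 1 2 (by decide) le_rfl (by decide)).pb
  refine ⟨_, _, _, _, _, _, x.1.map (rightHom 0 0 1 le_rfl (by decide)), _, _,
    x.1.map (leftHom 1 2 2 (by decide) le_rfl), _, _, pb, Subtype.ext ?_⟩
  refine subintervalFunctor_ext_of_lt ?_ ?_ ?_
  · intro i j h
    fin_cases i <;> fin_cases j
    exacts [rfl, rfl, rfl, absurd h (by decide), rfl, rfl, absurd h (by decide),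
      absurd h (by decide), rfl]
  · intro i c j h h'
    obtain ⟨rfl, rfl, rfl⟩ | ⟨rfl, rfl, rfl⟩ | ⟨rfl, rfl, rfl⟩ | ⟨rfl, rfl, rfl⟩ :
      (i = 0 ∧ c = 1 ∧ j = 1) ∨ (i = 0 ∧ c = 1 ∧ j = 2) ∨ (i = 0 ∧ c = 2 ∧ j = 2) ∨
        (i = 1 ∧ c = 2 ∧ j = 2) := fin_three_eq_of_lt_of_le h h'
    · exact (Category.comp_id _).trans ((congrArg (𝟙 _ ≫ ·)
        (spanTriangle_map_leftHom _ _ _ _ _ _ pb 0 1 1 _ _)).trans (Category.id_comp _)).symm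
    · exact (Category.comp_id _).trans ((congrArg (𝟙 _ ≫ ·)
        (spanTriangle_map_leftHom _ _ _ _ _ _ pb 0 1 2 _ _)).trans (Category.id_comp _)).symm
    · have e := (hx.laws 0 1 2 2 (by decide) (by decide) le_rfl).ll
      exact (Category.comp_id _).trans (e.symm.trans
        ((congrArg (𝟙 _ ≫ ·) (spanTriangle_map_leftHom _ _ _ _ _ _ pb 0 2 2 _ _)).trans
          (Category.id_comp _)).symm)
    · exact (Category.comp_id _).trans ((congrArg (𝟙 _ ≫ ·)
        (spanTriangle_map_leftHom _ _ _ _ _ _ pb 1 2 2 _ _)).trans (Category.id_comp _)).symm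
  · intro i d j h h'
    obtain ⟨rfl, rfl, rfl⟩ | ⟨rfl, rfl, rfl⟩ | ⟨rfl, rfl, rfl⟩ | ⟨rfl, rfl, rfl⟩ :
      (i = 0 ∧ d = 0 ∧ j = 1) ∨ (i = 0 ∧ d = 1 ∧ j = 2) ∨ (i = 0 ∧ d = 0 ∧ j = 2) ∨
        (i = 1 ∧ d = 1 ∧ j = 2) := fin_three_eq_of_le_of_lt h h'
    · exact (Category.comp_id _).trans ((congrArg (𝟙 _ ≫ ·)
        (spanTriangle_map_rightHom _ _ _ _ _ _ pb 0 0 1 _ _)).trans (Category.id_comp _)).symm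
    · exact (Category.comp_id _).trans ((congrArg (𝟙 _ ≫ ·)
        (spanTriangle_map_rightHom _ _ _ _ _ _ pb 0 1 2 _ _)).trans (Category.id_comp _)).symm
    · have e := (hx.laws 0 0 1 2 le_rfl (by decide) (by decide)).rr
      exact (Category.comp_id _).trans (e.symm.trans
        ((congrArg (𝟙 _ ≫ ·) (spanTriangle_map_rightHom _ _ _ _ _ _ pb 0 0 2 _ _)).trans
          (Category.id_comp _)).symm)
    · exact (Category.comp_id _).trans ((congrArg (𝟙 _ ≫ ·)
        (spanTriangle_map_rightHom _ _ _ _ _ _ pb 1 1 2 _ _)).trans (Category.id_comp _)).symm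

end Triangle

end LowDimension

/-! ### Faces and fillers of triangles -/

section TriangleFaces

variable {C : Type u} [Category.{v} C] {D : Type u} [Category.{v} D]
  {O₀ O₁ O₂ O₀₁ O₁₂ O₀₂ : C} (f₀₁ : O₀₁ ⟶ O₀) (g₀₁ : O₀₁ ⟶ O₁) (f₁₂ : O₁₂ ⟶ O₁)
  (g₁₂ : O₁₂ ⟶ O₂) (f : O₀₂ ⟶ O₀₁) (g : O₀₂ ⟶ O₁₂) (pb : IsPullback f g g₀₁ f₁₂)

lemma spanTriangle_edge₀₁ :
    (spanSSet C).map (edgeHom 0 1 (by decide)).op (spanTriangle f₀₁ g₀₁ f₁₂ g₁₂ f g pb) =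
      spanEdge f₀₁ g₀₁ :=
  (spanEdge_eta _).symm.trans (congrArg₂ (fun (s : O₀₁ ⟶ O₀) (t : O₀₁ ⟶ O₁) => spanEdge s t)
    (spanTriangle_map_rightHom _ _ _ _ _ _ pb 0 0 1 (by decide) (by decide))
    (spanTriangle_map_leftHom _ _ _ _ _ _ pb 0 1 1 (by decide) (by decide)))

lemma spanTriangle_edge₁₂ :
    (spanSSet C).map (edgeHom 1 2 (by decide)).op (spanTriangle f₀₁ g₀₁ f₁₂ g₁₂ f g pb) =
      spanEdge f₁₂ g₁₂ :=
  (spanEdge_eta _).symm.trans (congrArg₂ (fun (s : O₁₂ ⟶ O₁) (t : O₁₂ ⟶ O₂) => spanEdge s t)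
    (spanTriangle_map_rightHom _ _ _ _ _ _ pb 1 1 2 (by decide) (by decide))
    (spanTriangle_map_leftHom _ _ _ _ _ _ pb 1 2 2 (by decide) (by decide)))

lemma spanTriangle_edge₀₂ :
    (spanSSet C).map (edgeHom 0 2 (by decide)).op (spanTriangle f₀₁ g₀₁ f₁₂ g₁₂ f g pb) =
      spanEdge (f ≫ f₀₁) (g ≫ g₁₂) :=
  (spanEdge_eta _).symm.trans (congrArg₂ (fun (s : O₀₂ ⟶ O₀) (t : O₀₂ ⟶ O₂) => spanEdge s t)
    (spanTriangle_map_rightHom _ _ _ _ _ _ pb 0 0 2 (by decide) (by decide))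
    (spanTriangle_map_leftHom _ _ _ _ _ _ pb 0 2 2 (by decide) (by decide)))

lemma spanMap_spanTriangle (G : C ⥤ D) [PreservesLimitsOfShape WalkingCospan G] :
    (spanMap G).app _ (spanTriangle f₀₁ g₀₁ f₁₂ g₁₂ f g pb) =
      spanTriangle (G.map f₀₁) (G.map g₀₁) (G.map f₁₂) (G.map g₁₂) (G.map f) (G.map g)
        (pb.map G) := by
  apply Subtype.ext
  have pb' := pb.map G
  have el : ∀ i c j h h', ((spanMap G).app _ (spanTriangle f₀₁ g₀₁ f₁₂ g₁₂ f g pb)).1.map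
      (leftHom i c j h h') = G.map ((trianglePregrid f₀₁ g₀₁ f₁₂ g₁₂ f g).l i c j h h') :=
    fun i c j h h' => congrArg G.map (spanTriangle_map_leftHom _ _ _ _ _ _ pb i c j h h')
  have er : ∀ i d j h h', ((spanMap G).app _ (spanTriangle f₀₁ g₀₁ f₁₂ g₁₂ f g pb)).1.map
      (rightHom i d j h h') = G.map ((trianglePregrid f₀₁ g₀₁ f₁₂ g₁₂ f g).r i d j h h') :=
    fun i c j h h' => congrArg G.map (spanTriangle_map_rightHom _ _ _ _ _ _ pb i c j h h')
  refine subintervalFunctor_ext_of_lt ?_ ?_ ?_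
  · intro i j h
    fin_cases i <;> fin_cases j
    exacts [rfl, rfl, rfl, absurd h (by decide), rfl, rfl, absurd h (by decide),
      absurd h (by decide), rfl]
  · intro i c j h h'
    obtain ⟨rfl, rfl, rfl⟩ | ⟨rfl, rfl, rfl⟩ | ⟨rfl, rfl, rfl⟩ | ⟨rfl, rfl, rfl⟩ :
      (i = 0 ∧ c = 1 ∧ j = 1) ∨ (i = 0 ∧ c = 1 ∧ j = 2) ∨ (i = 0 ∧ c = 2 ∧ j = 2) ∨
        (i = 1 ∧ c = 2 ∧ j = 2) := fin_three_eq_of_lt_of_le h h'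
    · exact (Category.comp_id _).trans ((el 0 1 1 _ _).trans ((congrArg (𝟙 _ ≫ ·)
        (spanTriangle_map_leftHom _ _ _ _ _ _ pb' 0 1 1 _ _)).trans (Category.id_comp _)).symm)
    · exact (Category.comp_id _).trans ((el 0 1 2 _ _).trans ((congrArg (𝟙 _ ≫ ·)
        (spanTriangle_map_leftHom _ _ _ _ _ _ pb' 0 1 2 _ _)).trans (Category.id_comp _)).symm)
    · exact (Category.comp_id _).trans ((el 0 2 2 _ _).trans ((G.map_comp g g₁₂).trans
        ((congrArg (𝟙 _ ≫ ·) (spanTriangle_map_leftHom _ _ _ _ _ _ pb' 0 2 2 _ _)).trans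
          (Category.id_comp _)).symm))
    · exact (Category.comp_id _).trans ((el 1 2 2 _ _).trans ((congrArg (𝟙 _ ≫ ·)
        (spanTriangle_map_leftHom _ _ _ _ _ _ pb' 1 2 2 _ _)).trans (Category.id_comp _)).symm)
  · intro i d j h h'
    obtain ⟨rfl, rfl, rfl⟩ | ⟨rfl, rfl, rfl⟩ | ⟨rfl, rfl, rfl⟩ | ⟨rfl, rfl, rfl⟩ :
      (i = 0 ∧ d = 0 ∧ j = 1) ∨ (i = 0 ∧ d = 1 ∧ j = 2) ∨ (i = 0 ∧ d = 0 ∧ j = 2) ∨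
        (i = 1 ∧ d = 1 ∧ j = 2) := fin_three_eq_of_le_of_lt h h'
    · exact (Category.comp_id _).trans ((er 0 0 1 _ _).trans ((congrArg (𝟙 _ ≫ ·)
        (spanTriangle_map_rightHom _ _ _ _ _ _ pb' 0 0 1 _ _)).trans (Category.id_comp _)).symm)
    · exact (Category.comp_id _).trans ((er 0 1 2 _ _).trans ((congrArg (𝟙 _ ≫ ·)
        (spanTriangle_map_rightHom _ _ _ _ _ _ pb' 0 1 2 _ _)).trans (Category.id_comp _)).symm)
    · exact (Category.comp_id _).trans ((er 0 0 2 _ _).trans ((G.map_comp f f₀₁).trans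
        ((congrArg (𝟙 _ ≫ ·) (spanTriangle_map_rightHom _ _ _ _ _ _ pb' 0 0 2 _ _)).trans
          (Category.id_comp _)).symm))
    · exact (Category.comp_id _).trans ((er 1 1 2 _ _).trans ((congrArg (𝟙 _ ≫ ·)
        (spanTriangle_map_rightHom _ _ _ _ _ _ pb' 1 1 2 _ _)).trans (Category.id_comp _)).symm)

end TriangleFaces

section TriangleFillers

variable {C : Type u} [Category.{v} C] {D : Type u} [Category.{v} D]

/-- Every pullback of a diagram `G A → G E ← G B` is, on the nose, the image of a pullback of
`A → E ← B`. -/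
def LiftsPullbacks (G : C ⥤ D) : Prop :=
  ∀ {A B E : C} (f : A ⟶ E) (g : B ⟶ E) {W : D} (p : W ⟶ G.obj A) (q : W ⟶ G.obj B),
    IsPullback p q (G.map f) (G.map g) →
    ∃ (P : C) (e : G.obj P = W) (p' : P ⟶ A) (q' : P ⟶ B), IsPullback p' q' f g ∧
      G.map p' = eqToHom e ≫ p ∧ G.map q' = eqToHom e ≫ q

lemma liftsPullbacks_rightFunc {C : Type (v + 1)} [LargeCategory.{v} C] [HasPullbacks C] :
    LiftsPullbacks (Arrow.rightFunc : Arrow C ⥤ C) := by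
  intro A B E f g W p q h
  have w : (pullback.fst f.left g.left ≫ A.hom) ≫ f.right =
      (pullback.snd f.left g.left ≫ B.hom) ≫ g.right := by
    rw [Category.assoc, Category.assoc, ← Arrow.w f, ← Arrow.w g, pullback.condition_assoc]
  exact ⟨Arrow.mk (h.lift _ _ w), rfl, Arrow.homMk (pullback.fst _ _) p (h.lift_fst _ _ w).symm,
    Arrow.homMk (pullback.snd _ _) q (h.lift_snd _ _ w).symm,
    isPullback_of_left_right (IsPullback.of_hasPullback _ _) h, (Category.id_comp _).symm,
    (Category.id_comp _).symm⟩

/-- Composites of spans exist over any composite in the base. -/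
lemma exists_triangle_inner (G : C ⥤ D) [PreservesLimitsOfShape WalkingCospan G]
    (hG : LiftsPullbacks G) (e₀₁ e₁₂ : (spanSSet C) _⦋1⦌) (he : spanTarget e₀₁ = spanSource e₁₂)
    (y : (spanSSet D) _⦋2⦌)
    (h₀₁ : (spanMap G).app _ e₀₁ = (spanSSet D).map (edgeHom 0 1 (by decide)).op y)
    (h₁₂ : (spanMap G).app _ e₁₂ = (spanSSet D).map (edgeHom 1 2 (by decide)).op y) :
    ∃ z : (spanSSet C) _⦋2⦌, (spanSSet C).map (edgeHom 0 1 (by decide)).op z = e₀₁ ∧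
      (spanSSet C).map (edgeHom 1 2 (by decide)).op z = e₁₂ ∧ (spanMap G).app _ z = y := by
  obtain ⟨P, A, B, f, g, rfl⟩ := exists_eq_spanEdge e₀₁
  obtain ⟨P', A', B', f', g', rfl⟩ := exists_eq_spanEdge e₁₂
  obtain rfl : B = A' := he
  obtain ⟨O₀, O₁, O₂, O₀₁, O₁₂, O₀₂, f₀₁, g₀₁, f₁₂, g₁₂, p, q, pb, rfl⟩ :=
    exists_eq_spanTriangle y
  rw [spanMap_spanEdge, spanTriangle_edge₀₁] at h₀₁
  rw [spanMap_spanEdge, spanTriangle_edge₁₂] at h₁₂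
  obtain ⟨rfl, rfl, rfl, h₁, h₂⟩ := spanEdge_inj h₀₁
  obtain ⟨rfl, -, rfl, h₃, h₄⟩ := spanEdge_inj h₁₂
  obtain rfl := eq_of_heq h₁
  obtain rfl := eq_of_heq h₂
  obtain rfl := eq_of_heq h₃
  obtain rfl := eq_of_heq h₄
  obtain ⟨W, rfl, p', q', pb', hp, hq⟩ := hG _ _ _ _ pb
  obtain rfl : G.map p' = p := hp.trans (Category.id_comp _)
  obtain rfl : G.map q' = q := hq.trans (Category.id_comp _)
  exact ⟨spanTriangle f g f' g' p' q' pb', spanTriangle_edge₀₁ .., spanTriangle_edge₁₂ ..,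
    spanMap_spanTriangle ..⟩

lemma isSpecialEdge_spanEdge_iff {P A B : Arrow C} (f : P ⟶ A) (g : P ⟶ B) :
    IsSpecialEdge (spanEdge f g) ↔ IsPullback g.left P.hom B.hom g.right ∧ IsIso f.left := by
  have h₁ : IsSpecialEdge (spanEdge f g) ↔ IsPullback (spanRightLeg (spanEdge f g)).left P.hom B.hom
    (spanRightLeg (spanEdge f g)).right ∧ IsIso (spanLeftLeg (spanEdge f g)).left := Iff.rfl
  rw [h₁]
  exact Iff.of_eq (congrArg₂ And
    (congrArg (fun (t : P ⟶ B) => IsPullback t.left P.hom B.hom t.right)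
      (spanRightLeg_spanEdge f g)) (congrArg (fun (t : P ⟶ A) => IsIso t.left)
      (spanLeftLeg_spanEdge f g)))

/-- A span of arrows factors through a special one with the same target over any such factorization
of its base. -/
lemma exists_triangle_right {C : Type (v + 1)} [LargeCategory.{v} C]
    [PreservesLimitsOfShape WalkingCospan (Arrow.rightFunc : Arrow C ⥤ C)]
    (e₀₂ e₁₂ : (spanSSet (Arrow C)) _⦋1⦌) (he : spanTarget e₀₂ = spanTarget e₁₂)
    (h : IsSpecialEdge e₁₂) (y : (spanSSet C) _⦋2⦌)
    (h₀₂ : (spanMap (Arrow.rightFunc : Arrow C ⥤ C)).app _ e₀₂ =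
      (spanSSet C).map (edgeHom 0 2 (by decide)).op y)
    (h₁₂ : (spanMap (Arrow.rightFunc : Arrow C ⥤ C)).app _ e₁₂ =
      (spanSSet C).map (edgeHom 1 2 (by decide)).op y) :
    ∃ z : (spanSSet (Arrow C)) _⦋2⦌,
      (spanSSet (Arrow C)).map (edgeHom 0 2 (by decide)).op z = e₀₂ ∧
      (spanSSet (Arrow C)).map (edgeHom 1 2 (by decide)).op z = e₁₂ ∧
      (spanMap (Arrow.rightFunc : Arrow C ⥤ C)).app _ z = y := by
  obtain ⟨P, A₀, A₂, f, g, rfl⟩ := exists_eq_spanEdge e₀₂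
  obtain ⟨Q, A₁, A₂', f', g', rfl⟩ := exists_eq_spanEdge e₁₂
  obtain rfl : A₂ = A₂' := he
  obtain ⟨hg', hf'⟩ := (isSpecialEdge_spanEdge_iff f' g').1 h
  obtain ⟨O₀, O₁, O₂, O₀₁, O₁₂, O₀₂, f₀₁, g₀₁, f₁₂, g₁₂, p, q, pb, rfl⟩ :=
    exists_eq_spanTriangle y
  rw [spanMap_spanEdge, spanTriangle_edge₀₂] at h₀₂
  rw [spanMap_spanEdge, spanTriangle_edge₁₂] at h₁₂
  obtain ⟨rfl, rfl, rfl, h₁, h₂⟩ := spanEdge_inj h₀₂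
  obtain ⟨rfl, rfl, -, h₃, h₄⟩ := spanEdge_inj h₁₂
  obtain rfl := eq_of_heq h₃
  obtain rfl := eq_of_heq h₄
  have hf : f.right = p ≫ f₀₁ := eq_of_heq h₁
  have hg : g.right = q ≫ g'.right := eq_of_heq h₂
  -- the left square of the composite is determined by the cartesian square of the special edge
  have w : g.left ≫ A₂.hom = (P.hom ≫ q) ≫ g'.right :=
    (Arrow.w g).trans ((congrArg (P.hom ≫ ·) hg).trans (Category.assoc _ _ _).symm)
  let O : Arrow C := Arrow.mk (P.hom ≫ p)
  let t : P ⟶ Q := Arrow.homMk (hg'.lift _ _ w) q (hg'.lift_snd _ _ w)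
  let s : P ⟶ O := Arrow.homMk (𝟙 _) p (Category.id_comp _)
  let a : O ⟶ A₀ := Arrow.homMk f.left f₀₁ ((Arrow.w f).trans
    ((congrArg (P.hom ≫ ·) hf).trans (Category.assoc _ _ _).symm))
  let b : O ⟶ A₁ := Arrow.homMk (t.left ≫ f'.left) g₀₁ (by
    have e : p ≫ g₀₁ = q ≫ f'.right := pb.w
    rw [Category.assoc, Arrow.w f', Arrow.w_assoc t]
    exact (congrArg (P.hom ≫ ·) e.symm).trans (Category.assoc _ _ _).symm)
  have sa : s ≫ a = f := by
    ext
    · exact Category.id_comp _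
    · exact hf.symm
  have tg : t ≫ g' = g := by
    ext
    · exact hg'.lift_fst _ _ w
    · exact hg.symm
  have pb' : IsPullback s t b f' := by
    refine isPullback_of_left_right ?_ pb
    have : IsIso s.left := inferInstanceAs (IsIso (𝟙 P.left))
    exact IsPullback.of_horiz_isIso ⟨Category.id_comp _⟩
  refine ⟨spanTriangle a b f' g' s t pb', ?_, spanTriangle_edge₁₂ .., spanMap_spanTriangle ..⟩
  rw [spanTriangle_edge₀₂, sa, tg]

end TriangleFillers

/-! ### Inner fibrations of spans -/

section HornLifting

variable {X Y : SSet.{w}}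

lemma memSub_horn_δ {N : ℕ} {k : Fin (N + 2)} (j : Fin (N + 2)) (hj : j ≠ k) :
    MemSub (SSet.horn.{w} (N + 1) k) (SimplexCategory.δ j) :=
  (memSub_horn_iff _).2 ⟨j, hj, fun i => Fin.succAbove_ne j i⟩

/-- Simplices that extend a map on a horn are recognized on the faces. -/
lemma map_eq_evalAt_of_faces {N : ℕ} {k : Fin (N + 2)}
    (σ : (SSet.horn.{w} (N + 1) k : SSet.{w}) ⟶ X) (z : X _⦋N + 1⦌)
    (h : ∀ (j : Fin (N + 2)) (hj : j ≠ k), X.map (SimplexCategory.δ j).op z =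
      evalAt σ (SimplexCategory.δ j) (memSub_horn_δ j hj))
    (m : ℕ) (s : ⦋m⦌ ⟶ ⦋N + 1⦌) (hs : MemSub (SSet.horn.{w} (N + 1) k) s) :
    X.map s.op z = evalAt σ s hs := by
  obtain ⟨j, hj, hs'⟩ := (memSub_horn_iff s).1 hs
  obtain ⟨θ, rfl⟩ := SimplexCategory.eq_comp_δ_of_not_surjective' s j hs'
  rw [op_comp, Functor.map_comp_apply, h j hj]
  exact map_evalAt σ _ _ θ

/-- Fillers of a horn are solutions of the lifting problem. -/
lemma hasLift_of_exists_filler {N : ℕ} {k : Fin (N + 1)} {p : X ⟶ Y}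
    {σ : (SSet.horn.{w} N k : SSet.{w}) ⟶ X} {τ : Δ[N] ⟶ Y}
    (sq : CommSq σ (SSet.horn N k).ι p τ)
    (h : ∃ z : X _⦋N⦌, (∀ (m : ℕ) (s : ⦋m⦌ ⟶ ⦋N⦌) (hs : MemSub (SSet.horn N k) s),
      X.map s.op z = evalAt σ s hs) ∧ p.app _ z = SSet.yonedaEquiv τ) : sq.HasLift := by
  obtain ⟨z, h, h'⟩ := h
  refine ⟨⟨⟨SSet.yonedaEquiv.symm z, ?_, ?_⟩⟩⟩
  · ext ⟨m⟩ ⟨s, hs⟩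
    obtain ⟨s, rfl⟩ := SSet.stdSimplex.objEquiv.symm.surjective s
    exact h m.len s hs
  · apply SSet.yonedaEquiv.injective
    rw [SSet.yonedaEquiv_comp, Equiv.apply_symm_apply, h']

lemma app_evalAt {N : ℕ} {k : Fin (N + 1)} {p : X ⟶ Y}
    {σ : (SSet.horn.{w} N k : SSet.{w}) ⟶ X} {τ : Δ[N] ⟶ Y}
    (sq : CommSq σ (SSet.horn N k).ι p τ) (m : ℕ) (s : ⦋m⦌ ⟶ ⦋N⦌)
    (hs : MemSub (SSet.horn N k) s) :
    p.app _ (evalAt σ s hs) = Y.map s.op (SSet.yonedaEquiv τ) := by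
  obtain ⟨y, rfl⟩ := SSet.yonedaEquiv.symm.surjective τ
  refine (ConcreteCategory.congr_hom (NatTrans.congr_app sq.w (op ⦋m⦌)) ⟨_, hs⟩).trans ?_
  rw [Equiv.apply_symm_apply]
  exact SSet.yonedaEquiv_symm_app_objEquiv_symm ..

end HornLifting

lemma δ_zero_eq_edgeHom : (SimplexCategory.δ 0 : ⦋1⦌ ⟶ ⦋2⦌) = edgeHom 1 2 (by decide) := by
  ext i
  fin_cases i <;> rfl

lemma δ_one_eq_edgeHom : (SimplexCategory.δ 1 : ⦋1⦌ ⟶ ⦋2⦌) = edgeHom 0 2 (by decide) := by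
  ext i
  fin_cases i <;> rfl

lemma δ_two_eq_edgeHom : (SimplexCategory.δ 2 : ⦋1⦌ ⟶ ⦋2⦌) = edgeHom 0 1 (by decide) := by
  ext i
  fin_cases i <;> rfl

section InnerFibration

variable {C : Type u} [Category.{v} C] {D : Type u} [Category.{v} D]

/-- The map of spans induced by a functor that lifts pullbacks is an inner fibration. -/
theorem innerFibration_spanMap (G : C ⥤ D) [PreservesLimitsOfShape WalkingCospan G]
    (hG : LiftsPullbacks G) : SSet.InnerFibration (spanMap G) := by
  rw [SSet.innerFibration_iff]
  rintro _ _ _ ⟨k, h0, hn⟩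
  rename_i n
  refine ⟨fun {σ τ} sq => hasLift_of_exists_filler sq ?_⟩
  have hy := app_evalAt sq
  rcases n with _ | n
  · have hk : ∀ k : Fin 3, 0 < k → k < Fin.last 2 → k = 1 := by decide
    obtain rfl : k = 1 := hk k h0 hn
    have h₂ := memSub_horn_δ.{max u v} (N := 1) (k := 1) 2 (by decide)
    have h₀ := memSub_horn_δ.{max u v} (N := 1) (k := 1) 0 (by decide)
    have he : (spanSSet C).map (SimplexCategory.δ 0).op (evalAt σ (SimplexCategory.δ 2) h₂) =
        (spanSSet C).map (SimplexCategory.δ 1).op (evalAt σ (SimplexCategory.δ 0) h₀) :=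
      (map_evalAt ..).trans ((evalAt_congr σ
        (SimplexCategory.δ_comp_δ (n := 0) (i := 0) (j := 1) (by decide)) _ _).trans
          (map_evalAt ..).symm)
    obtain ⟨z, hz₂, hz₀, hz⟩ := exists_triangle_inner G hG (evalAt σ (SimplexCategory.δ 2) h₂)
      (evalAt σ (SimplexCategory.δ 0) h₀) (obj_eq_of_eq he 0 0 le_rfl) (SSet.yonedaEquiv τ)
      ((hy _ _ h₂).trans (by rw [δ_two_eq_edgeHom]))
      ((hy _ _ h₀).trans (by rw [δ_zero_eq_edgeHom]))
    refine ⟨z, map_eq_evalAt_of_faces σ z fun j hj => ?_, hz⟩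
    obtain rfl | rfl : j = 0 ∨ j = 2 := by
      fin_cases j
      exacts [.inl rfl, absurd rfl hj, .inr rfl]
    · rw [← hz₀, δ_zero_eq_edgeHom]
    · rw [← hz₂, δ_two_eq_edgeHom]
  · exact exists_inner_filler G (by omega) h0 hn σ _ hy

end InnerFibration

/-- The terminal category, with objects and morphisms in prescribed universes. -/
inductive TerminalCategory : Type u where
  | pt : TerminalCategory

instance : Category.{v} TerminalCategory.{u} where
  Hom _ _ := PUnit
  id _ := PUnit.unit
  comp _ _ := PUnit.unit

section Quasicategory

instance (X Y : TerminalCategory.{u}) : Subsingleton (X ⟶ Y) :=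
  inferInstanceAs (Subsingleton PUnit)

lemma isPullback_terminalCategory {P A B E : TerminalCategory.{u}} (f : P ⟶ A) (g : P ⟶ B)
    (h : A ⟶ E) (i : B ⟶ E) : IsPullback f g h i :=
  ⟨⟨Subsingleton.elim _ _⟩, ⟨PullbackCone.IsLimit.mk _ (fun _ => PUnit.unit)
    (fun _ => Subsingleton.elim _ _) (fun _ => Subsingleton.elim _ _)
    (fun _ _ _ _ => Subsingleton.elim _ _)⟩⟩

variable (C : Type u) [Category.{v} C]

/-- The functor from `C` to the terminal category. -/
def toTerminalCategory : C ⥤ TerminalCategory.{u} where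
  obj _ := .pt
  map _ := PUnit.unit

instance : PreservesLimitsOfShape WalkingCospan (toTerminalCategory.{v} C) where
  preservesLimit := ⟨fun _ => ⟨{
    lift := fun _ => PUnit.unit
    fac := fun _ _ => Subsingleton.elim _ _
    uniq := fun _ _ _ => Subsingleton.elim _ _ }⟩⟩

lemma liftsPullbacks_toTerminalCategory [HasPullbacks C] :
    LiftsPullbacks (toTerminalCategory.{v} C) := fun f g _ _ _ _ =>
  ⟨pullback f g, rfl, pullback.fst f g, pullback.snd f g, IsPullback.of_hasPullback f g,
    Subsingleton.elim _ _, Subsingleton.elim _ _⟩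

instance : SSet.Quasicategory (spanSSet.{v} TerminalCategory.{u}) where
  hornFilling' n i σ _ _ := by
    have hF : ∀ m : SimplexCategory, PullbackProperty ((Functor.const (SubintervalPoset m)).obj
        TerminalCategory.pt.{u}) :=
      fun m I J U K _ _ _ _ _ _ => isPullback_terminalCategory _ _ _ _
    have : ∀ m : SimplexCategoryᵒᵖ, Subsingleton ((spanSSet.{v} TerminalCategory.{u}).obj m) :=
      fun m => ⟨fun x y => Subtype.ext (CategoryTheory.Functor.ext (fun _ => rfl)
        (fun _ _ _ => Subsingleton.elim _ _))⟩
    refine ⟨SSet.yonedaEquiv.symm ⟨_, hF _⟩, ?_⟩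
    ext m x
    exact Subsingleton.elim _ _

/-- `Span(C)` is a quasicategory: it is inner fibrant over the spans of the terminal category, which
have just one cell in each dimension. -/
theorem quasicategory_spanSSet [HasPullbacks C] : SSet.Quasicategory (spanSSet C) := by
  have := innerFibration_spanMap _ (liftsPullbacks_toTerminalCategory.{v} C)
  exact SSet.quasicategory_of_innerFibration (spanMap (toTerminalCategory.{v} C))

end Quasicategory

/-! ### Ordinal sums of small ordinals -/

section OrdinalSum

lemma simplexCategory_hom_ext_of_val {a b : ℕ} {φ ψ : ⦋a⦌ ⟶ ⦋b⦌}
    (h : ∀ i : Fin (a + 1), ((φ.toOrderHom i : Fin (b + 1)) : ℕ) = (ψ.toOrderHom i : Fin (b + 1))) :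
    φ = ψ :=
  SimplexCategory.Hom.ext _ _ (OrderHom.ext _ _ (funext fun i => Fin.ext (h i)))

lemma δ_toOrderHom_val {n : ℕ} (i : Fin (n + 2)) (x : Fin (n + 1)) :
    (((SimplexCategory.δ i).toOrderHom x : Fin (n + 2)) : ℕ) =
      if (x : ℕ) < i then (x : ℕ) else x + 1 := by
  have e : (SimplexCategory.δ i).toOrderHom x = i.succAbove x := rfl
  rw [e, Fin.succAbove]
  simp only [Fin.lt_def, Fin.val_castSucc]
  split_ifs <;> rfl

lemma ordinalSumMap_δ_id_one (m : ℕ) (i : Fin (m + 2)) :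
    ordinalSumMap (SimplexCategory.δ i) (𝟙 ⦋1⦌) =
      (SimplexCategory.δ (i.castSucc.castSucc) : ⦋m + 2⦌ ⟶ ⦋m + 3⦌) := by
  refine simplexCategory_hom_ext_of_val (a := m + 2) (b := m + 3) fun x => ?_
  rw [δ_toOrderHom_val]
  refine Fin.addCases (m := m + 1) (n := 2) (fun j => ?_) (fun j => ?_) x
  · rw [ordinalSumMap_left]
    exact δ_toOrderHom_val i j
  · rw [ordinalSumMap_right]
    have hi := i.isLt
    have e : ((Fin.natAdd (m + 1) j : Fin (m + 1 + 2)) : ℕ) = m + 1 + j := rfl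
    have e' : ((i.castSucc.castSucc : Fin (m + 4)) : ℕ) = i := rfl
    change m + 2 + (j : ℕ) = _
    rw [e, e', if_neg (by omega)]
    omega

lemma ordinalSumMap_δ_id_zero (m : ℕ) (i : Fin (m + 2)) :
    ordinalSumMap (SimplexCategory.δ i) (𝟙 ⦋0⦌) =
      (SimplexCategory.δ i.castSucc : ⦋m + 1⦌ ⟶ ⦋m + 2⦌) := by
  refine simplexCategory_hom_ext_of_val (a := m + 1) (b := m + 2) fun x => ?_
  rw [δ_toOrderHom_val]
  refine Fin.addCases (m := m + 1) (n := 1) (fun j => ?_) (fun j => ?_) x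
  · rw [ordinalSumMap_left]
    exact δ_toOrderHom_val i j
  · rw [ordinalSumMap_right]
    have hi := i.isLt
    have e : ((Fin.natAdd (m + 1) j : Fin (m + 1 + 1)) : ℕ) = m + 1 + j := rfl
    have e' : ((i.castSucc : Fin (m + 3)) : ℕ) = i := rfl
    change m + 2 + (j : ℕ) = _
    rw [e, e', if_neg (by omega)]
    omega

lemma ordinalSumMap_id_δ_zero (m : ℕ) :
    ordinalSumMap (𝟙 ⦋m⦌) (SimplexCategory.δ (0 : Fin 2)) =
      (SimplexCategory.δ (Fin.last (m + 1)).castSucc : ⦋m + 1⦌ ⟶ ⦋m + 2⦌) := by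
  refine simplexCategory_hom_ext_of_val (a := m + 1) (b := m + 2) fun x => ?_
  rw [δ_toOrderHom_val]
  refine Fin.addCases (m := m + 1) (n := 1) (fun j => ?_) (fun j => ?_) x
  · rw [ordinalSumMap_left]
    have hj := j.isLt
    have e : ((Fin.castAdd 1 j : Fin (m + 1 + 1)) : ℕ) = j := rfl
    have e' : (((Fin.last (m + 1)).castSucc : Fin (m + 3)) : ℕ) = m + 1 := rfl
    change (j : ℕ) = _
    rw [e, e', if_pos hj]
  · rw [ordinalSumMap_right]
    have e : ((Fin.natAdd (m + 1) j : Fin (m + 1 + 1)) : ℕ) = m + 1 + j := rfl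
    have e' : (((Fin.last (m + 1)).castSucc : Fin (m + 3)) : ℕ) = m + 1 := rfl
    have e'' := δ_toOrderHom_val (0 : Fin 2) j
    rw [if_neg (by simp)] at e''
    change m + 1 + (((SimplexCategory.δ (0 : Fin 2)).toOrderHom j : Fin 2) : ℕ) = _
    rw [e, e', e'', if_neg (by omega)]
    omega

lemma ordinalSumInr_one (m : ℕ) : ordinalSumInr ⦋m⦌ ⦋1⦌ =
    (edgeHom (Fin.last (m + 1)).castSucc (Fin.last (m + 2)) (Fin.le_last _) : ⦋1⦌ ⟶ ⦋m + 2⦌) := by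
  refine simplexCategory_hom_ext_of_val (a := 1) (b := m + 2) fun x => ?_
  fin_cases x <;> rfl

lemma ordinalSumInr_zero_zero :
    ordinalSumInr ⦋0⦌ ⦋0⦌ = (SimplexCategory.δ 0 : ⦋0⦌ ⟶ ⦋1⦌) := by
  refine simplexCategory_hom_ext_of_val (a := 0) (b := 1) fun x => ?_
  fin_cases x
  rfl

lemma ordinalSumInr_zero_one :
    ordinalSumInr ⦋0⦌ ⦋1⦌ = (SimplexCategory.δ 0 : ⦋1⦌ ⟶ ⦋2⦌) := by
  refine simplexCategory_hom_ext_of_val (a := 1) (b := 2) fun x => ?_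
  fin_cases x <;> rfl

end OrdinalSum

/-! ### Cartesian edges in terms of horns -/

section OverSSet

variable {X Y : SSet.{w}} {k : SimplexCategory} {τ : X.obj (op k)} {m : ℕ}

namespace overSSet

/-- The simplex `Δ^m ⋆ Δ^k → X` of a simplex `Δ^m → X_{/τ}`. -/
def val (t : Δ[m] ⟶ overSSet X τ) : X.obj (op (ordinalSum ⦋m⦌ k)) := (SSet.yonedaEquiv t).1

lemma map_inr_val (t : Δ[m] ⟶ overSSet X τ) : X.map (ordinalSumInr ⦋m⦌ k).op (val t) = τ :=
  (SSet.yonedaEquiv t).2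

lemma val_injective {t t' : Δ[m] ⟶ overSSet X τ} (h : val t = val t') : t = t' :=
  SSet.yonedaEquiv.injective (Subtype.ext h)

/-- The simplex `Δ^m → X_{/τ}` of a simplex `Δ^m ⋆ Δ^k → X` that ends in `τ`. -/
def ofVal (z : X.obj (op (ordinalSum ⦋m⦌ k))) (h : X.map (ordinalSumInr ⦋m⦌ k).op z = τ) :
    Δ[m] ⟶ overSSet X τ :=
  SSet.yonedaEquiv.symm ⟨z, h⟩

lemma val_ofVal (z : X.obj (op (ordinalSum ⦋m⦌ k)))
    (h : X.map (ordinalSumInr ⦋m⦌ k).op z = τ) : val (ofVal z h) = z :=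
  congrArg (fun t : (overSSet X τ) _⦋m⦌ => (show { a : X.obj (op (ordinalSum ⦋m⦌ k)) //
    X.map (ordinalSumInr ⦋m⦌ k).op a = τ } from t).1)
    (Equiv.apply_symm_apply SSet.yonedaEquiv _)

lemma val_comp_restrict (t : Δ[m] ⟶ overSSet X τ) {j : SimplexCategory} (θ : j ⟶ k)
    {τ' : X.obj (op j)} (h : X.map θ.op τ = τ') :
    val (t ≫ restrict θ h) = X.map (ordinalSumMap (𝟙 ⦋m⦌) θ).op (val t) := rfl

lemma val_comp_map (t : Δ[m] ⟶ overSSet X τ) (p : X ⟶ Y) {ρ : Y.obj (op k)}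
    (h : p.app _ τ = ρ) : val (t ≫ map p h) = p.app _ (val t) := rfl

lemma val_δ_comp (t : Δ[m + 1] ⟶ overSSet X τ) (i : Fin (m + 2)) :
    val (SSet.stdSimplex.δ i ≫ t) =
      X.map (ordinalSumMap (SimplexCategory.δ i) (𝟙 k)).op (val t) :=
  congrArg Subtype.val (SSet.yonedaEquiv_naturality (SimplexCategory.δ i) t).symm

end overSSet

end OverSSet

section Cartesian

variable {X Y : SSet.{w}} {p : X ⟶ Y} {f : X _⦋1⦌} {m : ℕ}

/-- The target `C_{/y} ×_{D_{/py}} D_{/pf}` of the comparison map. -/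
noncomputable abbrev overComparisonTarget (p : X ⟶ Y) (f : X _⦋1⦌) : SSet.{w} := pullback
  (overSSet.map p rfl : overSSet X (edgeTarget f) ⟶ overSSet Y (p.app _ (edgeTarget f)))
  (overSSet.restrict (SimplexCategory.δ 0) (NatTrans.naturality_apply p _ f).symm :
    overSSet Y (p.app _ f) ⟶ overSSet Y (p.app _ (edgeTarget f)))

/-- The component in `C_{/y}` of a simplex of `C_{/y} ×_{D_{/py}} D_{/pf}`. -/
noncomputable def overFst (v : Δ[m] ⟶ overComparisonTarget p f) : X _⦋m + 1⦌ :=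
  overSSet.val (v ≫ pullback.fst _ _)

/-- The component in `D_{/pf}` of a simplex of `C_{/y} ×_{D_{/py}} D_{/pf}`. -/
noncomputable def overSnd (v : Δ[m] ⟶ overComparisonTarget p f) : Y _⦋m + 2⦌ :=
  overSSet.val (v ≫ pullback.snd _ _)

lemma app_overFst (v : Δ[m] ⟶ overComparisonTarget p f) : p.app _ (overFst v) =
    Y.map (SimplexCategory.δ (Fin.last (m + 1)).castSucc).op (overSnd v) := by
  have h := congrArg (fun t : overComparisonTarget p f ⟶ overSSet Y (p.app _ (edgeTarget f)) =>
    overSSet.val (v ≫ t)) pullback.condition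
  rw [← ordinalSumMap_id_δ_zero]
  exact h

lemma hom_overComparisonTarget_ext {v v' : Δ[m] ⟶ overComparisonTarget p f}
    (h₁ : overFst v = overFst v') (h₂ : overSnd v = overSnd v') : v = v' :=
  pullback.hom_ext (overSSet.val_injective h₁) (overSSet.val_injective h₂)

lemma overFst_comp_overComparison (t : Δ[m] ⟶ overSSet X f) : overFst (t ≫ overComparison p f) =
    X.map (SimplexCategory.δ (Fin.last (m + 1)).castSucc).op (overSSet.val t) := by
  rw [← ordinalSumMap_id_δ_zero]
  refine Eq.trans ?_ (overSSet.val_comp_restrict t (SimplexCategory.δ 0) rfl)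
  exact congrArg overSSet.val ((Category.assoc _ _ _).trans
    (congrArg (t ≫ ·) (pullback.lift_fst _ _ _)))

lemma overSnd_comp_overComparison (t : Δ[m] ⟶ overSSet X f) :
    overSnd (t ≫ overComparison p f) = p.app _ (overSSet.val t) := by
  refine Eq.trans ?_ (overSSet.val_comp_map t p rfl)
  exact congrArg overSSet.val ((Category.assoc _ _ _).trans
    (congrArg (t ≫ ·) (pullback.lift_snd _ _ _)))

lemma overFst_δ_comp (v : Δ[m + 1] ⟶ overComparisonTarget p f) (i : Fin (m + 2)) :
    overFst (SSet.stdSimplex.δ i ≫ v) =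
      X.map (SimplexCategory.δ i.castSucc).op (overFst v) := by
  rw [← ordinalSumMap_δ_id_zero]
  refine Eq.trans ?_ (overSSet.val_δ_comp (v ≫ pullback.fst _ _) i)
  exact congrArg overSSet.val (Category.assoc _ _ _)

lemma overSnd_δ_comp (v : Δ[m + 1] ⟶ overComparisonTarget p f) (i : Fin (m + 2)) :
    overSnd (SSet.stdSimplex.δ i ≫ v) =
      Y.map (SimplexCategory.δ i.castSucc.castSucc).op (overSnd v) := by
  rw [← ordinalSumMap_δ_id_one]
  refine Eq.trans ?_ (overSSet.val_δ_comp (v ≫ pullback.snd _ _) i)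
  exact congrArg overSSet.val (Category.assoc _ _ _)

/-- A simplex that ends in `f` and has the prescribed components solves the lifting problem. -/
lemma hasLift_overComparison {u : (SSet.boundary.{w} m : SSet.{w}) ⟶ overSSet X f}
    {v : Δ[m] ⟶ overComparisonTarget p f}
    (sq : CommSq u (SSet.boundary m).ι (overComparison p f) v) (z : X _⦋m + 2⦌)
    (hf : X.map (ordinalSumInr ⦋m⦌ ⦋1⦌).op z = f)
    (h₁ : X.map (SimplexCategory.δ (Fin.last (m + 1)).castSucc).op z = overFst v)
    (h₂ : p.app _ z = overSnd v)
    (hu : (SSet.boundary m).ι ≫ overSSet.ofVal z hf = u) : sq.HasLift := by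
  refine ⟨⟨⟨_, hu, hom_overComparisonTarget_ext ?_ ?_⟩⟩⟩
  · rw [overFst_comp_overComparison]
    exact (congrArg
      (fun t : X _⦋m + 2⦌ => X.map (SimplexCategory.δ (Fin.last (m + 1)).castSucc).op t)
      (overSSet.val_ofVal (k := ⦋1⦌) (m := m) z hf)).trans h₁
  · rw [overSnd_comp_overComparison]
    exact (congrArg (fun t : X _⦋m + 2⦌ => p.app _ t)
      (overSSet.val_ofVal (k := ⦋1⦌) (m := m) z hf)).trans h₂

/-- An edge `f` is `p`-cartesian if `p` has the right lifting property with respect to the horns of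
dimension at least two that lack the face opposite to the last vertex, for those
lifting problems in which the last edge is mapped to `f`. -/
theorem isCartesianEdge_of_fillers
    (h₂ : ∀ (g : X _⦋1⦌) (y : Y _⦋2⦌), edgeTarget g = edgeTarget f →
      p.app _ g = Y.map (SimplexCategory.δ 1).op y → p.app _ f = Y.map (SimplexCategory.δ 0).op y →
      ∃ z : X _⦋2⦌, X.map (SimplexCategory.δ 0).op z = f ∧
        X.map (SimplexCategory.δ 1).op z = g ∧ p.app _ z = y)
    (h₃ : ∀ (n : ℕ) (σ : (SSet.horn.{w} (n + 3) (Fin.last (n + 3)) : SSet.{w}) ⟶ X)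
      (y : Y _⦋n + 3⦌),
      (∀ (m : ℕ) (s : ⦋m⦌ ⟶ ⦋n + 3⦌) (hs : MemSub (SSet.horn.{w} (n + 3) (Fin.last (n + 3))) s),
        p.app _ (evalAt σ s hs) = Y.map s.op y) →
      evalAt σ (edgeHom (Fin.last (n + 2)).castSucc (Fin.last (n + 3)) (Fin.le_last _))
        (memSub_horn_edge (by omega) _ _ _) = f →
      ∃ z : X _⦋n + 3⦌,
        (∀ (m : ℕ) (s : ⦋m⦌ ⟶ ⦋n + 3⦌) (hs : MemSub (SSet.horn (n + 3) (Fin.last (n + 3))) s),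
          X.map s.op z = evalAt σ s hs) ∧ p.app _ z = y) : IsCartesianEdge p f := by
  intro m
  refine ⟨fun {u v} sq => ?_⟩
  rcases m with _ | n
  · have e₁ := overSSet.map_inr_val (v ≫ pullback.fst _ _)
    have e₂ := overSSet.map_inr_val (v ≫ pullback.snd _ _)
    rw [ordinalSumInr_zero_zero] at e₁
    rw [ordinalSumInr_zero_one] at e₂
    obtain ⟨z, hz₀, hz₁, hz⟩ := h₂ (overFst v) (overSnd v) e₁ (app_overFst v) e₂.symm
    rw [← ordinalSumInr_zero_one] at hz₀
    exact hasLift_overComparison sq z hz₀ hz₁ hz SSet.boundary.hom_ext₀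
  · -- the faces of the simplex to be constructed
    let a : Fin (n + 2) → X _⦋n + 2⦌ := fun i =>
      overSSet.val (SSet.boundary.ι i ≫ u)
    have ha : ∀ i, X.map (ordinalSumInr ⦋n⦌ ⦋1⦌).op (a i) = f := fun i =>
      overSSet.map_inr_val _
    let x : Fin (n + 3) → X _⦋n + 2⦌ := Fin.lastCases (overFst v) a
    have sq' (i : Fin (n + 2)) : (SSet.boundary.ι i ≫ u) ≫ overComparison p f =
        SSet.stdSimplex.δ i ≫ v := by
      rw [Category.assoc, sq.w]
      rfl
    have x_last : x (Fin.last (n + 2)) = overFst v := Fin.lastCases_last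
    have x_castSucc (i : Fin (n + 2)) : x i.castSucc = a i := Fin.lastCases_castSucc i
    have hy (i : Fin (n + 3)) : p.app _ (x i) =
        Y.map (SimplexCategory.δ i.castSucc).op (overSnd v) := by
      refine Fin.lastCases ?_ (fun i => ?_) i
      · rw [x_last]
        exact app_overFst v
      · rw [x_castSucc, ← overSnd_δ_comp, ← sq']
        exact (overSnd_comp_overComparison _).symm
    have ha_last (i : Fin (n + 2)) :
        X.map (SimplexCategory.δ (Fin.last (n + 1)).castSucc).op (a i) =
          X.map (SimplexCategory.δ i.castSucc).op (overFst v) := by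
      rw [← overFst_δ_comp, ← sq']
      exact (overFst_comp_overComparison _).symm
    have haa (i l : Fin (n + 2)) (h : i < l) :
        X.map (SimplexCategory.δ (l.castSucc.castSucc.pred (Fin.ne_zero_of_lt
          (Fin.castSucc_lt_castSucc_iff.2 (Fin.castSucc_lt_castSucc_iff.2 h))))).op (a i) =
        X.map (SimplexCategory.δ i.castSucc).op (a l) := by
      rcases n with _ | n
      -- the two vertices of `∂Δ[1]` are disjoint, but as triangles of `X` they share the edge `f`
      · have hil : ∀ i l : Fin 2, i < l → i = 0 ∧ l = 1 := by decide
        obtain ⟨rfl, rfl⟩ := hil i l h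
        have e₁ := ha 0
        have e₂ := ha 1
        rw [ordinalSumInr_zero_one] at e₁ e₂
        exact e₁.trans e₂.symm
      · obtain ⟨i, rfl⟩ := Fin.eq_castSucc_of_ne_last (Fin.ne_last_of_lt h)
        obtain ⟨l, rfl⟩ := Fin.eq_succ_of_ne_zero (Fin.ne_zero_of_lt h)
        have hil : i ≤ l := Fin.castSucc_lt_succ_iff.1 h
        have e : SSet.stdSimplex.δ l ≫ SSet.boundary.ι i.castSucc =
            SSet.stdSimplex.δ i ≫ SSet.boundary.ι l.succ := by
          rw [← cancel_mono (SSet.Subcomplex.ι _), Category.assoc, Category.assoc,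
            SSet.boundary.ι_ι, SSet.boundary.ι_ι]
          exact (SSet.stdSimplex.δ_comp_δ hil).symm
        have e' := congrArg (fun t => overSSet.val (t ≫ u)) e
        have e₁ := overSSet.val_δ_comp (SSet.boundary.ι i.castSucc ≫ u) l
        have e₂ := overSSet.val_δ_comp (SSet.boundary.ι l.succ ≫ u) i
        rw [ordinalSumMap_δ_id_one] at e₁ e₂
        exact e₁.symm.trans (e'.trans e₂)
    have compat : SSet.horn.IsCompatible (i := Fin.last (n + 3))
        (fun j hj => SSet.yonedaEquiv.symm (x (j.castPred hj))) := by
      intro j k hj hk hjk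
      obtain ⟨j, rfl⟩ := Fin.eq_castSucc_of_ne_last hj
      obtain ⟨k, rfl⟩ := Fin.eq_castSucc_of_ne_last hk
      have hjk' : j < k := Fin.castSucc_lt_castSucc_iff.1 hjk
      obtain ⟨j, rfl⟩ := Fin.eq_castSucc_of_ne_last (Fin.ne_last_of_lt hjk')
      rw [SSet.stdSimplex.δ_comp_yonedaEquiv_symm, SSet.stdSimplex.δ_comp_yonedaEquiv_symm]
      congr 1
      simp only [Fin.castPred_castSucc, x_castSucc]
      revert hk hjk hjk'
      refine Fin.lastCases ?_ (fun k => ?_) k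
      · intro hk hjk hjk'
        rw [x_last]
        exact ha_last j
      · intro hk hjk hjk'
        rw [x_castSucc]
        exact haa j k (Fin.castSucc_lt_castSucc_iff.1 hjk')
    have hσ (i : Fin (n + 3)) : evalAt compat.desc (SimplexCategory.δ i.castSucc)
        (memSub_horn_δ _ (Fin.castSucc_ne_last i)) = x i := by
      have e := congrArg SSet.yonedaEquiv (compat.ι_desc i.castSucc (Fin.castSucc_ne_last i))
      rw [Equiv.apply_symm_apply, Fin.castPred_castSucc, SSet.yonedaEquiv_comp,
        SSet.horn.yonedaEquiv_ι] at e
      exact e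
    have hσy (m : ℕ) (s : ⦋m⦌ ⟶ ⦋n + 3⦌)
        (hs : MemSub (SSet.horn.{w} (n + 3) (Fin.last (n + 3))) s) :
        p.app _ (evalAt compat.desc s hs) = Y.map s.op (overSnd v) := by
      obtain ⟨j, hj, hs'⟩ := (memSub_horn_iff s).1 hs
      obtain ⟨θ, rfl⟩ := SimplexCategory.eq_comp_δ_of_not_surjective' s j hs'
      obtain ⟨j, rfl⟩ := Fin.eq_castSucc_of_ne_last hj
      rw [← map_evalAt compat.desc _ (memSub_horn_δ _ (Fin.castSucc_ne_last j)) θ, hσ,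
        NatTrans.naturality_apply, hy, op_comp, Functor.map_comp_apply]
    have hσf : evalAt compat.desc (edgeHom (Fin.last (n + 2)).castSucc (Fin.last (n + 3))
        (Fin.le_last _)) (memSub_horn_edge (by omega) _ _ _) = f := by
      have e : (edgeHom (Fin.last (n + 1)).castSucc (Fin.last (n + 2)) (Fin.le_last _) :
          ⦋1⦌ ⟶ ⦋n + 2⦌) ≫ SimplexCategory.δ (Fin.castSucc 0) =
          edgeHom (Fin.last (n + 2)).castSucc (Fin.last (n + 3)) (Fin.le_last _) := by
        refine simplexCategory_hom_ext_of_val fun x => ?_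
        fin_cases x <;> rfl
      have h₀ := hσ 0
      have e' := ha 0
      rw [ordinalSumInr_one] at e'
      exact (evalAt_congr _ e.symm _ _).trans ((map_evalAt compat.desc _
        (memSub_horn_δ _ (Fin.castSucc_ne_last 0)) _).symm.trans
          ((congrArg _ (h₀.trans (x_castSucc 0))).trans e'))
    obtain ⟨z, hz, hz'⟩ := h₃ n compat.desc (overSnd v) hσy hσf
    have hzx (i : Fin (n + 3)) : X.map (SimplexCategory.δ i.castSucc).op z = x i :=
      (hz _ _ (memSub_horn_δ _ (Fin.castSucc_ne_last i))).trans (hσ i)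
    have hf : X.map (ordinalSumInr ⦋n + 1⦌ ⦋1⦌).op z = f := by
      rw [ordinalSumInr_one]
      exact (hz _ _ _).trans hσf
    refine hasLift_overComparison sq z hf ((hzx _).trans x_last) hz'
      (SSet.boundary.hom_ext fun i => overSSet.val_injective ?_)
    refine (overSSet.val_δ_comp (overSSet.ofVal (k := ⦋1⦌) (m := n + 1) z hf) i).trans ?_
    rw [ordinalSumMap_δ_id_one]
    exact (congrArg (fun t : X _⦋n + 3⦌ => X.map (SimplexCategory.δ i.castSucc.castSucc).op t)
      (overSSet.val_ofVal (k := ⦋1⦌) (m := n + 1) z hf)).trans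
        ((hzx i.castSucc).trans (x_castSucc i))

end Cartesian

/-! ### Special edges are cartesian -/

section SpecialEdges

lemma spanVertex_ext {C : Type u} [Category.{v} C] {x y : (spanSSet C) _⦋0⦌}
    (h : x.1.obj (subinterval (n := ⦋0⦌) 0 0 le_rfl) =
      y.1.obj (subinterval (n := ⦋0⦌) 0 0 le_rfl)) : x = y := by
  have h₁ : ∀ i c : Fin 1, ¬ i < c := by decide
  refine Subtype.ext (subintervalFunctor_ext_of_lt (fun i j _ => ?_)
    (fun i c _ hic => absurd hic (h₁ i c)) (fun _ d j _ hdj => absurd hdj (h₁ d j)))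
  obtain rfl : i = 0 := Subsingleton.elim (α := Fin 1) _ _
  obtain rfl : j = 0 := Subsingleton.elim (α := Fin 1) _ _
  exact h

variable {C : Type (v + 1)} [LargeCategory.{v} C]
  [PreservesLimitsOfShape WalkingCospan (Arrow.rightFunc : Arrow C ⥤ C)]

theorem IsSpecialEdge.isCartesianEdge {f : (spanSSet (Arrow C)) _⦋1⦌} (hf : IsSpecialEdge f) :
    IsCartesianEdge (spanMap (Arrow.rightFunc : Arrow C ⥤ C)) f := by
  refine isCartesianEdge_of_fillers (fun g y hg h₁ h₀ => ?_) (fun n σ y hy hσ => ?_)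
  · rw [δ_one_eq_edgeHom] at h₁
    rw [δ_zero_eq_edgeHom] at h₀
    obtain ⟨z, hz₁, hz₀, hz⟩ := exists_triangle_right g f (obj_eq_of_eq hg 0 0 le_rfl) hf y h₁ h₀
    exact ⟨z, by rwa [δ_zero_eq_edgeHom], by rwa [δ_one_eq_edgeHom], hz⟩
  · refine exists_right_filler (by omega) (j := (Fin.last (n + 2)).castSucc)
      (Fin.castSucc_lt_last _) (fun b => ?_) σ y hy (by rwa [hσ])
    rcases Fin.eq_castSucc_or_eq_last b with ⟨b, rfl⟩ | rfl
    · rcases (Fin.le_last b).lt_or_eq with h | rfl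
      exacts [.inl (Fin.castSucc_lt_castSucc_iff.2 h), .inr (.inl rfl)]
    · exact .inr (.inr rfl)

/-- Every span in the base has a special lift with a given target: its right square is a
pullback, and its left leg is the identity on domains. -/
lemma exists_isSpecialEdge [HasPullbacks C] (g : (spanSSet C) _⦋1⦌)
    (y : (spanSSet (Arrow C)) _⦋0⦌)
    (hy : (spanMap (Arrow.rightFunc : Arrow C ⥤ C)).app _ y = edgeTarget g) :
    ∃ f : (spanSSet (Arrow C)) _⦋1⦌, IsSpecialEdge f ∧ edgeTarget f = y ∧
      (spanMap (Arrow.rightFunc : Arrow C ⥤ C)).app _ f = g := by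
  obtain ⟨P, A₀, A₁, f', g', rfl⟩ := exists_eq_spanEdge g
  generalize hA : (y.1.obj (subinterval (n := ⦋0⦌) 0 0 le_rfl)) = A
  have h : A.right = A₁ := (congrArg Comma.right hA).symm.trans (obj_eq_of_eq hy 0 0 le_rfl)
  subst h
  let Q : Arrow C := Arrow.mk (pullback.snd A.hom g')
  let a : Q ⟶ Arrow.mk (pullback.snd A.hom g' ≫ f') := Arrow.homMk (𝟙 _) f' (Category.id_comp _)
  let b : Q ⟶ A := Arrow.homMk (pullback.fst A.hom g') g' pullback.condition
  refine ⟨spanEdge a b, (isSpecialEdge_spanEdge_iff a b).2 ⟨IsPullback.of_hasPullback _ _,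
    inferInstanceAs (IsIso (𝟙 _))⟩, spanVertex_ext hA.symm, ?_⟩
  rw [spanMap_spanEdge]
  rfl

end SpecialEdges

/-! ### Lifting along a cartesian edge -/

section CartesianLifts

variable {X Y : SSet.{w}}

/-- A map on `∂Δ[1]` is given by two vertices. -/
lemma exists_boundary_one_desc (a b : X _⦋0⦌) : ∃ u : (SSet.boundary.{w} 1 : SSet.{w}) ⟶ X,
    SSet.boundary.ι 0 ≫ u = SSet.yonedaEquiv.symm a ∧
    SSet.boundary.ι 1 ≫ u = SSet.yonedaEquiv.symm b := by
  -- a simplex of `∂Δ[1]` is constant as it misses a vertex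
  have hconst : ∀ {m : SimplexCategoryᵒᵖ} (x : (SSet.boundary.{w} 1 : SSet.{w}).obj m) (i j),
      SSet.stdSimplex.asOrderHom x.1 i = SSet.stdSimplex.asOrderHom x.1 j := by
    intro m x i j
    by_contra h
    have h₂ : ∀ s t y : Fin 2, s ≠ t → y = s ∨ y = t := by decide
    refine x.2 fun y => ?_
    rcases h₂ _ _ y h with rfl | rfl
    exacts [⟨i, rfl⟩, ⟨j, rfl⟩]
  have hid (x : X _⦋0⦌) : X.map (SimplexCategory.const ⦋0⦌ ⦋0⦌ 0).op x = x := by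
    rw [show SimplexCategory.const ⦋0⦌ ⦋0⦌ 0 = 𝟙 _ from Subsingleton.elim _ _]
    exact ConcreteCategory.congr_hom (X.map_id (op ⦋0⦌)) x
  refine ⟨{
    app := fun m => ↾fun x => X.map (SimplexCategory.const m.unop ⦋0⦌ 0).op
      (if SSet.stdSimplex.asOrderHom x.1 0 = 1 then a else b)
    naturality := fun m n θ => by
      apply ConcreteCategory.hom_ext
      intro x
      have h := hconst x (θ.unop.toOrderHom 0) 0
      change X.map _ (if SSet.stdSimplex.asOrderHom x.1 (θ.unop.toOrderHom 0) = 1 then a else b) =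
        X.map θ (X.map _ _)
      rw [h, ← Functor.map_comp_apply]
      rfl }, ?_, ?_⟩
  · apply SSet.yonedaEquiv.injective
    rw [Equiv.apply_symm_apply]
    exact (congrArg _ (if_pos rfl)).trans (hid a)
  · apply SSet.yonedaEquiv.injective
    rw [Equiv.apply_symm_apply]
    exact (congrArg _ (if_neg (by decide))).trans (hid b)

variable {p : X ⟶ Y} {f : X _⦋1⦌}

/-- The simplex of `C_{/y} ×_{D_{/py}} D_{/pf}` with prescribed components. -/
lemma exists_hom_overComparisonTarget {m : ℕ} (x : X _⦋m + 1⦌) (y : Y _⦋m + 2⦌)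
    (hx : X.map (ordinalSumInr ⦋m⦌ ⦋0⦌).op x = edgeTarget f)
    (hy : Y.map (ordinalSumInr ⦋m⦌ ⦋1⦌).op y = p.app _ f)
    (h : p.app _ x = Y.map (SimplexCategory.δ (Fin.last (m + 1)).castSucc).op y) :
    ∃ v : Δ[m] ⟶ overComparisonTarget p f, overFst v = x ∧ overSnd v = y := by
  refine ⟨pullback.lift (overSSet.ofVal (k := ⦋0⦌) (m := m) x hx)
    (overSSet.ofVal (k := ⦋1⦌) (m := m) y hy) (overSSet.val_injective ?_), ?_, ?_⟩
  · refine (congrArg (fun t : X _⦋m + 1⦌ => p.app _ t)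
      (overSSet.val_ofVal (k := ⦋0⦌) (m := m) x hx)).trans (h.trans ?_)
    rw [← ordinalSumMap_id_δ_zero]
    exact (congrArg (fun t : Y _⦋m + 2⦌ =>
      Y.map (ordinalSumMap (𝟙 ⦋m⦌) (SimplexCategory.δ (0 : Fin 2))).op t)
      (overSSet.val_ofVal (k := ⦋1⦌) (m := m) y hy)).symm
  · exact (congrArg overSSet.val (pullback.lift_fst _ _ _)).trans
      (overSSet.val_ofVal (k := ⦋0⦌) (m := m) x hx)
  · exact (congrArg overSSet.val (pullback.lift_snd _ _ _)).trans
      (overSSet.val_ofVal (k := ⦋1⦌) (m := m) y hy)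

/-- Edges with the same target as a cartesian edge factor through it over any such factorization
in the base. -/
lemma IsCartesianEdge.exists_triangle (hf : IsCartesianEdge p f) (g : X _⦋1⦌) (y : Y _⦋2⦌)
    (hg : edgeTarget g = edgeTarget f) (h₁ : p.app _ g = Y.map (SimplexCategory.δ 1).op y)
    (h₀ : p.app _ f = Y.map (SimplexCategory.δ 0).op y) :
    ∃ z : X _⦋2⦌, X.map (SimplexCategory.δ 0).op z = f ∧
      X.map (SimplexCategory.δ 1).op z = g ∧ p.app _ z = y := by
  obtain ⟨v, hv₁, hv₂⟩ := exists_hom_overComparisonTarget (m := 0) g y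
    (by rw [ordinalSumInr_zero_zero]; exact hg) (by rw [ordinalSumInr_zero_one]; exact h₀.symm) h₁
  let u : (SSet.boundary.{w} 0 : SSet.{w}) ⟶ overSSet X f :=
    SSet.Subcomplex.homOfLE SSet.boundary_zero.le ≫ SSet.Subcomplex.isInitialBot.to _
  have sq : CommSq u (SSet.boundary 0).ι (overComparison p f) v := ⟨SSet.boundary.hom_ext₀⟩
  have := hf 0
  have hz₀ := overSSet.map_inr_val sq.lift
  have hz₁ := overFst_comp_overComparison (p := p) sq.lift
  have hz := overSnd_comp_overComparison (p := p) sq.lift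
  rw [ordinalSumInr_zero_one] at hz₀
  rw [sq.fac_right] at hz₁ hz
  exact ⟨overSSet.val sq.lift, hz₀, hz₁.symm.trans hv₁, hz.symm.trans hv₂⟩

/-- Factorizations through a cartesian edge are unique up to homotopy: three triangles that
match along a horn whose last edge is cartesian extend to a 3-simplex. -/
lemma IsCartesianEdge.exists_tetrahedron (hf : IsCartesianEdge p f) (x₀ x₁ x₂ : X _⦋2⦌)
    (y : Y _⦋3⦌) (h₀ : X.map (SimplexCategory.δ 0).op x₀ = f)
    (h₁ : X.map (SimplexCategory.δ 0).op x₁ = f)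
    (h₀₂ : X.map (SimplexCategory.δ 1).op x₀ = X.map (SimplexCategory.δ 0).op x₂)
    (h₁₂ : X.map (SimplexCategory.δ 1).op x₁ = X.map (SimplexCategory.δ 1).op x₂)
    (hy₀ : p.app _ x₀ = Y.map (SimplexCategory.δ 0).op y)
    (hy₁ : p.app _ x₁ = Y.map (SimplexCategory.δ 1).op y)
    (hy₂ : p.app _ x₂ = Y.map (SimplexCategory.δ 2).op y) :
    ∃ z : X _⦋3⦌, X.map (SimplexCategory.δ 0).op z = x₀ ∧ X.map (SimplexCategory.δ 1).op z = x₁ ∧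
      X.map (SimplexCategory.δ 2).op z = x₂ ∧ p.app _ z = y := by
  have e₅ : ordinalSumInr ⦋1⦌ ⦋0⦌ = (SimplexCategory.δ 0 ≫ SimplexCategory.δ 0 : ⦋0⦌ ⟶ ⦋2⦌) := by
    refine simplexCategory_hom_ext_of_val (a := 0) (b := 2) fun x => ?_
    fin_cases x
    rfl
  have e₆ : ordinalSumInr ⦋1⦌ ⦋1⦌ = (SimplexCategory.δ 0 ≫ SimplexCategory.δ 0 : ⦋1⦌ ⟶ ⦋3⦌) := by
    refine simplexCategory_hom_ext_of_val (a := 1) (b := 3) fun x => ?_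
    fin_cases x <;> rfl
  obtain ⟨v, hv₁, hv₂⟩ := exists_hom_overComparisonTarget (p := p) (f := f) (m := 1) x₂ y
    (by rw [e₅, op_comp, Functor.map_comp_apply, ← h₀₂, ← Functor.map_comp_apply, ← op_comp,
          show (SimplexCategory.δ 0 ≫ SimplexCategory.δ 1 : ⦋0⦌ ⟶ ⦋2⦌) =
            SimplexCategory.δ 0 ≫ SimplexCategory.δ 0 from
            SimplexCategory.δ_comp_δ_self.symm, op_comp, Functor.map_comp_apply, h₀]
        rfl)
    (by rw [e₆, op_comp, Functor.map_comp_apply, ← hy₀, ← NatTrans.naturality_apply, h₀]) hy₂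
  obtain ⟨u, hu₀, hu₁⟩ := exists_boundary_one_desc (X := overSSet X f)
    ⟨x₀, by rw [← h₀, ← ordinalSumInr_zero_one]⟩ ⟨x₁, by rw [← h₁, ← ordinalSumInr_zero_one]⟩
  have hu₀' : overSSet.val (SSet.boundary.ι 0 ≫ u) = x₀ :=
    (congrArg overSSet.val hu₀).trans (overSSet.val_ofVal (k := ⦋1⦌) (m := 0) x₀ _)
  have hu₁' : overSSet.val (SSet.boundary.ι 1 ≫ u) = x₁ :=
    (congrArg overSSet.val hu₁).trans (overSSet.val_ofVal (k := ⦋1⦌) (m := 0) x₁ _)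
  have sq : CommSq u (SSet.boundary 1).ι (overComparison p f) v := by
    refine ⟨SSet.boundary.hom_ext fun i => ?_⟩
    rw [← Category.assoc]
    apply hom_overComparisonTarget_ext
    · refine (overFst_comp_overComparison _).trans (Eq.trans ?_ (overFst_δ_comp v i).symm)
      rw [hv₁]
      fin_cases i
      · exact (congrArg (fun t : X _⦋2⦌ => X.map (SimplexCategory.δ 1).op t) hu₀').trans h₀₂
      · exact (congrArg (fun t : X _⦋2⦌ => X.map (SimplexCategory.δ 1).op t) hu₁').trans h₁₂
    · refine (overSnd_comp_overComparison _).trans (Eq.trans ?_ (overSnd_δ_comp v i).symm)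
      rw [hv₂]
      fin_cases i
      · exact (congrArg (fun t : X _⦋2⦌ => p.app _ t) hu₀').trans hy₀
      · exact (congrArg (fun t : X _⦋2⦌ => p.app _ t) hu₁').trans hy₁
  have := hf 1
  have hz₂ := overFst_comp_overComparison (p := p) sq.lift
  have hz := overSnd_comp_overComparison (p := p) sq.lift
  rw [sq.fac_right] at hz₂ hz
  have hzi (i : Fin 2) : X.map (SimplexCategory.δ i.castSucc.castSucc).op (overSSet.val sq.lift) =
      overSSet.val (SSet.boundary.ι i ≫ u) := by
    have e := overSSet.val_δ_comp sq.lift i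
    rw [ordinalSumMap_δ_id_one] at e
    refine e.symm.trans (congrArg overSSet.val ?_)
    rw [← SSet.boundary.ι_ι, Category.assoc, sq.fac_left]
  exact ⟨overSSet.val sq.lift, (hzi 0).trans hu₀', (hzi 1).trans hu₁', hz₂.symm.trans hv₁,
    hz.symm.trans hv₂⟩

end CartesianLifts

/-! ### Cartesian edges that factor through each other -/

section Comparison

variable {X Y : SSet.{w}} {p : X ⟶ Y}

/-- Fillers of horns `Λ[3,1]` relative to an inner fibration. -/
lemma exists_inner_tetrahedron [SSet.InnerFibration p] (x₀ x₂ x₃ : X _⦋2⦌) (y : Y _⦋3⦌)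
    (h₀₂ : X.map (SimplexCategory.δ 1).op x₀ = X.map (SimplexCategory.δ 0).op x₂)
    (h₀₃ : X.map (SimplexCategory.δ 2).op x₀ = X.map (SimplexCategory.δ 0).op x₃)
    (h₂₃ : X.map (SimplexCategory.δ 2).op x₂ = X.map (SimplexCategory.δ 2).op x₃)
    (hy₀ : p.app _ x₀ = Y.map (SimplexCategory.δ 0).op y)
    (hy₂ : p.app _ x₂ = Y.map (SimplexCategory.δ 2).op y)
    (hy₃ : p.app _ x₃ = Y.map (SimplexCategory.δ 3).op y) :
    ∃ z : X _⦋3⦌, X.map (SimplexCategory.δ 0).op z = x₀ ∧ X.map (SimplexCategory.δ 2).op z = x₂ ∧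
      X.map (SimplexCategory.δ 3).op z = x₃ ∧ p.app _ z = y := by
  obtain ⟨σ, hσ₀, hσ₂, hσ₃⟩ := SSet.horn₃₁.exists_desc (SSet.yonedaEquiv.symm x₀)
    (SSet.yonedaEquiv.symm x₂) (SSet.yonedaEquiv.symm x₃)
    (by rw [SSet.stdSimplex.δ_comp_yonedaEquiv_symm, SSet.stdSimplex.δ_comp_yonedaEquiv_symm]
        exact congrArg _ h₀₃)
    (by rw [SSet.stdSimplex.δ_comp_yonedaEquiv_symm, SSet.stdSimplex.δ_comp_yonedaEquiv_symm]
        exact congrArg _ h₀₂)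
    (by rw [SSet.stdSimplex.δ_comp_yonedaEquiv_symm, SSet.stdSimplex.δ_comp_yonedaEquiv_symm]
        exact congrArg _ h₂₃)
  have face {j : Fin 4} (hj : j ≠ 1) {x : X _⦋2⦌}
      (hx : p.app _ x = Y.map (SimplexCategory.δ j).op y)
      (hσ : SSet.horn.ι 1 j hj ≫ σ = SSet.yonedaEquiv.symm x) :
      SSet.horn.ι 1 j hj ≫ σ ≫ p =
        SSet.horn.ι 1 j hj ≫ (SSet.horn 3 1).ι ≫ SSet.yonedaEquiv.symm y := by
    rw [← Category.assoc, hσ, ← Category.assoc, SSet.horn.ι_ι,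
      SSet.stdSimplex.δ_comp_yonedaEquiv_symm]
    apply SSet.yonedaEquiv.injective
    rw [SSet.yonedaEquiv_comp, Equiv.apply_symm_apply, Equiv.apply_symm_apply]
    exact hx
  have sq : CommSq σ (SSet.horn 3 1).ι p (SSet.yonedaEquiv.symm y) := by
    refine ⟨SSet.horn.hom_ext' fun j hj => ?_⟩
    fin_cases j
    exacts [face _ hy₀ hσ₀, absurd rfl hj, face _ hy₂ hσ₂, face _ hy₃ hσ₃]
  have := SSet.mem_innerFibrations p _ (SSet.innerHornInclusions.intro (n := 1) 1 (by decide)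
    (by decide))
  have face' {j : Fin 4} (hj : j ≠ 1) {x : X _⦋2⦌}
      (hσ : SSet.horn.ι 1 j hj ≫ σ = SSet.yonedaEquiv.symm x) :
      X.map (SimplexCategory.δ j).op (SSet.yonedaEquiv sq.lift) = x := by
    rw [SSet.yonedaEquiv_naturality]
    apply SSet.yonedaEquiv.symm.injective
    rw [← hσ, Equiv.symm_apply_apply]
    exact (congrArg (· ≫ sq.lift) (SSet.horn.ι_ι (i := 1) (j := j) hj)).symm.trans
      ((Category.assoc _ _ _).trans (congrArg (SSet.horn.ι 1 j hj ≫ ·) sq.fac_left))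
  refine ⟨SSet.yonedaEquiv sq.lift, face' _ hσ₀, face' _ hσ₂, face' _ hσ₃, ?_⟩
  rw [← SSet.yonedaEquiv_comp, sq.fac_right, Equiv.apply_symm_apply]

lemma map_δ_δ {a b : ℕ} {φ : ⦋a⦌ ⟶ ⦋a + 1⦌} {ψ : ⦋a + 1⦌ ⟶ ⦋b⦌} {φ' : ⦋a⦌ ⟶ ⦋a + 1⦌}
    {ψ' : ⦋a + 1⦌ ⟶ ⦋b⦌} (h : φ ≫ ψ = φ' ≫ ψ') (x : X _⦋b⦌) :
    X.map φ.op (X.map ψ.op x) = X.map φ'.op (X.map ψ'.op x) := by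
  rw [← Functor.map_comp_apply, ← Functor.map_comp_apply, ← op_comp, ← op_comp, h]

lemma map_map_of_comp {a b c : ℕ} {φ : ⦋a⦌ ⟶ ⦋b⦌} {ψ : ⦋b⦌ ⟶ ⦋c⦌} {θ : ⦋a⦌ ⟶ ⦋c⦌}
    (h : φ ≫ ψ = θ) (x : X _⦋c⦌) : X.map φ.op (X.map ψ.op x) = X.map θ.op x := by
  rw [← Functor.map_comp_apply, ← op_comp, h]

lemma δ_zero_comp_triangleHom :
    SimplexCategory.δ 0 ≫ (triangleHom 0 0 1 le_rfl (by decide) : ⦋2⦌ ⟶ ⦋1⦌) = 𝟙 _ := by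
  refine simplexCategory_hom_ext_of_val fun x => ?_
  fin_cases x <;> rfl

lemma δ_one_comp_triangleHom :
    SimplexCategory.δ 1 ≫ (triangleHom 0 0 1 le_rfl (by decide) : ⦋2⦌ ⟶ ⦋1⦌) = 𝟙 _ := by
  refine simplexCategory_hom_ext_of_val fun x => ?_
  fin_cases x <;> rfl

lemma δ_two_comp_triangleHom :
    SimplexCategory.δ 2 ≫ (triangleHom 0 0 1 le_rfl (by decide) : ⦋2⦌ ⟶ ⦋1⦌) =
      edgeHom 0 0 le_rfl := by
  refine simplexCategory_hom_ext_of_val fun x => ?_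
  fin_cases x <;> rfl

/-- Suppose that `f` is cartesian, and that `f` and another edge factor through each other, by
triangles `α` and `β` whose third edges lie over an identity. Then a composite of these edges, given
by `γ`, is homotopic to an identity. Indeed the triangles combine to a factorization of `f` through
itself, which is unique up to homotopy. -/
lemma IsCartesianEdge.exists_homotopy [SSet.InnerFibration p] {f : X _⦋1⦌}
    (hf : IsCartesianEdge p f) (α β γ : X _⦋2⦌)
    (hβ₁ : X.map (SimplexCategory.δ 1).op β = f)
    (hαβ : X.map (SimplexCategory.δ 1).op α = X.map (SimplexCategory.δ 0).op β)
    (hα₀ : X.map (SimplexCategory.δ 0).op α = f)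
    (hγα : X.map (SimplexCategory.δ 2).op α = X.map (SimplexCategory.δ 0).op γ)
    (hγβ : X.map (SimplexCategory.δ 2).op β = X.map (SimplexCategory.δ 2).op γ)
    (hα : p.app _ α = Y.map (triangleHom 0 0 1 le_rfl (by decide)).op (p.app _ f))
    (hβ : p.app _ β = Y.map (triangleHom 0 0 1 le_rfl (by decide)).op (p.app _ f))
    (hγ : p.app _ γ = Y.map (triangleHom 0 0 0 le_rfl le_rfl).op (p.app _ f)) :
    ∃ κ : X _⦋2⦌, X.map (SimplexCategory.δ 0).op κ = X.map (edgeHom 0 0 le_rfl).op f ∧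
      X.map (SimplexCategory.δ 2).op κ = X.map (edgeHom 0 0 le_rfl).op f ∧
      X.map (SimplexCategory.δ 1).op κ = X.map (SimplexCategory.δ 1).op γ := by
  -- the faces of the degenerate simplices of the vertices `0, 0, 0, 1`
  have e (i : Fin 4) (hi : i ≠ 3) : SimplexCategory.δ i ≫
      (tetraHom 0 0 0 1 le_rfl le_rfl (by decide) : ⦋3⦌ ⟶ ⦋1⦌) =
        triangleHom 0 0 1 le_rfl (by decide) := by
    refine simplexCategory_hom_ext_of_val fun x => ?_
    fin_cases i
    · fin_cases x <;> rfl
    · fin_cases x <;> rfl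
    · fin_cases x <;> rfl
    · exact absurd rfl hi
  have e₃ : SimplexCategory.δ 3 ≫ (tetraHom 0 0 0 1 le_rfl le_rfl (by decide) : ⦋3⦌ ⟶ ⦋1⦌) =
        triangleHom 0 0 0 le_rfl le_rfl := by
    refine simplexCategory_hom_ext_of_val fun x => ?_
    fin_cases x <;> rfl
  let y : Y _⦋3⦌ := Y.map (tetraHom 0 0 0 1 le_rfl le_rfl (by decide)).op (p.app _ f)
  have hy (i : Fin 4) (hi : i ≠ 3) : Y.map (SimplexCategory.δ i).op y =
      Y.map (triangleHom 0 0 1 le_rfl (by decide)).op (p.app _ f) := map_map_of_comp (e i hi) _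
  obtain ⟨ω, hω₀, hω₂, hω₃, hω⟩ := exists_inner_tetrahedron α β γ y hαβ hγα hγβ
    (hα.trans (hy 0 (by decide)).symm) (hβ.trans (hy 2 (by decide)).symm)
    (hγ.trans (map_map_of_comp e₃ _).symm)
  let s : X _⦋2⦌ := X.map (triangleHom 0 0 1 le_rfl (by decide)).op f
  have hs₀ : X.map (SimplexCategory.δ 0).op s = f :=
    (map_map_of_comp δ_zero_comp_triangleHom f).trans (ConcreteCategory.congr_hom (X.map_id _) f)
  have hs₁ : X.map (SimplexCategory.δ 1).op s = f :=
    (map_map_of_comp δ_one_comp_triangleHom f).trans (ConcreteCategory.congr_hom (X.map_id _) f)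
  have hs : p.app _ s = Y.map (triangleHom 0 0 1 le_rfl (by decide)).op (p.app _ f) :=
    NatTrans.naturality_apply p _ f
  have hω₁₀ : X.map (SimplexCategory.δ 0).op (X.map (SimplexCategory.δ 1).op ω) = f := by
    refine (map_δ_δ (SimplexCategory.δ_comp_δ_self (i := 0)).symm ω).trans ?_
    exact (congrArg _ hω₀).trans hα₀
  have hω₁₁ : X.map (SimplexCategory.δ 1).op (X.map (SimplexCategory.δ 1).op ω) = f := by
    refine (map_δ_δ (SimplexCategory.δ_comp_δ_self (i := 1)) ω).trans ?_
    exact (congrArg _ hω₂).trans hβ₁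
  obtain ⟨z, hz₀, hz₁, hz₂, -⟩ := hf.exists_tetrahedron s (X.map (SimplexCategory.δ 1).op ω) s y
    hs₀ hω₁₀ (hs₁.trans hs₀.symm) (hω₁₁.trans hs₁.symm) (hs.trans (hy 0 (by decide)).symm)
    ((NatTrans.naturality_apply p _ ω).trans (congrArg _ hω)) (hs.trans (hy 2 (by decide)).symm)
  refine ⟨X.map (SimplexCategory.δ 3).op z, ?_, ?_, ?_⟩
  · refine (map_δ_δ (SimplexCategory.δ_comp_δ (i := 0) (j := 2) (by decide)) z).trans ?_
    exact (congrArg _ hz₀).trans (map_map_of_comp δ_two_comp_triangleHom f)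
  · refine (map_δ_δ (SimplexCategory.δ_comp_δ (i := 2) (j := 2) (by decide)) z).trans ?_
    exact (congrArg _ hz₂).trans (map_map_of_comp δ_two_comp_triangleHom f)
  · refine (map_δ_δ (SimplexCategory.δ_comp_δ (i := 1) (j := 2) (by decide)) z).trans ?_
    refine (congrArg _ hz₁).trans ?_
    refine (map_δ_δ (SimplexCategory.δ_comp_δ (i := 1) (j := 2) (by decide)) ω).symm.trans ?_
    exact congrArg _ hω₃

end Comparison

/-! ### Cartesian edges are special -/

section InvertibleSpans

variable {C : Type u} [Category.{v} C]

lemma isSplitEpi_fst_of_isPullback {P A B E : C} {f : P ⟶ A} {g : P ⟶ B} {a : A ⟶ E} {b : B ⟶ E}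
    (h : IsPullback f g a b) [IsSplitEpi b] : IsSplitEpi f :=
  ⟨⟨⟨h.lift (𝟙 _) (a ≫ section_ b) (by simp), h.lift_fst _ _ _⟩⟩⟩

/-- A span is invertible if both its legs are isomorphisms. -/
def IsInvertibleSpan (e : (spanSSet C) _⦋1⦌) : Prop :=
  IsIso (spanLeftLeg e) ∧ IsIso (spanRightLeg e)

lemma isInvertibleSpan_spanEdge_iff {P A B : C} (f : P ⟶ A) (g : P ⟶ B) :
    IsInvertibleSpan (spanEdge f g) ↔ IsIso f ∧ IsIso g :=
  Iff.of_eq (congrArg₂ And (congrArg (fun t : P ⟶ A => IsIso t) (spanLeftLeg_spanEdge f g))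
    (congrArg (fun t : P ⟶ B => IsIso t) (spanRightLeg_spanEdge f g)))

lemma isInvertibleSpan_degenerate (e : (spanSSet C) _⦋1⦌) :
    IsInvertibleSpan ((spanSSet C).map (edgeHom 0 0 le_rfl).op e) := by
  have h₁ : spanLeftLeg ((spanSSet C).map (edgeHom 0 0 le_rfl).op e) = 𝟙 (spanSource e) :=
    e.1.map_id _
  have h₂ : spanRightLeg ((spanSSet C).map (edgeHom 0 0 le_rfl).op e) = 𝟙 (spanSource e) :=
    e.1.map_id _
  have i : IsIso (𝟙 (spanSource e)) := inferInstance
  exact ⟨h₁.symm ▸ i, h₂.symm ▸ i⟩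

lemma IsInvertibleSpan.comp {z : (spanSSet C) _⦋2⦌}
    (h₀₁ : IsInvertibleSpan ((spanSSet C).map (edgeHom 0 1 (by decide)).op z))
    (h₁₂ : IsInvertibleSpan ((spanSSet C).map (edgeHom 1 2 (by decide)).op z)) :
    IsInvertibleSpan ((spanSSet C).map (edgeHom 0 2 (by decide)).op z) := by
  obtain ⟨O₀, O₁, O₂, O₀₁, O₁₂, O₀₂, f₀₁, g₀₁, f₁₂, g₁₂, f, g, pb, rfl⟩ :=
    exists_eq_spanTriangle z
  rw [spanTriangle_edge₀₁, isInvertibleSpan_spanEdge_iff] at h₀₁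
  rw [spanTriangle_edge₁₂, isInvertibleSpan_spanEdge_iff] at h₁₂
  rw [spanTriangle_edge₀₂, isInvertibleSpan_spanEdge_iff]
  obtain ⟨_, _⟩ := h₀₁
  obtain ⟨_, _⟩ := h₁₂
  have := pb.isIso_fst_of_isIso
  have := pb.isIso_snd_of_isIso
  exact ⟨inferInstance, inferInstance⟩

/-- If the span `(a, b)` followed by `(c, d)` is invertible, as well as `(c, d)` followed
by `(a, b)`, then `(a, b)` is invertible. Indeed all four legs are split epimorphisms, hence so are
their pullbacks, and one of these followed by `a` is an isomorphism. -/
lemma isInvertibleSpan_of_comp {z z' : (spanSSet C) _⦋2⦌} {a b : (spanSSet C) _⦋1⦌}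
    (h₀₁ : (spanSSet C).map (edgeHom 0 1 (by decide)).op z = a)
    (h₁₂ : (spanSSet C).map (edgeHom 1 2 (by decide)).op z = b)
    (h₀₂ : IsInvertibleSpan ((spanSSet C).map (edgeHom 0 2 (by decide)).op z))
    (h₀₁' : (spanSSet C).map (edgeHom 0 1 (by decide)).op z' = b)
    (h₁₂' : (spanSSet C).map (edgeHom 1 2 (by decide)).op z' = a)
    (h₀₂' : IsInvertibleSpan ((spanSSet C).map (edgeHom 0 2 (by decide)).op z')) :
    IsInvertibleSpan a := by
  have key : ∀ {P A B Q R R' : C} (a : P ⟶ A) (b : P ⟶ B) (c : Q ⟶ B) (d : Q ⟶ A)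
      (f : R ⟶ P) (g : R ⟶ Q) (f' : R' ⟶ Q) (g' : R' ⟶ P), IsPullback f g b c →
      IsPullback f' g' d a → IsIso (f ≫ a) → IsIso (g ≫ d) → IsIso (f' ≫ c) → IsIso (g' ≫ b) →
      IsIso a ∧ IsIso b := by
    intro P A B Q R R' a b c d f g f' g' pb pb' _ _ _ _
    have ha : IsSplitEpi a := ⟨⟨⟨inv (f ≫ a) ≫ f, by simp⟩⟩⟩
    have hb : IsSplitEpi b := ⟨⟨⟨inv (g' ≫ b) ≫ g', by simp⟩⟩⟩
    have hc : IsSplitEpi c := ⟨⟨⟨inv (f' ≫ c) ≫ f', by simp⟩⟩⟩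
    have hd : IsSplitEpi d := ⟨⟨⟨inv (g ≫ d) ≫ g, by simp⟩⟩⟩
    have := isSplitEpi_fst_of_isPullback pb
    have := isSplitEpi_fst_of_isPullback pb'.flip
    have : Mono f := mono_of_mono f a
    have : Mono g' := mono_of_mono g' b
    have := isIso_of_mono_of_isSplitEpi f
    have := isIso_of_mono_of_isSplitEpi g'
    exact ⟨IsIso.of_isIso_comp_left f a, IsIso.of_isIso_comp_left g' b⟩
  obtain ⟨O₀, O₁, O₂, O₀₁, O₁₂, O₀₂, f₀₁, g₀₁, f₁₂, g₁₂, f, g, pb, rfl⟩ :=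
    exists_eq_spanTriangle z
  obtain ⟨O₀', O₁', O₂', O₀₁', O₁₂', O₀₂', f₀₁', g₀₁', f₁₂', g₁₂', f', g', pb', rfl⟩ :=
    exists_eq_spanTriangle z'
  rw [spanTriangle_edge₀₁] at h₀₁ h₀₁'
  rw [spanTriangle_edge₁₂] at h₁₂ h₁₂'
  rw [spanTriangle_edge₀₂, isInvertibleSpan_spanEdge_iff] at h₀₂ h₀₂'
  subst h₀₁ h₁₂
  obtain ⟨rfl, rfl, rfl, h₁, h₂⟩ := spanEdge_inj h₀₁'
  obtain ⟨rfl, rfl, rfl, h₃, h₄⟩ := spanEdge_inj h₁₂'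
  obtain rfl := eq_of_heq h₁
  obtain rfl := eq_of_heq h₂
  obtain rfl := eq_of_heq h₃
  obtain rfl := eq_of_heq h₄
  exact (isInvertibleSpan_spanEdge_iff _ _).2
    (key _ _ _ _ f g f' g' pb pb' h₀₂.1 h₀₂.2 h₀₂'.1 h₀₂'.2)

end InvertibleSpans

section CartesianImpSpecial

variable {C : Type (v + 1)} [LargeCategory.{v} C]

/-- The composite of an invertible span with a special one is special. -/
lemma IsSpecialEdge.comp_of_isInvertibleSpan {z : (spanSSet (Arrow C)) _⦋2⦌}
    (h₁₂ : IsSpecialEdge ((spanSSet (Arrow C)).map (edgeHom 1 2 (by decide)).op z))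
    (h₀₁ : IsInvertibleSpan ((spanSSet (Arrow C)).map (edgeHom 0 1 (by decide)).op z)) :
    IsSpecialEdge ((spanSSet (Arrow C)).map (edgeHom 0 2 (by decide)).op z) := by
  obtain ⟨O₀, O₁, O₂, O₀₁, O₁₂, O₀₂, f₀₁, g₀₁, f₁₂, g₁₂, f, g, pb, rfl⟩ :=
    exists_eq_spanTriangle z
  rw [spanTriangle_edge₀₁, isInvertibleSpan_spanEdge_iff] at h₀₁
  rw [spanTriangle_edge₁₂, isSpecialEdge_spanEdge_iff] at h₁₂
  rw [spanTriangle_edge₀₂, isSpecialEdge_spanEdge_iff]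
  obtain ⟨_, _⟩ := h₀₁
  obtain ⟨h, hi⟩ := h₁₂
  have := pb.isIso_snd_of_isIso
  have hg : IsPullback g.left O₀₂.hom O₁₂.hom g.right := IsPullback.of_horiz_isIso ⟨Arrow.w g⟩
  have := (isPullback_left pb).isIso_fst_of_isIso
  refine ⟨hg.paste_horiz h, ?_⟩
  exact inferInstanceAs (IsIso (f.left ≫ f₀₁.left))

variable [PreservesLimitsOfShape WalkingCospan (Arrow.rightFunc : Arrow C ⥤ C)] [HasPullbacks C]

/-- A cartesian edge differs by an invertible span from the special lift with the same target of
the same edge. -/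
theorem IsCartesianEdge.isSpecialEdge {F : (spanSSet (Arrow C)) _⦋1⦌}
    (hF : IsCartesianEdge (spanMap (Arrow.rightFunc : Arrow C ⥤ C)) F) : IsSpecialEdge F := by
  let p := spanMap (Arrow.rightFunc : Arrow C ⥤ C)
  have : SSet.InnerFibration p := innerFibration_spanMap _ liftsPullbacks_rightFunc
  obtain ⟨F', hF', ht, hp⟩ := exists_isSpecialEdge (p.app _ F) (edgeTarget F)
    (NatTrans.naturality_apply p _ F)
  have hc := hF'.isCartesianEdge
  let y := (spanSSet C).map (triangleHom 0 0 1 le_rfl (by decide)).op (p.app _ F)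
  let y' := (spanSSet C).map (triangleHom 0 0 0 le_rfl le_rfl).op (p.app _ F)
  have hy₀ : (spanSSet C).map (SimplexCategory.δ 0).op y = p.app _ F :=
    (map_map_of_comp δ_zero_comp_triangleHom _).trans
      (ConcreteCategory.congr_hom ((spanSSet C).map_id _) _)
  have hy₁ : (spanSSet C).map (SimplexCategory.δ 1).op y = p.app _ F :=
    (map_map_of_comp δ_one_comp_triangleHom _).trans
      (ConcreteCategory.congr_hom ((spanSSet C).map_id _) _)
  have hy₂ : (spanSSet C).map (SimplexCategory.δ 2).op y =
      (spanSSet C).map (edgeHom 0 0 le_rfl).op (p.app _ F) :=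
    map_map_of_comp δ_two_comp_triangleHom _
  -- `F` and `F'` factor through each other, by means of `G = δ₂ β` and `H = δ₂ α`
  obtain ⟨β, hβ₀, hβ₁, hβ⟩ := hc.exists_triangle F y ht.symm hy₁.symm (hp.trans hy₀.symm)
  obtain ⟨α, hα₀, hα₁, hα⟩ := hF.exists_triangle F' y ht (hp.trans hy₁.symm) hy₀.symm
  let G := (spanSSet (Arrow C)).map (SimplexCategory.δ 2).op β
  let H := (spanSSet (Arrow C)).map (SimplexCategory.δ 2).op α
  have hG : p.app _ G = (spanSSet C).map (edgeHom 0 0 le_rfl).op (p.app _ F) :=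
    (NatTrans.naturality_apply p _ β).trans ((congrArg _ hβ).trans hy₂)
  have hH : p.app _ H = (spanSSet C).map (edgeHom 0 0 le_rfl).op (p.app _ F) :=
    (NatTrans.naturality_apply p _ α).trans ((congrArg _ hα).trans hy₂)
  have hy'₀₁ : (spanSSet C).map (edgeHom 0 1 (by decide)).op y' =
      (spanSSet C).map (edgeHom 0 0 le_rfl).op (p.app _ F) :=
    map_map_of_comp (simplexCategory_hom_ext_of_val fun x => by fin_cases x <;> rfl) _
  have hy'₁₂ : (spanSSet C).map (edgeHom 1 2 (by decide)).op y' =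
      (spanSSet C).map (edgeHom 0 0 le_rfl).op (p.app _ F) :=
    map_map_of_comp (simplexCategory_hom_ext_of_val fun x => by fin_cases x <;> rfl) _
  have hGH : spanTarget G = spanSource H :=
    (congrArg spanSource hβ₀).trans (congrArg spanSource hα₁).symm
  have hHG : spanTarget H = spanSource G :=
    (congrArg spanSource hα₀).trans (congrArg spanSource hβ₁).symm
  obtain ⟨γ, hγ₀₁, hγ₁₂, hγ⟩ := exists_triangle_inner _ liftsPullbacks_rightFunc G H hGH y'
    (hG.trans hy'₀₁.symm) (hH.trans hy'₁₂.symm)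
  obtain ⟨γ', hγ'₀₁, hγ'₁₂, hγ'⟩ := exists_triangle_inner _ liftsPullbacks_rightFunc H G hHG y'
    (hH.trans hy'₀₁.symm) (hG.trans hy'₁₂.symm)
  obtain ⟨κ, hκ₀, hκ₂, hκ₁⟩ := hF.exists_homotopy α β γ hβ₁ (hα₁.trans hβ₀.symm) hα₀
    (by rw [δ_zero_eq_edgeHom]; exact hγ₁₂.symm) (hγ₀₁.symm.trans (by rw [δ_two_eq_edgeHom]))
    hα hβ hγ
  obtain ⟨κ', hκ'₀, hκ'₂, hκ'₁⟩ := hc.exists_homotopy β α γ' hα₁ (hβ₁.trans hα₀.symm) hβ₀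
    (by rw [δ_zero_eq_edgeHom]; exact hγ'₁₂.symm) (hγ'₀₁.symm.trans (by rw [δ_two_eq_edgeHom]))
    (by rw [hp]; exact hβ) (by rw [hp]; exact hα) (by rw [hp]; exact hγ')
  rw [δ_zero_eq_edgeHom] at hκ₀ hκ'₀ hβ₀
  rw [δ_one_eq_edgeHom] at hκ₁ hκ'₁ hβ₁
  rw [δ_two_eq_edgeHom] at hκ₂ hκ'₂
  have inv : IsInvertibleSpan G := isInvertibleSpan_of_comp hγ₀₁ hγ₁₂
    (hκ₁ ▸ IsInvertibleSpan.comp (hκ₂ ▸ isInvertibleSpan_degenerate _)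
      (hκ₀ ▸ isInvertibleSpan_degenerate _)) hγ'₀₁ hγ'₁₂
    (hκ'₁ ▸ IsInvertibleSpan.comp (hκ'₂ ▸ isInvertibleSpan_degenerate _)
      (hκ'₀ ▸ isInvertibleSpan_degenerate _))
  rw [← hβ₁]
  exact IsSpecialEdge.comp_of_isInvertibleSpan (hβ₀.symm ▸ hF')
    (by rw [← δ_two_eq_edgeHom]; exact inv)

end CartesianImpSpecial


theorem mainTheorem8 :
    (∀ F : FinSpanTimes.{u} _⦋1⦌,
      IsCartesianEdge finSpanProj F ↔
        IsPullback (spanRightLeg F).left (spanApex F).hom (spanTarget F).hom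
          (spanRightLeg F).right ∧
        IsIso (spanLeftLeg F).left) ∧
    IsCartesianFibration finSpanProj.{u} :=
  ⟨fun _ => ⟨IsCartesianEdge.isSpecialEdge, IsSpecialEdge.isCartesianEdge⟩,
    { quasicategory_source := quasicategory_spanSSet _
      quasicategory_target := quasicategory_spanSSet _
      innerFibration := innerFibration_spanMap _ liftsPullbacks_rightFunc
      exists_cartesian_lift := fun g y hy => by
        obtain ⟨f, hf, h⟩ := exists_isSpecialEdge g y hy
        exact ⟨f, hf.isCartesianEdge, h⟩ }⟩
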